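/- Let $p$ be an odd prime. A $p$-adic field is a finite extension $F$ of $\mathbb{Q}_p$; write $\mathcal{O}_F$ for its ring of integers. A Hopf–Galois structure on a finite extension $L/K$ is a finite-dimensional cocommutative $K$-Hopf algebra $H$ together with a $K$-linear action of $H$ on $L$ that makes $L$ an $H$-module algebra and for which the map $L\otimes_K H\to\mathrm{End}_K(L)$, $x\otimes h\mapsto (y\mapsto x(h\cdot y))$, is bijective; Hopf–Galois structures are identified when there is an isomorphism of Hopf algebras compatible with the actions. If $L/K$ is an extension of $p$-adic fields, the associated order is $\mathfrak{A}_H=\{h\in H : h\cdot\mathcal{O}_L\subseteq\mathcal{O}_L\}$. A separable extension $L/K$ with normal closure $\widetilde L$ is almost classically Galois with Galois complement $M$ if $\mathrm{Gal}(\widetilde L/K)$ has a normal subgroup $J$ that is a complement of $\mathrm{Gal}(\widetilde L/L)$ and $M=\widetilde L^{J}$. Let $L/K$ be a totally ramified extension of $p$-adic fields of degree $p$, with normal closure $\widetilde L$, and let $L'$ (resp. $K'$) be the inertia field of $\widetilde L/L$ (resp. $\widetilde L/K$), i.e. the fixed field in $\widetilde L$ of the inertia group. Then $K'\subseteq L'$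 and: 1. $L'/K'$ is an extension of $p$-adic fields of degree $p$ whose normal closure is $\widetilde L$, and it admits a Hopf–Galois structure. 2. $\widetilde L/K'$ is totally ramified. 3. $L/K$ is almost classically Galois, and if $M$ is a Galois complement of $L/K$, then $K'\subseteq M$ and $L'/K'$ is almost classically Galois with Galois complement $M$. Moreover $L/K$ admits a Hopf–Galois structure, and for every Hopf–Galois structure $H$ on $L/K$: 4. There is exactly one action of the $K'$-Hopf algebra $H'=K'\otimes_K H$ on $L'$ by $K'$-linear maps with $(a\otimes h)\cdot x=a\,(h\cdot x)$ for $a\in K'$, $h\in H$, $x\in L$; with this action $H'$ is a Hopf–Galois structure on $L'/K'$, and it is the only one. 5. The natural map $\mathcal{O}_{K'}\otimes_{\mathcal{O}_K}\mathfrak{A}_H\to K'\otimes_K H$, $a\otimes h\mapsto a\otimes h$, is an isomorphism of $\mathcal{O}_{K'}$-algebras onto $\mathfrak{A}_{H'}$, and $\mathcal{O}_{L'}$ is a free $\mathfrak{A}_{H'}$-module if and only if $\mathcal{O}_L$ is a free $\mathfrak{A}_H$-module. -/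

import Mathlib

open scoped TensorProduct

universe u v w z

noncomputable section

namespace HopfGaloisDegP

instance intermediateFieldTower (p : ℕ) [Fact p.Prime] {K : Type*} {N : Type*} [Field K] [Field N]
    [Algebra K N] [Algebra ℤ_[p] K] [Algebra ℤ_[p] N] [IsScalarTower ℤ_[p] K N]
    (S : IntermediateField K N) : IsScalarTower ℤ_[p] S N where
  smul_assoc r s n := by
    change (r • (s : N)) * n = r • ((s : N) * n)
    exact smul_mul_assoc r (s : N) n

/-! ### Rings of integers of `p`-adic fields, ramification, inertia fields -/

section Integers

variable (p : ℕ) [Fact p.Prime]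

/-- The ring of integers `𝒪_F` of a `p`-adic field `F`: the integral closure of `ℤ_p` in `F`. -/
abbrev intRing (F : Type*) [Field F] [Algebra ℤ_[p] F] : Subalgebra ℤ_[p] F :=
  integralClosure ℤ_[p] F

/-- The maximal ideal of the local ring `𝒪_F`, written as its Jacobson radical
(the intersection of all maximal ideals). -/
def maxIdeal (F : Type*) [Field F] [Algebra ℤ_[p] F] : Ideal (intRing p F) :=
  Ring.jacobson (intRing p F)

variable (F E : Type*) [Field F] [Field E] [Algebra ℤ_[p] F] [Algebra ℤ_[p] E] [Algebra F E]
  [IsScalarTower ℤ_[p] F E]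

/-- The inclusion `𝒪_F → 𝒪_E` for an extension `E/F`. -/
def intRingMap : intRing p F →+* intRing p E :=
  ((algebraMap F E).comp (intRing p F).val.toRingHom).codRestrict (intRing p E)
    (fun x => IsIntegral.map (IsScalarTower.toAlgHom ℤ_[p] F E) x.2)

instance intRingAlgebra : Algebra (intRing p F) (intRing p E) :=
  (intRingMap p F E).toAlgebra

/-- `E/F` is totally ramified: its ramification index equals its degree. -/
def IsTotallyRamified : Prop :=
  (maxIdeal p E).ramificationIdx (intRing p F) = Module.finrank F E

/-- The inertia group of `E/F`: the automorphisms acting trivially on `𝒪_E / 𝔭_E`. -/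
def inertiaGroup : Subgroup (E ≃ₐ[F] E) :=
  (maxIdeal p E).inertia (E ≃ₐ[F] E)

/-- The inertia field of `E/F`: the fixed field of the inertia group. -/
def inertiaField : IntermediateField F E :=
  IntermediateField.fixedField (inertiaGroup p F E)

end Integers

/-! ### Almost classically Galois extensions -/

section AlmostClassical

variable {K : Type*} {N : Type*} [Field K] [Field N] [Algebra K N]

/-- `L/K` (with normal closure `N`) is almost classically Galois with Galois complement `M`:
`L/K` is separable and there is a normal subgroup `J` of `Gal(N/K)` which is a complement of
`Gal(N/L)` and whose fixed field is `M`. -/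
structure IsAlmostClassicallyGaloisWith (L M : IntermediateField K N) : Prop where
  separable : Algebra.IsSeparable K L
  normalClosure : IsNormalClosure K L N
  complement : ∃ J : Subgroup (N ≃ₐ[K] N), J.Normal ∧
    Subgroup.IsComplement' J L.fixingSubgroup ∧ M = IntermediateField.fixedField J

end AlmostClassical

/-! ### Hopf-Galois structures -/

section HopfGalois

variable {K : Type*} {L : Type*} {H : Type*} [Field K] [Field L] [Algebra K L] [Ring H]
  [HopfAlgebra K H]

/-- A `K`-linear action of `H` on `L`, as an algebra homomorphism `h ↦ (x ↦ h · x)`. -/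
abbrev HopfAction (K : Type*) (L : Type*) (H : Type*) [Field K] [Field L] [Algebra K L] [Ring H]
    [HopfAlgebra K H] : Type _ :=
  H →ₐ[K] Module.End K L

/-- The map `j : L ⊗ H → End_K L`, `x ⊗ h ↦ (y ↦ x (h · y))`, of an action `ρ` of `H` on `L`. -/
def jMap (ρ : HopfAction K L H) : L ⊗[K] H →ₗ[K] Module.End K L :=
  LinearMap.mul' K (Module.End K L) ∘ₗ
    TensorProduct.map (Algebra.lmul K L).toLinearMap ρ.toLinearMap

/-- A `K`-linear action `ρ` of the `K`-Hopf algebra `H` on `L` is a Hopf-Galois structure on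
`L/K`: `H` is finite-dimensional and cocommutative, `L` is an `H`-module algebra
(`h · 1 = ε(h) 1` and `h · (x y) = ∑ (h₁ · x) (h₂ · y)`), and `j` is bijective. -/
structure IsHopfGalois (ρ : HopfAction K L H) : Prop where
  finite : FiniteDimensional K H
  cocomm : Coalgebra.IsCocomm K H
  map_one : ∀ h : H, ρ h 1 = algebraMap K L (Coalgebra.counit (R := K) h)
  map_mul : ∀ (h : H) (x y : L), ρ h (x * y) =
    LinearMap.mul' K L (TensorProduct.map (ρ.toLinearMap.flip x) (ρ.toLinearMap.flip y)
      (Coalgebra.comul (R := K) h))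
  bijective : Function.Bijective (jMap ρ)

/-- `ρ` is the only Hopf-Galois structure on `L/K`, up to isomorphisms of Hopf algebras that
are compatible with the actions. -/
def IsUniqueHopfGalois (ρ : HopfAction K L H) : Prop :=
  IsHopfGalois ρ ∧
    ∀ (H₁ : Type w) [Ring H₁] [HopfAlgebra K H₁] (ρ₁ : HopfAction K L H₁),
      IsHopfGalois ρ₁ → ∃ φ : H₁ ≃ₐc[K] H, ∀ h : H₁, ρ (φ h) = ρ₁ h

end HopfGalois

/-- The extension `L/K` is Hopf-Galois: it admits some Hopf-Galois structure. -/
def IsHopfGaloisExtension (K : Type u) (L : Type v) [Field K] [Field L] [Algebra K L] : Prop :=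
  ∃ (H : Type v) (_ : Ring H) (_ : HopfAlgebra K H) (ρ : HopfAction K L H), IsHopfGalois ρ

/-! ### Associated orders -/

section AssociatedOrder

variable (p : ℕ) [Fact p.Prime] {K : Type*} {L : Type*} {H : Type*} [Field K] [Field L]
  [Algebra K L] [Algebra ℤ_[p] K] [Algebra ℤ_[p] L] [IsScalarTower ℤ_[p] K L] [Ring H]
  [HopfAlgebra K H]

/-- The associated order `𝔄_H = {h ∈ H | h · 𝒪_L ⊆ 𝒪_L}`. -/
def associatedOrder (ρ : HopfAction K L H) : Subalgebra (intRing p K) H where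
  carrier := {h | ∀ x ∈ intRing p L, ρ h x ∈ intRing p L}
  mul_mem' := by
    intro a b ha hb x hx
    rw [map_mul]
    exact ha _ (hb x hx)
  add_mem' := by
    intro a b ha hb x hx
    rw [map_add]
    exact add_mem (ha x hx) (hb x hx)
  algebraMap_mem' := by
    intro r x hx
    have h : algebraMap (intRing p K) H r = algebraMap K H (r : K) := rfl
    rw [h, AlgHom.commutes, Module.algebraMap_end_apply, Algebra.smul_def]
    exact mul_mem (IsIntegral.map (IsScalarTower.toAlgHom ℤ_[p] K L) r.2) hx

/-- The action of the associated order on `𝒪_L`. -/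
abbrev associatedOrderModule (ρ : HopfAction K L H) :
    Module (associatedOrder p ρ) (intRing p L) where
  smul a x := ⟨ρ a.1 x.1, a.2 x.1 x.2⟩
  one_smul x := Subtype.ext (by change ρ 1 x.1 = x.1; simp)
  mul_smul a b x := Subtype.ext (by
    change ρ (a.1 * b.1) x.1 = ρ a.1 (ρ b.1 x.1); simp)
  smul_zero a := Subtype.ext (map_zero (ρ a.1))
  smul_add a x y := Subtype.ext (map_add (ρ a.1) x.1 y.1)
  add_smul a b x := Subtype.ext (by
    change ρ (a.1 + b.1) x.1 = ρ a.1 x.1 + ρ b.1 x.1; simp)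
  zero_smul x := Subtype.ext (by change ρ 0 x.1 = 0; simp)

/-- `𝒪_L` is free as a module over the associated order `𝔄_H`. -/
def IsFreeOverAssociatedOrder (ρ : HopfAction K L H) : Prop :=
  letI := associatedOrderModule p ρ
  Module.Free (associatedOrder p ρ) (intRing p L)

end AssociatedOrder

end HopfGaloisDegP

end

open HopfGaloisDegP

set_option linter.unusedSectionVars false

noncomputable section

namespace HopfGaloisDegP

/-! ### The ring of integers of a `p`-adic field -/

section IntRing

variable (p : ℕ) [Fact p.Prime]

section One

variable (F : Type*) [Field F] [Algebra ℚ_[p] F] [FiniteDimensional ℚ_[p] F] [Algebra ℤ_[p] F]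
  [IsScalarTower ℤ_[p] ℚ_[p] F]

/-! Write G = Gal(N/K), I for its inertia group and S = Gal(N/L), so that Gal(N/K') = I and
Gal(N/L') = I ∩ S.

Group theory. G permutes the p embeddings of L into N faithfully, so |G| = p·|S| divides p! and S
has order prime to p. Since e(L/K) = p divides e(N/K) = |I|, the wild inertia group W is nontrivial:
it is a p-group, normal in G, and I/W has no element of order p (`mem_wildInertia_of_pow_mem`).
Hence |W| = p and W is a normal complement of S (`isComplement'_wildInertiaGroup`). Being a normal
Sylow subgroup it is the only complement. As W ⊆ I, it is also a complement over K', which gives the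
almost classically Galois statements, the degree [L' : K'] = p and the normal closure.

Hopf–Galois structures. The invariants N[W]^G, with G acting on W by conjugation, form a K-Hopf
algebra acting on L (`isHopfGalois_invAlgAction`). Conversely, for an arbitrary structure H, expand
the action in the N-basis {w|_L : w ∈ W} of Hom_K(L, N). The coordinates H → N are orthogonal
idempotents for convolution, so Gal(N/K) permutes them (`exists_perm_actionCoord`). An element of W
permutes p coordinates with order dividing p and fixes the one at 1, hence fixes all
(`actionCoord_fixed`). So H and N[W]^G have the same image in End_K(L), and the image determines the
Hopf algebra (`exists_bialgEquiv_of_range_eq`). The argument applies over K and over K'.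

Base change. Since W fixes K', the W-conjugates show that L and K' are linearly disjoint, and
degrees give L' = K' ⊗_K L. A structure H on L/K therefore extends to K' ⊗ H on L'/K'
(`isHopfGalois_baseChangeAction`).

Integers. N/K' is totally ramified and L'/L is unramified, so 𝒪_{L'} = 𝒪_L·𝒪_{K'} by Nakayama
(`span_range_algebraMap_eq_top`). An 𝒪_K-basis of 𝒪_{K'} then decomposes both 𝒪_{L'} into copies of
𝒪_L and 𝔄_{H'} into copies of 𝔄_H. Freeness goes up along this decomposition. It comes down because
𝔄_H is commutative and semilocal, where a finite module with a free finite power is projective of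
constant rank, hence free (`free_of_free_pi`). -/

instance intRing_isDedekindDomain : IsDedekindDomain (intRing p F) :=
  have : CharZero F := charZero_of_injective_algebraMap (algebraMap ℚ_[p] F).injective
  integralClosure.isDedekindDomain ℤ_[p] ℚ_[p] F

instance intRing_isFractionRing : IsFractionRing (intRing p F) F :=
  integralClosure.isFractionRing_of_finite_extension ℚ_[p] F

instance intRing_finite : Module.Finite ℤ_[p] (intRing p F) :=
  IsIntegralClosure.finite ℤ_[p] ℚ_[p] F (intRing p F)

variable {F} in
-- The spectral norm is at most 1 exactly when the minimal polynomial over ℚ_p has coefficients in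
-- ℤ_p; as ℤ_p is integrally closed, this is integrality.
theorem mem_intRing_iff_spectralNorm_le_one (x : F) :
    x ∈ intRing p F ↔ spectralNorm ℚ_[p] F x ≤ 1 := by
  have hx : IsIntegral ℚ_[p] x := Algebra.IsIntegral.isIntegral x
  rw [spectralNorm, spectralValue_le_one_iff (minpoly.monic hx)]
  constructor
  · intro h n
    rw [minpoly.isIntegrallyClosed_eq_field_fractions' ℚ_[p] h, Polynomial.coeff_map]
    exact PadicInt.norm_le_one _
  · intro h
    have hl : minpoly ℚ_[p] x ∈ Polynomial.lifts (algebraMap ℤ_[p] ℚ_[p]) := by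
      rw [Polynomial.lifts_iff_coeff_lifts]
      exact fun n => ⟨⟨_, h n⟩, rfl⟩
    obtain ⟨q, hq, -, hm⟩ := Polynomial.lifts_and_natDegree_eq_and_monic hl (minpoly.monic hx)
    refine ⟨q, hm, ?_⟩
    rw [← Polynomial.aeval_def, ← Polynomial.aeval_map_algebraMap ℚ_[p], hq, minpoly.aeval]

/-- The spectral norm on F is multiplicative, so one of x and x⁻¹ has norm at most 1. This is what
makes 𝒪_F local. -/
instance intRing_valuationRing : ValuationRing (intRing p F) := by
  rw [ValuationRing.iff_isInteger_or_isInteger (intRing p F) F]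
  intro x
  have key : ∀ y : F, spectralNorm ℚ_[p] F y ≤ 1 → IsLocalization.IsInteger (intRing p F) y :=
    fun y hy => ⟨⟨y, (mem_intRing_iff_spectralNorm_le_one p y).2 hy⟩, rfl⟩
  rcases le_total (spectralNorm ℚ_[p] F x) 1 with h | h
  · exact .inl (key x h)
  · refine .inr (key _ ?_)
    rw [← spectralMulAlgNorm_def, map_inv₀]
    exact inv_le_one_of_one_le₀ h

instance intRing_isPrincipalIdealRing : IsPrincipalIdealRing (intRing p F) :=
  inferInstance

theorem maxIdeal_eq_maximalIdeal :
    maxIdeal p F = IsLocalRing.maximalIdeal (intRing p F) := by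
  rw [maxIdeal, ← Ideal.jacobson_bot, IsLocalRing.jacobson_eq_maximalIdeal _ bot_ne_top]

instance maxIdeal_isMaximal : (maxIdeal p F).IsMaximal := by
  rw [maxIdeal_eq_maximalIdeal]; infer_instance

instance intRing_faithfulSMul_padicInt : FaithfulSMul ℤ_[p] (intRing p F) := by
  rw [faithfulSMul_iff_algebraMap_injective]
  refine .of_comp (f := algebraMap (intRing p F) F) ?_
  rw [← RingHom.coe_comp, ← IsScalarTower.algebraMap_eq, IsScalarTower.algebraMap_eq _ ℚ_[p]]
  exact (algebraMap ℚ_[p] F).injective.comp (IsFractionRing.injective ℤ_[p] ℚ_[p])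

theorem natCast_mem_maxIdeal : (p : intRing p F) ∈ maxIdeal p F := by
  rw [maxIdeal_eq_maximalIdeal, IsLocalRing.mem_maximalIdeal, mem_nonunits_iff]
  intro h
  have h1 : IsUnit (p : ℤ_[p]) := by
    have : IsUnit (algebraMap ℤ_[p] (intRing p F) p) := by simpa using h
    exact (Algebra.IsIntegral.isLocalHom ℤ_[p] (intRing p F)).1 _ this
  exact PadicInt.p_nonunit h1

theorem maxIdeal_ne_bot : maxIdeal p F ≠ ⊥ := by
  intro h
  have h1 := natCast_mem_maxIdeal p F
  rw [h, Ideal.mem_bot] at h1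
  have h2 : ((p : intRing p F) : F) = 0 := by rw [h1]; rfl
  have : CharZero F := charZero_of_injective_algebraMap (algebraMap ℚ_[p] F).injective
  simp [(Fact.out : p.Prime).ne_zero] at h2

instance maxIdeal_finite_quotient : Finite (intRing p F ⧸ maxIdeal p F) := by
  have hle : IsLocalRing.maximalIdeal ℤ_[p] ≤
      (maxIdeal p F).comap (algebraMap ℤ_[p] (intRing p F)) := by
    rw [PadicInt.maximalIdeal_eq_span_p, Ideal.span_singleton_le_iff_mem, Ideal.mem_comap]
    simpa using natCast_mem_maxIdeal p F
  have hf : Finite (ℤ_[p] ⧸ IsLocalRing.maximalIdeal ℤ_[p]) :=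
    Finite.of_equiv _ (PadicInt.residueField (p := p)).toEquiv.symm
  let : Algebra (ℤ_[p] ⧸ IsLocalRing.maximalIdeal ℤ_[p]) (intRing p F ⧸ maxIdeal p F) :=
    (Ideal.quotientMap _ (algebraMap ℤ_[p] (intRing p F)) hle).toAlgebra
  have : IsScalarTower ℤ_[p] (ℤ_[p] ⧸ IsLocalRing.maximalIdeal ℤ_[p])
      (intRing p F ⧸ maxIdeal p F) := .of_algebraMap_eq fun _ => rfl
  have : Module.Finite (ℤ_[p] ⧸ IsLocalRing.maximalIdeal ℤ_[p]) (intRing p F ⧸ maxIdeal p F) :=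
    .of_restrictScalars_finite ℤ_[p] _ _
  exact Module.finite_of_finite (ℤ_[p] ⧸ IsLocalRing.maximalIdeal ℤ_[p])

instance maxIdeal_perfectField_residueField : PerfectField (maxIdeal p F).ResidueField := by
  have : Finite (maxIdeal p F).ResidueField :=
    Finite.of_surjective _ (Ideal.bijective_algebraMap_quotient_residueField (maxIdeal p F)).2
  infer_instance

end One

section Two

variable (F E : Type*) [Field F] [Field E] [Algebra ℤ_[p] F] [Algebra ℤ_[p] E] [Algebra F E]
  [IsScalarTower ℤ_[p] F E]

@[simp]
theorem coe_algebraMap_intRing (x : intRing p F) :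
    (algebraMap (intRing p F) (intRing p E) x : E) = algebraMap F E x := rfl

instance intRing_isScalarTower_base : IsScalarTower ℤ_[p] (intRing p F) (intRing p E) :=
  .of_algebraMap_eq fun x => Subtype.ext (by
    rw [coe_algebraMap_intRing]
    exact IsScalarTower.algebraMap_apply ℤ_[p] F E x)

theorem intRing_algebraMap_injective :
    Function.Injective (algebraMap (intRing p F) (intRing p E)) := fun _ _ h =>
  Subtype.ext ((algebraMap F E).injective (congrArg Subtype.val h))

instance intRing_faithfulSMul : FaithfulSMul (intRing p F) (intRing p E) :=
  (faithfulSMul_iff_algebraMap_injective _ _).2 (intRing_algebraMap_injective p F E)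

instance intRing_isTorsionFree : Module.IsTorsionFree (intRing p F) (intRing p E) :=
  Module.isTorsionFree_iff_faithfulSMul.2 inferInstance

instance intRing_isScalarTower_field : IsScalarTower (intRing p F) (intRing p E) E :=
  .of_algebraMap_eq fun _ => rfl

instance intRing_isIntegral : Algebra.IsIntegral (intRing p F) (intRing p E) where
  isIntegral x := by
    have : IsIntegral ℤ_[p] x :=
      (isIntegral_algHom_iff (intRing p E).val Subtype.val_injective).1 x.2
    exact this.tower_top

variable [Algebra ℚ_[p] F] [FiniteDimensional ℚ_[p] F] [IsScalarTower ℤ_[p] ℚ_[p] F]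
  [Algebra ℚ_[p] E] [FiniteDimensional ℚ_[p] E] [IsScalarTower ℤ_[p] ℚ_[p] E]

instance intRing_finite_intRing : Module.Finite (intRing p F) (intRing p E) :=
  .of_restrictScalars_finite ℤ_[p] _ _

instance intRing_free_intRing : Module.Free (intRing p F) (intRing p E) :=
  Module.free_of_finite_type_torsion_free'

instance maxIdeal_liesOver : (maxIdeal p E).LiesOver (maxIdeal p F) := by
  rw [maxIdeal_eq_maximalIdeal p F]
  constructor
  have : ((maxIdeal p E).under (intRing p F)).IsMaximal := Ideal.IsMaximal.under _ _
  exact (IsLocalRing.eq_maximalIdeal this).symm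

theorem primesOver_maxIdeal :
    (maxIdeal p F).primesOver (intRing p E) = {maxIdeal p E} := by
  ext P
  rw [Set.mem_singleton_iff]
  constructor
  · rintro ⟨h1, h2⟩
    have : P.IsMaximal := Ideal.isMaximal_of_isIntegral_of_isMaximal_comap P (by
      have := h2.over
      rw [Ideal.under] at this
      rw [← this]; infer_instance)
    rw [maxIdeal_eq_maximalIdeal]
    exact IsLocalRing.eq_maximalIdeal this
  · rintro rfl
    exact ⟨inferInstance, inferInstance⟩

instance intRing_isScalarTower_fractionField : IsScalarTower (intRing p F) F E :=
  .of_algebraMap_eq fun _ => rfl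

theorem finrank_intRing : Module.finrank (intRing p F) (intRing p E) = Module.finrank F E :=
  (IsFractionRing.finrank_eq (intRing p F) F (intRing p E) E).symm

/-- A single prime lies over `maxIdeal p F`, so the sum of the e·f has one term. -/
theorem ramificationIdx_mul_inertiaDeg :
    (maxIdeal p E).ramificationIdx (intRing p F) * (maxIdeal p E).inertiaDeg (intRing p F) =
      Module.finrank F E := by
  have h : (maxIdeal p F).primesOver (intRing p E) = {maxIdeal p E} := primesOver_maxIdeal p F E
  let : Unique ((maxIdeal p F).primesOver (intRing p E)) := by
    rw [h]; infer_instance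
  have hu : ((default : (maxIdeal p F).primesOver (intRing p E)) : Ideal (intRing p E)) =
      maxIdeal p E := by
    exact Set.mem_singleton_iff.1 (h.le (Subtype.property _))
  rw [← finrank_intRing p F E, ← Ideal.sum_ramification_inertia_eq_finrank (maxIdeal p F),
    Fintype.sum_unique, hu]

end Two

end IntRing

theorem exists_sub_mem_of_finrank_quotient_eq_one {R S : Type*} [CommRing R] [CommRing S]
    [Algebra R S] (P : Ideal R) (Q : Ideal S) [P.IsMaximal] [Q.IsPrime] [Q.LiesOver P]
    (h : Module.finrank (R ⧸ P) (S ⧸ Q) = 1) (x : S) : ∃ r : R, x - algebraMap R S r ∈ Q := by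
  let : Field (R ⧸ P) := Ideal.Quotient.field _
  obtain ⟨c, hc⟩ := (finrank_eq_one_iff_of_nonzero' (1 : S ⧸ Q) one_ne_zero).1 h
    (Ideal.Quotient.mk _ x)
  obtain ⟨r, rfl⟩ := Ideal.Quotient.mk_surjective c
  refine ⟨r, ?_⟩
  rw [← Ideal.Quotient.eq, ← hc, Algebra.smul_def, mul_one]
  rfl

/-! ### Inertia groups, ramification in towers, and generation of rings of integers. -/

section Inertia

variable (p : ℕ) [Fact p.Prime]

variable (F E : Type*) [Field F] [Field E] [Algebra ℤ_[p] F] [Algebra ℤ_[p] E] [Algebra F E]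
  [IsScalarTower ℤ_[p] F E]

@[simp]
theorem coe_smul_intRing (σ : E ≃ₐ[F] E) (x : intRing p E) : ((σ • x : intRing p E) : E) = σ x :=
  rfl

section PAdic

variable [Algebra ℚ_[p] F] [FiniteDimensional ℚ_[p] F] [IsScalarTower ℤ_[p] ℚ_[p] F]
  [Algebra ℚ_[p] E] [FiniteDimensional ℚ_[p] E] [IsScalarTower ℤ_[p] ℚ_[p] E]

theorem ramificationIdx_pos : 0 < (maxIdeal p E).ramificationIdx (intRing p F) :=
  Ideal.ramificationIdx_pos _ _

section Galois

variable [IsGalois F E] [FiniteDimensional F E]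

instance intRing_isGaloisGroup : IsGaloisGroup (E ≃ₐ[F] E) (intRing p F) (intRing p E) :=
  have : SMulDistribClass (E ≃ₐ[F] E) (intRing p E) E := ⟨fun σ x y => by
    change σ ((x : E) * y) = σ x * σ y
    exact map_mul _ _ _⟩
  .of_isFractionRing _ _ _ F E

/-- Compare |G| = g·|I|·f, where g = 1, with [E : F] = e·f. -/
theorem card_inertiaGroup :
    Nat.card (inertiaGroup p F E) = (maxIdeal p E).ramificationIdx (intRing p F) := by
  have h := Ideal.ncard_primesOver_mul_card_inertia_mul_finrank (G := E ≃ₐ[F] E) (maxIdeal p F)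
    (maxIdeal p E)
  rw [primesOver_maxIdeal, Set.ncard_singleton, one_mul, IsGalois.card_aut_eq_finrank,
    ← ramificationIdx_mul_inertiaDeg p F E] at h
  exact Nat.eq_of_mul_eq_mul_right (Ideal.inertiaDeg_pos _ _) h

theorem isTotallyRamified_of_inertiaGroup_eq_top (h : inertiaGroup p F E = ⊤) :
    IsTotallyRamified p F E := by
  rw [IsTotallyRamified, ← card_inertiaGroup, h, Subgroup.card_top, IsGalois.card_aut_eq_finrank]

end Galois

end PAdic

section Tower

variable (N : Type*) [Field N] [Algebra ℤ_[p] N] [Algebra F N] [Algebra E N] [IsScalarTower F E N]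
  [IsScalarTower ℤ_[p] F N] [IsScalarTower ℤ_[p] E N]

instance intRing_isScalarTower : IsScalarTower (intRing p F) (intRing p E) (intRing p N) :=
  .of_algebraMap_eq fun x => Subtype.ext (IsScalarTower.algebraMap_apply F E N x)

theorem restrictScalars_mem_inertiaGroup (σ : N ≃ₐ[E] N) :
    σ.restrictScalars F ∈ inertiaGroup p F N ↔ σ ∈ inertiaGroup p E N := .rfl

theorem inertiaGroup_eq_top_of_tower (h : inertiaGroup p F N = ⊤) : inertiaGroup p E N = ⊤ := by
  refine top_le_iff.1 fun σ _ => (restrictScalars_mem_inertiaGroup p F E N σ).1 ?_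
  rw [h]; trivial

variable [Algebra ℚ_[p] F] [FiniteDimensional ℚ_[p] F] [IsScalarTower ℤ_[p] ℚ_[p] F]
  [Algebra ℚ_[p] E] [FiniteDimensional ℚ_[p] E] [IsScalarTower ℤ_[p] ℚ_[p] E]
  [Algebra ℚ_[p] N] [FiniteDimensional ℚ_[p] N] [IsScalarTower ℤ_[p] ℚ_[p] N]

theorem ramificationIdx_tower :
    (maxIdeal p N).ramificationIdx (intRing p F) =
      (maxIdeal p E).ramificationIdx (intRing p F) *
        (maxIdeal p N).ramificationIdx (intRing p E) :=
  Ideal.ramificationIdx_tower (maxIdeal p E) (maxIdeal p N)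

/-- Every nonzero ideal of 𝒪_E is a power of the maximal ideal; for the extended ideal the exponent
is the ramification index. -/
theorem map_maxIdeal_of_ramificationIdx_eq_one
    (h : (maxIdeal p E).ramificationIdx (intRing p F) = 1) :
    (maxIdeal p F).map (algebraMap (intRing p F) (intRing p E)) = maxIdeal p E := by
  have hne : (maxIdeal p F).map (algebraMap (intRing p F) (intRing p E)) ≠ ⊥ :=
    Ideal.map_ne_bot_of_ne_bot (maxIdeal_ne_bot p F)
  rw [Ideal.IsDedekindDomain.ramificationIdx_eq_multiplicity (maxIdeal p F) _ hne] at h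
  obtain ⟨n, hn⟩ := exists_maximalIdeal_pow_eq_of_principal (intRing p E)
    (IsPrincipalIdealRing.principal _) _ hne
  rw [← maxIdeal_eq_maximalIdeal] at hn
  rw [hn, multiplicity_pow_self (maxIdeal_ne_bot p E)
    (by rw [Ideal.isUnit_iff]; exact (maxIdeal_isMaximal p E).ne_top)] at h
  rw [hn, h, pow_one]

/-- Total ramification gives f(N/F) = 1, so f(E/F) = 1 by multiplicativity, and 𝒪_F surjects onto
the residue field of E. -/
theorem exists_sub_mem_maxIdeal (h : IsTotallyRamified p F N) (x : intRing p E) :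
    ∃ r : intRing p F, x - algebraMap _ _ r ∈ maxIdeal p E := by
  have h1 := ramificationIdx_mul_inertiaDeg p F N
  rw [← h] at h1
  have h2 : (maxIdeal p N).inertiaDeg (intRing p F) = 1 :=
    Nat.eq_of_mul_eq_mul_left (ramificationIdx_pos p F N) (by rw [h1, mul_one])
  rw [Ideal.inertiaDeg_tower (maxIdeal p E) (maxIdeal p N), mul_eq_one,
    Ideal.inertiaDeg_eq_of_isMaximal (maxIdeal p F)] at h2
  exact exists_sub_mem_of_finrank_quotient_eq_one (maxIdeal p F) (maxIdeal p E) h2.1 x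

/-- If `N/K'` is totally ramified and `L'/L` is unramified then `𝒪_L'` is spanned over `𝒪_L`
by `𝒪_K'`. -/
theorem span_range_algebraMap_eq_top (L : Type*) [Field L] [Algebra ℤ_[p] L] [Algebra L E]
    [IsScalarTower ℤ_[p] L E] [Algebra ℚ_[p] L] [FiniteDimensional ℚ_[p] L]
    [IsScalarTower ℤ_[p] ℚ_[p] L] (h : IsTotallyRamified p F N)
    (h' : (maxIdeal p E).ramificationIdx (intRing p L) = 1) :
    Submodule.span (intRing p L) (Set.range (algebraMap (intRing p F) (intRing p E))) = ⊤ := by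
  -- Nakayama over 𝒪_L: it is enough to represent elements of 𝒪_E by elements of 𝒪_F modulo 𝔭_L𝒪_E,
  -- which equals 𝔭_E because e(E/L) = 1.
  refine top_le_iff.1 (Submodule.le_of_le_smul_of_le_jacobson_bot (I := maxIdeal p L)
    Module.Finite.fg_top ?_ ?_)
  · rw [IsLocalRing.jacobson_eq_maximalIdeal _ bot_ne_top, maxIdeal_eq_maximalIdeal]
  · intro x _
    obtain ⟨r, hr⟩ := exists_sub_mem_maxIdeal p F E N h x
    rw [← sub_add_cancel x (algebraMap _ _ r), add_comm]
    refine Submodule.add_mem_sup (Submodule.subset_span ⟨r, rfl⟩) ?_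
    rw [← map_maxIdeal_of_ramificationIdx_eq_one p L E h'] at hr
    rwa [Ideal.smul_top_eq_map]

end Tower

end Inertia

/-! ### Wild inertia -/

section WildInertia

open IsLocalRing

variable (S : Type*) [CommRing S] [IsLocalRing S] (G : Type*) [Group G] [MulSemiringAction G S]

variable {S G} in
theorem smul_mem_maximalIdeal_pow (g : G) {i : ℕ} {x : S} (hx : x ∈ maximalIdeal S ^ i) :
    g • x ∈ maximalIdeal S ^ i := by
  have h : (maximalIdeal S).map (MulSemiringAction.toRingHom G S g) ≤ maximalIdeal S := by
    rw [Ideal.map_le_iff_le_comap]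
    intro y hy
    rw [Ideal.mem_comap, mem_maximalIdeal, mem_nonunits_iff]
    exact fun hu => hy ((MulEquiv.isUnit_map (MulSemiringAction.toRingEquiv G S g)).1 hu)
  have h2 := Ideal.mem_map_of_mem (MulSemiringAction.toRingHom G S g) hx
  rw [Ideal.map_pow] at h2
  exact Ideal.pow_right_mono h i h2

/-- The wild inertia group of an action on a local ring with maximal ideal `𝔪`: the elements acting
trivially on all the quotients `𝔪 ^ i / 𝔪 ^ (i + 1)`. -/
def wildInertia : Subgroup G where
  carrier := {σ | ∀ i, ∀ x ∈ maximalIdeal S ^ i, σ • x - x ∈ maximalIdeal S ^ (i + 1)}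
  one_mem' i x _ := by simp
  mul_mem' {σ τ} hσ hτ i x hx := by
    rw [mul_smul, ← sub_add_sub_cancel _ (τ • x)]
    exact add_mem (hσ i _ (smul_mem_maximalIdeal_pow τ hx)) (hτ i x hx)
  inv_mem' {σ} hσ i x hx := by
    have h := hσ i _ (smul_mem_maximalIdeal_pow σ⁻¹ hx)
    rw [smul_inv_smul] at h
    rw [← neg_sub]
    exact neg_mem h

variable {S G}

instance wildInertia_normal : (wildInertia S G).Normal where
  conj_mem σ hσ g i x hx := by
    have h := smul_mem_maximalIdeal_pow g (hσ i _ (smul_mem_maximalIdeal_pow g⁻¹ hx))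
    rwa [smul_sub, smul_inv_smul, ← mul_smul, ← mul_smul] at h

theorem wildInertia_le_inertia : wildInertia S G ≤ (maximalIdeal S).inertia G := fun σ hσ x => by
  simpa using hσ 0 x (by simp)

theorem isUnit_natCast_of_not_dvd {p : ℕ} (hp : p.Prime) (hpS : (p : S) ∈ maximalIdeal S) {n : ℕ}
    (hn : ¬ p ∣ n) : IsUnit (n : S) := by
  by_contra h
  obtain ⟨a, b, hab⟩ := Nat.isCoprime_iff_coprime.2 ((hp.coprime_iff_not_dvd).2 hn)
  have h1 : ((a * p + b * n : ℤ) : S) = 1 := by rw [hab]; simp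
  push_cast at h1
  have h2 : (1 : S) ∈ maximalIdeal S := h1 ▸ add_mem (Ideal.mul_mem_left _ _ hpS)
    (Ideal.mul_mem_left _ _ h)
  exact (Ideal.ne_top_iff_one _).1 (maximalIdeal.isMaximal S).ne_top h2

section Noetherian

variable [IsNoetherianRing S]

theorem eq_zero_of_forall_mem_maximalIdeal_pow {z : S} (h : ∀ i, z ∈ maximalIdeal S ^ i) :
    z = 0 := by
  have h1 := Ideal.iInf_pow_eq_bot_of_isLocalRing (maximalIdeal S)
    (maximalIdeal.isMaximal S).ne_top
  rw [← Ideal.mem_bot, ← h1, Ideal.mem_iInf]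
  exact h

/-- By induction σx − x lies in every power of 𝔪, hence vanishes by Krull. If it lies in 𝔪^i, the
terms σ^k(σx − x) for k < n are all congruent to it modulo 𝔪^(i+1), while their sum telescopes to
σ^n x − x = 0. So n(σx − x) ∈ 𝔪^(i+1), and n is a unit. -/
theorem eq_one_of_mem_wildInertia_of_pow_eq_one [FaithfulSMul G S] {p : ℕ} (hp : p.Prime)
    (hpS : (p : S) ∈ maximalIdeal S) {σ : G} (hσ : σ ∈ wildInertia S G) {n : ℕ} (hn : ¬ p ∣ n)
    (h : σ ^ n = 1) : σ = 1 := by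
  refine FaithfulSMul.eq_of_smul_eq_smul fun x : S => ?_
  rw [one_smul, ← sub_eq_zero]
  refine eq_zero_of_forall_mem_maximalIdeal_pow fun i => ?_
  induction i with
  | zero => simp
  | succ i ih =>
    have h1 : ∑ k ∈ Finset.range n, σ ^ k • (σ • x - x) = 0 := by
      have := Finset.sum_range_sub (fun k => σ ^ k • x) n
      simp only [h, pow_zero, one_smul, sub_self, pow_succ, mul_smul, ← smul_sub] at this
      exact this
    have h2 : ∑ k ∈ Finset.range n, (σ ^ k • (σ • x - x) - (σ • x - x)) ∈
        maximalIdeal S ^ (i + 1) :=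
      sum_mem fun k _ => (pow_mem hσ k : σ ^ k ∈ wildInertia S G) i _ ih
    rw [Finset.sum_sub_distrib, h1, zero_sub, neg_mem_iff, Finset.sum_const, Finset.card_range,
      nsmul_eq_mul] at h2
    exact (Ideal.unit_mul_mem_iff_mem _ (isUnit_natCast_of_not_dvd hp hpS hn)).1 h2

theorem isPGroup_wildInertia [FaithfulSMul G S] [Finite G] {p : ℕ} (hp : p.Prime)
    (hpS : (p : S) ∈ maximalIdeal S) : IsPGroup p (wildInertia S G) := by
  rintro ⟨σ, hσ⟩
  -- With the order of σ equal to p^a·m and m prime to p, the wild element σ^(p^a) is killed by m,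
  -- hence trivial.
  obtain ⟨a, m, hm, h⟩ := Nat.exists_eq_pow_mul_and_not_dvd (orderOf_pos σ).ne' p hp.ne_one
  refine ⟨a, Subtype.ext ?_⟩
  refine eq_one_of_mem_wildInertia_of_pow_eq_one hp hpS (pow_mem hσ _) hm ?_
  change (σ ^ p ^ a) ^ m = 1
  rw [← pow_mul, ← h, pow_orderOf_eq_one]

end Noetherian

variable [IsDomain S] [IsPrincipalIdealRing S]

/-- For a uniformizer π write σπ = uπ. Inertia gives σ^k π ≡ u^k π modulo 𝔪², so wildness of σ^p
forces u^p ≡ 1 modulo 𝔪. The residue field has characteristic p, hence u ≡ 1, and then σ(π^i y) =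
u^i π^i σ(y) ≡ π^i y modulo 𝔪^(i+1). -/
theorem mem_wildInertia_of_pow_mem {p : ℕ} (hp : p.Prime) (hpS : (p : S) ∈ maximalIdeal S)
    (hS : maximalIdeal S ≠ ⊥) {σ : G} (hσ : σ ∈ (maximalIdeal S).inertia G)
    (h : σ ^ p ∈ wildInertia S G) : σ ∈ wildInertia S G := by
  obtain ⟨π, hπ⟩ := (IsPrincipalIdealRing.principal (maximalIdeal S)).principal
  rw [← Ideal.span] at hπ
  have hπ0 : π ≠ 0 := by rintro rfl; exact hS (by rw [hπ, Ideal.span_singleton_zero])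
  have hπm : π ∈ maximalIdeal S := by rw [hπ]; exact Ideal.mem_span_singleton_self π
  have hmul : ∀ y, y * π ∈ maximalIdeal S ^ 2 ↔ y ∈ maximalIdeal S := fun y => by
    rw [hπ, Ideal.span_singleton_pow, Ideal.mem_span_singleton, Ideal.mem_span_singleton, pow_two]
    exact mul_dvd_mul_iff_right hπ0
  have hσπ : σ • π ∈ maximalIdeal S := by
    rw [← pow_one (maximalIdeal S)]
    exact smul_mem_maximalIdeal_pow σ (i := 1) (by rwa [pow_one])
  obtain ⟨u, hu⟩ : ∃ u, σ • π = u * π := by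
    rw [hπ, Ideal.mem_span_singleton] at hσπ
    obtain ⟨u, hu⟩ := hσπ
    exact ⟨u, by rw [hu, mul_comm]⟩
  have hpow : ∀ k : ℕ, σ ^ k • π - u ^ k * π ∈ maximalIdeal S ^ 2 := by
    intro k
    induction k with
    | zero => simp
    | succ k ih =>
      have h1 := smul_mem_maximalIdeal_pow σ ih
      have h2 : (σ • (u ^ k) - u ^ k) * u * π ∈ maximalIdeal S ^ 2 := by
        rw [hmul]; exact Ideal.mul_mem_right _ _ (hσ _)
      convert add_mem h1 h2 using 1
      rw [smul_sub, ← mul_smul, ← pow_succ', MulSemiringAction.smul_mul, hu]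
      ring
  have hu1 : u ^ p - 1 ∈ maximalIdeal S := by
    rw [← hmul, sub_mul, one_mul]
    have h1 := h 1 π (by rwa [pow_one])
    convert sub_mem h1 (hpow p) using 1
    ring
  have hu2 : u - 1 ∈ maximalIdeal S := by
    have : CharP (ResidueField S) p := by
      rw [CharP.charP_iff_prime_eq_zero hp, ← map_natCast (residue S), residue_eq_zero_iff]
      exact hpS
    have : Fact p.Prime := ⟨hp⟩
    rw [← residue_eq_zero_iff, map_sub, map_pow, map_one] at hu1
    rw [← residue_eq_zero_iff, map_sub, map_one]
    refine eq_zero_of_pow_eq_zero (n := p) ?_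
    rw [sub_pow_char, one_pow, hu1]
  intro i x hx
  rw [hπ, Ideal.span_singleton_pow, Ideal.mem_span_singleton] at hx
  obtain ⟨y, rfl⟩ := hx
  have h1 : u ^ i * (σ • y) - y ∈ maximalIdeal S := by
    have h2 : u ^ i - 1 ∈ maximalIdeal S :=
      Ideal.mem_of_dvd _ (by simpa using sub_dvd_pow_sub_pow u 1 i) hu2
    convert add_mem (Ideal.mul_mem_right (σ • y) _ h2) (hσ y) using 1
    ring
  rw [MulSemiringAction.smul_mul, smul_pow', hu]
  rw [pow_succ]
  convert Ideal.mul_mem_mul (Ideal.pow_mem_pow hπm i) h1 using 1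
  ring

/-- Otherwise p divides the order of the quotient of inertia by wild inertia, and Cauchy gives an
element of order p there, against `mem_wildInertia_of_pow_mem`. -/
theorem dvd_card_wildInertia [Finite G] {p : ℕ} (hp : p.Prime) (hpS : (p : S) ∈ maximalIdeal S)
    (hS : maximalIdeal S ≠ ⊥) (h : p ∣ Nat.card ((maximalIdeal S).inertia G)) :
    p ∣ Nat.card (wildInertia S G) := by
  have : Fact p.Prime := ⟨hp⟩
  set I := (maximalIdeal S).inertia G
  let W := (wildInertia S G).subgroupOf I
  have hW : Nat.card W = Nat.card (wildInertia S G) :=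
    Nat.card_congr (Subgroup.subgroupOfEquivOfLe wildInertia_le_inertia).toEquiv
  rw [← hW]
  by_contra hd
  rw [Subgroup.card_eq_card_quotient_mul_card_subgroup W, hp.dvd_mul] at h
  obtain ⟨q, hq⟩ := exists_prime_orderOf_dvd_card' p (h.resolve_right hd)
  obtain ⟨σ, rfl⟩ := QuotientGroup.mk_surjective q
  have h1 : σ ^ p ∈ W := by
    rw [← QuotientGroup.eq_one_iff, QuotientGroup.mk_pow, ← hq, pow_orderOf_eq_one]
  have h2 : σ ∈ W := mem_wildInertia_of_pow_mem hp hpS hS σ.2 h1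
  rw [(QuotientGroup.eq_one_iff σ).2 h2, orderOf_one] at hq
  exact hp.ne_one hq.symm

end WildInertia

/-! ### Galois groups of extensions of prime degree -/

section GroupTheory

variable {G : Type*} [Group G] [Finite G] {p : ℕ} [Fact p.Prime] {H : Subgroup G}

/-- |W| is prime to |H| and divides p·|H|, so it is exactly p, and coprime orders with the right
product give a complement. -/
theorem isComplement'_of_isPGroup (hcard : Nat.card G = p * Nat.card H) (hH : ¬ p ∣ Nat.card H)
    {W : Subgroup G} (hW : IsPGroup p W) (hpW : p ∣ Nat.card W) : Subgroup.IsComplement' W H := by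
  have hp : p.Prime := Fact.out
  have hc : (Nat.card W).Coprime (Nat.card H) := by
    obtain ⟨n, hn⟩ := IsPGroup.iff_card.1 hW
    rw [hn]
    exact Nat.Coprime.pow_left n ((Nat.Prime.coprime_iff_not_dvd hp).2 hH)
  refine Subgroup.isComplement'_of_coprime ?_ hc
  have h1 : Nat.card W ∣ p := hc.dvd_of_dvd_mul_right (hcard ▸ W.card_subgroup_dvd_card)
  rw [hcard, Nat.dvd_antisymm h1 hpW]

/-- Any complement has order p and index prime to p, so it is a Sylow p-subgroup; a normal Sylow
subgroup is the only one. -/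
theorem eq_of_isComplement' (hcard : Nat.card G = p * Nat.card H) (hH : ¬ p ∣ Nat.card H)
    {J W : Subgroup G} (hW : W.Normal) (hWH : Subgroup.IsComplement' W H)
    (hJH : Subgroup.IsComplement' J H) : J = W := by
  have hp : p.Prime := Fact.out
  have hcJ : ∀ {J : Subgroup G}, Subgroup.IsComplement' J H → Nat.card J = p := fun h =>
    Nat.eq_of_mul_eq_mul_right Nat.card_pos (h.card_mul_card.trans hcard)
  have hS : ∀ {J : Subgroup G}, Subgroup.IsComplement' J H →
      IsPGroup p J ∧ ¬ p ∣ J.index := fun {J} h => by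
    refine ⟨IsPGroup.of_card (n := 1) (by rw [hcJ h, pow_one]), ?_⟩
    have h1 := J.card_mul_index
    rw [hcJ h, hcard] at h1
    rwa [Nat.eq_of_mul_eq_mul_left hp.pos h1]
  let P := (hS hWH).1.toSylow (hS hWH).2
  let Q := (hS hJH).1.toSylow (hS hJH).2
  have : P.Normal := hW
  let := P.unique_of_normal hW
  exact congrArg Sylow.toSubgroup (Subsingleton.elim Q P)

end GroupTheory

section Field

variable {K N : Type*} [Field K] [Field N] [Algebra K N]

/-- The action of `Gal(N/K)` on the embeddings of `L` into `N`. -/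
def galPermHom (L : Type*) [Field L] [Algebra K L] :
    (N ≃ₐ[K] N) →* Equiv.Perm (L →ₐ[K] N) where
  toFun σ :=
    { toFun f := σ.toAlgHom.comp f
      invFun f := σ.symm.toAlgHom.comp f
      left_inv f := by ext; simp
      right_inv f := by ext; simp }
  map_one' := by ext; rfl
  map_mul' σ τ := by ext; rfl

/-- An automorphism fixing every embedding fixes all the images of L pointwise, and these generate
N. -/
theorem galPermHom_injective {L : Type*} [Field L] [Algebra K L] [FiniteDimensional K L]
    (hN : IsNormalClosure K L N) : Function.Injective (galPermHom (K := K) (N := N) L) := by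
  rw [injective_iff_map_eq_one]
  intro σ hσ
  have h1 : IntermediateField.normalClosure K L N ≤
      IntermediateField.fixedField (Subgroup.zpowers σ) := by
    rw [normalClosure_le_iff]
    intro f
    rw [IntermediateField.le_iff_le, Subgroup.zpowers_le, IntermediateField.mem_fixingSubgroup_iff]
    rintro _ ⟨y, rfl⟩
    exact DFunLike.congr_fun (Equiv.congr_fun hσ f) y
  rw [(Algebra.IsAlgebraic.isNormalClosure_iff.1 hN).2, IntermediateField.le_iff_le,
    Subgroup.zpowers_le, IntermediateField.fixingSubgroup_top] at h1
  exact Subgroup.mem_bot.1 h1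

theorem finiteDimensional_of_isNormalClosure {L : Type*} [Field L] [Algebra K L]
    [FiniteDimensional K L] (hN : IsNormalClosure K L N) : FiniteDimensional K N := by
  have h : FiniteDimensional K (IntermediateField.normalClosure K L N) := inferInstance
  rw [(Algebra.IsAlgebraic.isNormalClosure_iff.1 hN).2] at h
  exact (IntermediateField.topEquiv (F := K) (E := N)).toLinearEquiv.finiteDimensional

theorem isNormalClosure_of_forall_fixed [FiniteDimensional K N] [IsGalois K N]
    (T : IntermediateField K N)
    (h : ∀ σ : N ≃ₐ[K] N, (∀ τ : N ≃ₐ[K] N, ∀ x ∈ T, σ (τ x) = τ x) → σ = 1) :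
    IsNormalClosure K T N := by
  rw [Algebra.IsAlgebraic.isNormalClosure_iff]
  refine ⟨fun x => by rw [IntermediateField.minpoly_eq]; exact Normal.splits inferInstance _, ?_⟩
  have h1 : (IntermediateField.normalClosure K T N).fixingSubgroup = ⊥ := by
    refine (Subgroup.eq_bot_iff_forall _).2 fun σ hσ => h σ fun τ x hx => ?_
    rw [IntermediateField.mem_fixingSubgroup_iff] at hσ
    exact hσ _ (AlgHom.fieldRange_le_normalClosure (τ.toAlgHom.comp T.val) ⟨⟨x, hx⟩, rfl⟩)
  rw [← IsGalois.fixedField_fixingSubgroup (IntermediateField.normalClosure K T N), h1,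
    IntermediateField.fixedField_bot]

variable [FiniteDimensional K N] [IsGalois K N] (L : IntermediateField K N)

theorem card_gal_eq_mul_card_fixingSubgroup :
    Nat.card (N ≃ₐ[K] N) = Module.finrank K L * Nat.card L.fixingSubgroup := by
  rw [IntermediateField.finrank_eq_fixingSubgroup_index N L, mul_comm, Subgroup.card_mul_index]

theorem card_gal_dvd_factorial (hN : IsNormalClosure K L N) :
    Nat.card (N ≃ₐ[K] N) ∣ (Module.finrank K L).factorial := by
  have h := Subgroup.card_dvd_of_injective _ (galPermHom_injective hN)
  rwa [Nat.card_perm, Nat.card_eq_fintype_card (α := L →ₐ[K] N),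
    AlgHom.card_of_splits K L N hN.splits] at h

/-- From p·|Gal(N/L)| = |Gal(N/K)| dividing p!, the order of Gal(N/L) divides (p − 1)!. -/
theorem not_dvd_card_fixingSubgroup {p : ℕ} (hp : p.Prime) (hdeg : Module.finrank K L = p)
    (hN : IsNormalClosure K L N) : ¬ p ∣ Nat.card L.fixingSubgroup := by
  intro h
  have h1 := card_gal_dvd_factorial L hN
  rw [card_gal_eq_mul_card_fixingSubgroup L, hdeg] at h1
  obtain ⟨q, rfl⟩ : ∃ q, p = q + 1 := ⟨p - 1, by have := hp.pos; omega⟩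
  rw [Nat.factorial_succ] at h1
  have h2 := h.trans (Nat.dvd_of_mul_dvd_mul_left hp.pos h1)
  exact absurd (hp.dvd_factorial.1 h2) (by omega)

end Field

/-! ### Totally ramified extensions of degree `p` -/

section Ramified

variable (p : ℕ) [Fact p.Prime] {K N : Type*} [Field K] [Algebra ℚ_[p] K]
  [Algebra ℤ_[p] K] [IsScalarTower ℤ_[p] ℚ_[p] K]
  [Field N] [Algebra K N] [Algebra ℚ_[p] N] [IsScalarTower ℚ_[p] K N]
  [Algebra ℤ_[p] N] [IsScalarTower ℤ_[p] K N]

theorem isScalarTower_padic_of_tower (K N : Type*) [Field K] [Algebra ℚ_[p] K]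
    [Algebra ℤ_[p] K] [IsScalarTower ℤ_[p] ℚ_[p] K]
    [Field N] [Algebra K N] [Algebra ℚ_[p] N] [IsScalarTower ℚ_[p] K N]
    [Algebra ℤ_[p] N] [IsScalarTower ℤ_[p] K N] : IsScalarTower ℤ_[p] ℚ_[p] N :=
  .of_algebraMap_eq fun x => by
    rw [IsScalarTower.algebraMap_apply ℤ_[p] K N, IsScalarTower.algebraMap_apply ℤ_[p] ℚ_[p] K,
      ← IsScalarTower.algebraMap_apply ℚ_[p] K N]

instance intermediateField_isScalarTower_padic (S : IntermediateField K N) :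
    IsScalarTower ℤ_[p] ℚ_[p] S :=
  isScalarTower_padic_of_tower p K S

instance intermediateField_finiteDimensional_padic [FiniteDimensional ℚ_[p] K]
    [FiniteDimensional K N] (S : IntermediateField K N) : FiniteDimensional ℚ_[p] S :=
  FiniteDimensional.trans ℚ_[p] K S

variable [FiniteDimensional ℚ_[p] K] [FiniteDimensional K N] [IsGalois K N]

/-- Membership in inertia depends only on the action on 𝒪_N, so changing the base field from K to S
just intersects with Gal(N/S). -/
theorem card_inertiaGroup_intermediateField (S : IntermediateField K N) :
    Nat.card (inertiaGroup p S N) =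
      Nat.card (inertiaGroup p K N ⊓ S.fixingSubgroup : Subgroup (N ≃ₐ[K] N)) := by
  refine Nat.card_eq_of_bijective (fun σ => ⟨σ.1.restrictScalars K, σ.2, ?_⟩) ⟨?_, ?_⟩
  · exact (IntermediateField.mem_fixingSubgroup_iff _ _).2 fun x hx => σ.1.commutes ⟨x, hx⟩
  · rintro ⟨σ, hσ⟩ ⟨τ, hτ⟩ h
    exact Subtype.ext (AlgEquiv.restrictScalars_injective K (congrArg Subtype.val h))
  · rintro ⟨σ, hσ, hS⟩
    exact ⟨⟨S.fixingSubgroupEquiv ⟨σ, hS⟩, hσ⟩, rfl⟩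

theorem inertiaGroup_fixedField_eq_top {T : IntermediateField K N}
    (hT : T.fixingSubgroup ≤ inertiaGroup p K N) : inertiaGroup p T N = ⊤ := by
  refine top_le_iff.1 fun σ _ => (restrictScalars_mem_inertiaGroup p K T N σ).1 (hT ?_)
  rw [IntermediateField.mem_fixingSubgroup_iff]
  exact fun x hx => σ.commutes ⟨x, hx⟩

variable [FiniteDimensional ℚ_[p] N] [IsScalarTower ℤ_[p] ℚ_[p] N]

section

variable {p}
variable {L : IntermediateField K N} (hdeg : Module.finrank K L = p)
  (hram : IsTotallyRamified p K L)

include hdeg hram in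
-- This is e(N/K) = e(L/K)·e(N/L) with e(L/K) = p, each index over N being the order of an inertia
-- group.
theorem card_inertiaGroup_eq_mul :
    Nat.card (inertiaGroup p K N) =
      p * Nat.card (inertiaGroup p K N ⊓ L.fixingSubgroup : Subgroup (N ≃ₐ[K] N)) := by
  rw [card_inertiaGroup, ramificationIdx_tower p K L N, hram, hdeg, ← card_inertiaGroup,
    card_inertiaGroup_intermediateField]

variable (p) (K) (N) in
/-- The wild inertia group of the extension `N/K` of `p`-adic fields. -/
def wildInertiaGroup : Subgroup (N ≃ₐ[K] N) := wildInertia (intRing p N) (N ≃ₐ[K] N)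

instance wildInertiaGroup_normal : (wildInertiaGroup p K N).Normal :=
  wildInertia_normal

theorem wildInertiaGroup_le_inertiaGroup : wildInertiaGroup p K N ≤ inertiaGroup p K N := by
  rw [inertiaGroup, maxIdeal_eq_maximalIdeal]
  exact wildInertia_le_inertia

instance intRing_faithfulSMul_gal : FaithfulSMul (N ≃ₐ[K] N) (intRing p N) where
  eq_of_smul_eq_smul {σ τ} h := by
    ext x
    obtain ⟨a, b, -, rfl⟩ := IsFractionRing.div_surjective (A := intRing p N) x
    have ha := congrArg Subtype.val (h a)
    have hb := congrArg Subtype.val (h b)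
    simp only [coe_smul_intRing] at ha hb
    change σ ((a : N) / b) = τ ((a : N) / b)
    rw [map_div₀, map_div₀, ha, hb]

variable (hN : IsNormalClosure K L N)

include hdeg hram hN in
theorem isComplement'_wildInertiaGroup :
    Subgroup.IsComplement' (wildInertiaGroup p K N) L.fixingSubgroup := by
  have hp : p.Prime := Fact.out
  have hpm : (p : intRing p N) ∈ IsLocalRing.maximalIdeal (intRing p N) :=
    maxIdeal_eq_maximalIdeal p N ▸ natCast_mem_maxIdeal p N
  refine isComplement'_of_isPGroup (hdeg ▸ card_gal_eq_mul_card_fixingSubgroup L)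
    (not_dvd_card_fixingSubgroup L hp hdeg hN) (isPGroup_wildInertia hp hpm)
    (dvd_card_wildInertia hp hpm (maxIdeal_eq_maximalIdeal p N ▸ maxIdeal_ne_bot p N) ?_)
  rw [← maxIdeal_eq_maximalIdeal]
  exact Dvd.intro _ (card_inertiaGroup_eq_mul hdeg hram).symm

include hdeg hram hN in
-- Reduces every statement about an arbitrary Galois complement to the fixed field of wild inertia.
theorem eq_wildInertiaGroup_of_isComplement' {J : Subgroup (N ≃ₐ[K] N)}
    (hJ : Subgroup.IsComplement' J L.fixingSubgroup) : J = wildInertiaGroup p K N :=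
  eq_of_isComplement' (hdeg ▸ card_gal_eq_mul_card_fixingSubgroup L)
    (not_dvd_card_fixingSubgroup L Fact.out hdeg hN) inferInstance
    (isComplement'_wildInertiaGroup hdeg hram hN) hJ

include hdeg hram hN in
theorem exists_isAlmostClassicallyGaloisWith :
    IsAlmostClassicallyGaloisWith L (IntermediateField.fixedField (wildInertiaGroup p K N)) :=
  ⟨inferInstance, hN, _, inferInstance, isComplement'_wildInertiaGroup hdeg hram hN, rfl⟩

theorem fixingSubgroup_restrictScalars_inertiaField :
    ((inertiaField p L N).restrictScalars K).fixingSubgroup =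
      inertiaGroup p K N ⊓ L.fixingSubgroup := by
  ext σ
  constructor
  · intro hσ
    have hL : σ ∈ L.fixingSubgroup := by
      rw [IntermediateField.mem_fixingSubgroup_iff] at hσ ⊢
      exact fun x hx => hσ x ((inertiaField p L N).algebraMap_mem ⟨x, hx⟩)
    refine ⟨?_, hL⟩
    have h1 : L.fixingSubgroupEquiv ⟨σ, hL⟩ ∈ (inertiaField p L N).fixingSubgroup := hσ
    rw [inertiaField, IntermediateField.fixingSubgroup_fixedField] at h1
    exact h1
  · rintro ⟨hσ, hL⟩
    have h1 : L.fixingSubgroupEquiv ⟨σ, hL⟩ ∈ (inertiaField p L N).fixingSubgroup := by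
      rw [inertiaField, IntermediateField.fixingSubgroup_fixedField]
      exact hσ
    exact h1

variable {K' L' : IntermediateField K N} (hK' : K'.fixingSubgroup = inertiaGroup p K N)
  (hL' : L'.fixingSubgroup = inertiaGroup p K N ⊓ L.fixingSubgroup)

theorem le_of_fixingSubgroup_le {S T : IntermediateField K N}
    (h : T.fixingSubgroup ≤ S.fixingSubgroup) : S ≤ T := by
  rwa [← IsGalois.fixedField_fixingSubgroup T, IntermediateField.le_iff_le]

variable (hle : K' ≤ L')

include hdeg hram hK' hL' in
theorem finrank_extendScalars_inertiaField :
    Module.finrank K' (IntermediateField.extendScalars hle) = p := by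
  have h1 := Module.finrank_mul_finrank K' (IntermediateField.extendScalars hle) N
  have h2 : Module.finrank (IntermediateField.extendScalars hle) N = Module.finrank L' N := rfl
  rw [h2, ← IsGalois.card_fixingSubgroup_eq_finrank, ← IsGalois.card_fixingSubgroup_eq_finrank,
    hK', hL', card_inertiaGroup_eq_mul hdeg hram] at h1
  exact Nat.eq_of_mul_eq_mul_right Nat.card_pos h1

include hK' in
theorem isTotallyRamified_inertiaField : IsTotallyRamified p K' N :=
  isTotallyRamified_of_inertiaGroup_eq_top p K' N (inertiaGroup_fixedField_eq_top p hK'.le)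

include hdeg hram hN hK' hL' in
-- Because Gal(N/K) is the product of wild inertia and Gal(N/L), each K-embedding of L into N is the
-- restriction of a wild w, and w fixes K'. So an automorphism fixing all K'-conjugates of L' fixes
-- all K-conjugates of L ⊆ L', and is trivial.
theorem isNormalClosure_extendScalars_inertiaField :
    IsNormalClosure K' (IntermediateField.extendScalars hle) N := by
  refine isNormalClosure_of_forall_fixed _ fun σ hσ => ?_
  refine AlgEquiv.restrictScalars_injective K (galPermHom_injective hN ?_)
  ext f x
  obtain ⟨w, ⟨h, hh⟩, hwh⟩ : ∃ (w : wildInertiaGroup p K N) (h : L.fixingSubgroup),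
      (w : N ≃ₐ[K] N) * h = AlgEquiv.ofBijective (f.liftNormal N)
        (AlgHom.normal_bijective K N N _) := by
    obtain ⟨⟨w, h⟩, hwh⟩ := (isComplement'_wildInertiaGroup hdeg hram hN).2 _
    exact ⟨w, h, hwh⟩
  have hx : f x = w.1 x := by
    have h1 : f x = f.liftNormal N (algebraMap L N x) := (f.liftNormal_commutes N x).symm
    have h2 := DFunLike.congr_fun hwh (algebraMap L N x)
    rw [h1]
    refine h2.symm.trans (congrArg w.1 ?_)
    exact (IntermediateField.mem_fixingSubgroup_iff _ _).1 hh _ x.2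
  have hw : w.1 ∈ K'.fixingSubgroup := hK' ▸ wildInertiaGroup_le_inertiaGroup w.2
  have hxL : (x : N) ∈ L' := le_of_fixingSubgroup_le (hL'.le.trans inf_le_right) x.2
  change σ (f x) = f x
  rw [hx]
  exact hσ (K'.fixingSubgroupEquiv ⟨w.1, hw⟩) x hxL

/-- Restriction of scalars from `Gal(N/K')` to `Gal(N/K)`. -/
abbrev galRestrictScalars (K' : IntermediateField K N) : (N ≃ₐ[K'] N) →* (N ≃ₐ[K] N) :=
  AlgEquiv.restrictScalarsHom K

theorem exists_galRestrictScalars_eq {σ : N ≃ₐ[K] N} (h : σ ∈ K'.fixingSubgroup) :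
    ∃ τ, galRestrictScalars K' τ = σ :=
  ⟨K'.fixingSubgroupEquiv ⟨σ, h⟩, rfl⟩

include hdeg hram hN hK' hL' in
-- Wild inertia lies in Gal(N/K') = I, so pulling it back loses nothing and it keeps order p. The
-- other factor has order |I ∩ Gal(N/L)|, prime to p, and the product of the two orders is |I|.
theorem isComplement'_comap_wildInertiaGroup :
    Subgroup.IsComplement' ((wildInertiaGroup p K N).comap (galRestrictScalars K'))
      (IntermediateField.extendScalars hle).fixingSubgroup := by
  have hp : p.Prime := Fact.out
  have hW : Nat.card (wildInertiaGroup p K N) = p :=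
    Nat.eq_of_mul_eq_mul_right (Nat.card_pos (α := L.fixingSubgroup))
      ((isComplement'_wildInertiaGroup hdeg hram hN).card_mul_card.trans
        (hdeg ▸ card_gal_eq_mul_card_fixingSubgroup L))
  have hc : Nat.card ((wildInertiaGroup p K N).comap (galRestrictScalars K')) = p := by
    refine (Nat.card_eq_of_bijective (fun σ => (⟨galRestrictScalars K' σ.1, σ.2⟩ :
      wildInertiaGroup p K N)) ⟨?_, ?_⟩).trans hW
    · rintro ⟨σ, hσ⟩ ⟨τ, hτ⟩ h
      exact Subtype.ext (AlgEquiv.restrictScalars_injective K (congrArg Subtype.val h))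
    · rintro ⟨σ, hσ⟩
      obtain ⟨τ, rfl⟩ := exists_galRestrictScalars_eq
        (hK' ▸ wildInertiaGroup_le_inertiaGroup hσ : σ ∈ K'.fixingSubgroup)
      exact ⟨⟨τ, hσ⟩, rfl⟩
  have hf : Nat.card (IntermediateField.extendScalars hle).fixingSubgroup =
      Nat.card (inertiaGroup p K N ⊓ L.fixingSubgroup : Subgroup (N ≃ₐ[K] N)) := by
    rw [← hL', IsGalois.card_fixingSubgroup_eq_finrank, IsGalois.card_fixingSubgroup_eq_finrank]
    rfl
  refine Subgroup.isComplement'_of_coprime ?_ ?_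
  · rw [hc, hf, IsGalois.card_aut_eq_finrank, ← card_inertiaGroup_eq_mul hdeg hram, ← hK',
      IsGalois.card_fixingSubgroup_eq_finrank]
  · rw [hc, hf, Nat.Prime.coprime_iff_not_dvd hp]
    exact fun h => not_dvd_card_fixingSubgroup L hp hdeg hN
      (h.trans (Subgroup.card_dvd_of_le inf_le_right))

include hdeg hram hN hK' hL' in
theorem isAlmostClassicallyGaloisWith_extendScalars {M : IntermediateField K N}
    (hM : IsAlmostClassicallyGaloisWith L M) :
    ∃ hM : K' ≤ M, IsAlmostClassicallyGaloisWith
      (IntermediateField.extendScalars hle) (IntermediateField.extendScalars hM) := by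
  obtain ⟨-, -, J, -, hJ, rfl⟩ := hM
  obtain rfl := eq_wildInertiaGroup_of_isComplement' hdeg hram hN hJ
  have hWK : wildInertiaGroup p K N ≤ K'.fixingSubgroup :=
    hK' ▸ wildInertiaGroup_le_inertiaGroup
  refine ⟨(IntermediateField.le_iff_le _ _).2 hWK, inferInstance,
    isNormalClosure_extendScalars_inertiaField hdeg hram hN hK' hL' hle, _,
    Subgroup.Normal.comap inferInstance _,
    isComplement'_comap_wildInertiaGroup hdeg hram hN hK' hL' hle, ?_⟩
  ext x
  rw [IntermediateField.mem_extendScalars, IntermediateField.mem_fixedField_iff,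
    IntermediateField.mem_fixedField_iff]
  constructor
  · exact fun h σ hσ => h _ hσ
  · intro h σ hσ
    obtain ⟨τ, rfl⟩ := exists_galRestrictScalars_eq (hWK hσ)
    exact h τ hσ

end

end Ramified

/-! ### Galois descent for spaces of functions -/

section Descent

variable {K N : Type*} [Field K] [Field N] [Algebra K N]

/-- The `K`-space of functions on `Y` with values in `N` that commute with the actions of
`Gal(N/K)`. -/
def equivariantFun {Y : Type*} (θ : (N ≃ₐ[K] N) →* Equiv.Perm Y) : Submodule K (Y → N) where
  carrier := {f | ∀ g y, f (θ g y) = g (f y)}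
  add_mem' ha hb g y := by simp [ha g y, hb g y]
  zero_mem' g y := by simp
  smul_mem' c f hf g y := by simp [hf g y]

variable [FiniteDimensional K N] [IsGalois K N] {Y : Type*} {θ : (N ≃ₐ[K] N) →* Equiv.Perm Y}

/-- Multiply an N-linear relation by n and sum its Galois conjugates: equivariance turns it into a
K-linear relation with coefficients Tr(n·cᵢ). These vanish for all n, and the trace form is
nondegenerate. -/
theorem linearIndependent_of_mem_equivariantFun {ι : Type*} {f : ι → Y → N}
    (hf : ∀ i, f i ∈ equivariantFun θ) (h : LinearIndependent K f) : LinearIndependent N f := by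
  rw [linearIndependent_iff'] at h ⊢
  intro s c hc i hi
  have key : ∀ n : N, Algebra.trace K N (n * c i) = 0 := by
    intro n
    refine h s (fun i => Algebra.trace K N (n * c i)) ?_ i hi
    ext y
    have h1 : ∀ g : N ≃ₐ[K] N, ∑ j ∈ s, g (n * c j) * f j y = 0 := by
      intro g
      have h2 := congrFun hc (θ g⁻¹ y)
      rw [Finset.sum_apply] at h2
      have h3 := congrArg (fun z => g (n * z)) h2
      simp only [Pi.smul_apply, smul_eq_mul, Finset.mul_sum, map_sum, Pi.zero_apply, mul_zero,
        map_zero] at h3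
      rw [← h3]
      refine Finset.sum_congr rfl fun j _ => ?_
      rw [← mul_assoc, map_mul g (n * c j), ← hf j g, ← Equiv.Perm.mul_apply, ← map_mul,
        mul_inv_cancel, map_one, Equiv.Perm.one_apply]
    rw [Finset.sum_apply]
    simp only [Pi.smul_apply, Algebra.smul_def, trace_eq_sum_automorphisms, Finset.sum_mul,
      Pi.zero_apply]
    rw [Finset.sum_comm]
    exact Finset.sum_eq_zero fun g _ => h1 g
  exact (traceForm_nondegenerate K N).2 (c i) key

variable [Finite Y]

/-- A functional killing the equivariant functions kills the orbit sums ∑ g(n)·δ_{θ(g)y} for every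
n. Dedekind independence of the automorphisms then makes it vanish on each δ_{θ(g)y}, in particular
on δ_y. -/
theorem span_equivariantFun : Submodule.span N (equivariantFun θ : Set (Y → N)) = ⊤ := by
  classical
  have := Fintype.ofFinite Y
  by_contra hne
  obtain ⟨φ, hφ, hker⟩ := Submodule.exists_le_ker_of_lt_top _ (lt_top_iff_ne_top.2 hne)
  refine hφ ?_
  refine (Pi.basisFun N Y).ext fun y => ?_
  have h1 : ∀ n : N, ∑ g : N ≃ₐ[K] N, φ (Pi.single (θ g y) 1) * g n = 0 := by
    intro n
    have h2 : (∑ g : N ≃ₐ[K] N, (g n) • (Pi.single (θ g y) 1 : Y → N)) ∈ equivariantFun θ := by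
      intro k z
      simp only [Finset.sum_apply, Pi.smul_apply, smul_eq_mul, map_sum, map_mul]
      refine Fintype.sum_equiv (Equiv.mulLeft k⁻¹) _ _ fun g => ?_
      have h3 : k ((Equiv.mulLeft k⁻¹ g) n) = g n := by
        rw [← AlgEquiv.mul_apply, Equiv.coe_mulLeft, mul_inv_cancel_left]
      rw [h3]
      congr 1
      rw [Pi.single_apply, Pi.single_apply, Equiv.coe_mulLeft, map_mul, Equiv.Perm.mul_apply,
        map_inv, Equiv.Perm.eq_inv_iff_eq]
      split_ifs <;> simp
    have h4 : φ _ = 0 := hker (Submodule.subset_span h2)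
    rw [map_sum] at h4
    rw [← h4]
    refine Finset.sum_congr rfl fun g _ => ?_
    rw [map_smul, smul_eq_mul, mul_comm]
  have hli := linearIndependent_toLinearMap K N N
  have hli' := hli.comp (fun g : N ≃ₐ[K] N => g.toAlgHom)
    (fun g k h => AlgEquiv.ext fun x => DFunLike.congr_fun h x)
  rw [Fintype.linearIndependent_iff] at hli'
  have h5 := hli' (fun g => φ (Pi.single (θ g y) 1)) (by
    ext n
    simpa [LinearMap.sum_apply] using h1 n) 1
  simpa using h5

theorem finrank_equivariantFun : Module.finrank K (equivariantFun θ) = Nat.card Y := by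
  have := Fintype.ofFinite Y
  have : FiniteDimensional K (Y → N) := .trans K N _
  let b := Module.finBasis K (equivariantFun θ)
  have hli : LinearIndependent N (fun i => (b i : Y → N)) :=
    linearIndependent_of_mem_equivariantFun (fun i => (b i).2)
      (b.linearIndependent.map' (equivariantFun θ).subtype (Submodule.ker_subtype _))
  have hsp : ⊤ ≤ Submodule.span N (Set.range fun i => (b i : Y → N)) := by
    rw [← span_equivariantFun (θ := θ), Submodule.span_le]
    intro f hf
    have h1 : (⟨f, hf⟩ : equivariantFun θ) = _ := (b.sum_repr ⟨f, hf⟩).symm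
    have h2 := congrArg Subtype.val h1
    simp only [Submodule.coe_sum, Submodule.coe_smul] at h2
    rw [h2]
    refine sum_mem fun i _ => ?_
    rw [← algebraMap_smul N]
    exact Submodule.smul_mem _ _ (Submodule.subset_span ⟨i, rfl⟩)
  have h3 := Module.finrank_eq_card_basis (Module.Basis.mk hli hsp)
  rw [Module.finrank_fintype_fun_eq_card, Fintype.card_fin] at h3
  rw [← h3, Nat.card_eq_fintype_card]

/-- A map on a tensor product given by multiplication of functions is injective, if the first
factor consists of equivariant functions. -/
theorem injective_of_tmul_eq_mul {A B X : Type*} [AddCommGroup A] [Module K A] [AddCommGroup B]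
    [Module K B] (α : A →ₗ[K] Y → N) (hα : Function.Injective α)
    (hα' : ∀ a, α a ∈ equivariantFun θ) (β : B →ₗ[K] X → N) (hβ : Function.Injective β)
    (μ : A ⊗[K] B →ₗ[K] Y × X → N) (hμ : ∀ a b y x, μ (a ⊗ₜ b) (y, x) = α a y * β b x) :
    Function.Injective μ := by
  rw [injective_iff_map_eq_zero]
  intro t ht
  let b := Module.Basis.ofVectorSpace K A
  obtain ⟨c, rfl⟩ := TensorProduct.eq_repr_basis_left b t
  have hli : LinearIndependent N (fun i => α (b i)) :=
    linearIndependent_of_mem_equivariantFun (fun i => hα' _)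
      (b.linearIndependent.map' α (LinearMap.ker_eq_bot.2 hα))
  have h1 : ∀ i ∈ c.support, c i = 0 := by
    intro i hi
    refine (map_eq_zero_iff β hβ).1 (funext fun x => ?_)
    refine (linearIndependent_iff'.1 hli) c.support (fun i => β (c i) x) ?_ i hi
    ext y
    have h2 := congrFun ht (y, x)
    rw [Finsupp.sum, map_sum, Finset.sum_apply] at h2
    simp only [hμ, Pi.zero_apply] at h2
    rw [Finset.sum_apply]
    simpa [mul_comm] using h2
  rw [Finsupp.sum]
  exact Finset.sum_eq_zero fun i hi => by rw [h1 i hi, TensorProduct.tmul_zero]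

end Descent

/-! ### The Hopf algebra of invariants of a group algebra -/

section InvariantAlgebra

variable {K N : Type*} [Field K] [Field N] [Algebra K N]

theorem coeff_mul_eq_sum {Γ : Type*} [Group Γ] [Fintype Γ] (a b : MonoidAlgebra N Γ) (z : Γ) :
    (a * b).coeff z = ∑ x, a.coeff x * b.coeff (x⁻¹ * z) := by
  rw [MonoidAlgebra.coeff_mul_apply_left, Finsupp.sum_fintype _ _ (by simp)]

theorem coeff_algebraMap {Γ : Type*} [Group Γ] (k : K) (z : Γ) [Decidable (z = 1)] :
    (algebraMap K (MonoidAlgebra N Γ) k).coeff z = if z = 1 then algebraMap K N k else 0 := by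
  classical
  rw [MonoidAlgebra.coe_algebraMap, Function.comp_apply, MonoidAlgebra.coeff_single,
    Finsupp.single_apply]
  exact if_congr eq_comm rfl rfl

theorem coeff_mapDomain_inl_mul_mapDomain_inr {Γ : Type*} [Group Γ] (a b : MonoidAlgebra N Γ)
    (x y : Γ) : (a.mapDomain (MonoidHom.inl Γ Γ) * b.mapDomain (MonoidHom.inr Γ Γ)).coeff (x, y) =
      a.coeff x * b.coeff y := by
  classical
  induction a using MonoidAlgebra.induction_linear with
  | zero => simp
  | add a a' ha ha' =>
    rw [MonoidAlgebra.mapDomain_add, add_mul, MonoidAlgebra.coeff_add, Finsupp.add_apply, ha, ha',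
      MonoidAlgebra.coeff_add, Finsupp.add_apply, add_mul]
  | single u r =>
    induction b using MonoidAlgebra.induction_linear with
    | zero => simp
    | add b b' hb hb' =>
      rw [MonoidAlgebra.mapDomain_add, mul_add, MonoidAlgebra.coeff_add, Finsupp.add_apply, hb, hb',
        MonoidAlgebra.coeff_add, Finsupp.add_apply, mul_add]
    | single v t =>
      simp only [MonoidAlgebra.mapDomain_single, MonoidAlgebra.single_mul_single,
        MonoidAlgebra.coeff_single, Finsupp.single_apply, MonoidHom.inl_apply, MonoidHom.inr_apply,
        Prod.mk_mul_mk, mul_one, one_mul, Prod.mk.injEq]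
      split_ifs <;> simp_all

theorem coeff_mapDomain_diag {Γ : Type*} [Group Γ] [DecidableEq Γ] (a : MonoidAlgebra N Γ)
    (x y : Γ) : (a.mapDomain ((MonoidHom.id Γ).prod (MonoidHom.id Γ))).coeff (x, y) =
      if x = y then a.coeff x else 0 := by
  induction a using MonoidAlgebra.induction_linear with
  | zero => simp
  | add a a' ha ha' => simp only [MonoidAlgebra.mapDomain_add, MonoidAlgebra.coeff_add,
      Finsupp.add_apply, ha, ha']; split_ifs <;> simp
  | single u r =>
    simp only [MonoidAlgebra.mapDomain_single, MonoidAlgebra.coeff_single, Finsupp.single_apply,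
      MonoidHom.prod_apply, MonoidHom.id_apply, Prod.mk.injEq]
    grind

variable {Γ : Type*} [CommGroup Γ] [Finite Γ]

/-- The `K`-algebra `N[Γ]^G` of invariants of the group algebra `N[Γ]` under the semilinear action
of `G = Gal(N/K)` attached to an action of `G` on `Γ`. -/
def invAlg (θ : (N ≃ₐ[K] N) →* MulAut Γ) : Subalgebra K (MonoidAlgebra N Γ) where
  carrier := {a | ∀ g x, a.coeff (θ g x) = g (a.coeff x)}
  add_mem' ha hb g x := by simp [ha g x, hb g x]
  mul_mem' {a b} ha hb g x := by
    have := Fintype.ofFinite Γ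
    rw [coeff_mul_eq_sum, coeff_mul_eq_sum, map_sum]
    refine (Fintype.sum_equiv (θ g).toEquiv _ _ fun y => ?_).symm
    rw [map_mul, ← ha g, ← hb g, map_mul, map_inv]
    rfl
  algebraMap_mem' k g x := by
    classical
    rw [coeff_algebraMap, coeff_algebraMap, map_eq_one_iff _ (θ g).injective]
    split_ifs <;> simp

/-- The `K`-algebra `N[Γ]^G`, as a type. -/
def InvAlg (θ : (N ≃ₐ[K] N) →* MulAut Γ) : Type _ := invAlg θ

instance (θ : (N ≃ₐ[K] N) →* MulAut Γ) : CommRing (InvAlg θ) :=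
  inferInstanceAs (CommRing (invAlg θ))

instance (θ : (N ≃ₐ[K] N) →* MulAut Γ) : Algebra K (InvAlg θ) :=
  inferInstanceAs (Algebra K (invAlg θ))

/-- The inclusion of `N[Γ]^G` in `N[Γ]`. -/
def invAlgVal (θ : (N ≃ₐ[K] N) →* MulAut Γ) : InvAlg θ →ₐ[K] MonoidAlgebra N Γ :=
  (invAlg θ).val

/-- The coefficients of an element of `N[Γ]^G`. -/
def invAlgCoeff (θ : (N ≃ₐ[K] N) →* MulAut Γ) : InvAlg θ →ₗ[K] Γ → N where
  toFun a x := (invAlgVal θ a).coeff x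
  map_add' a b := by rw [map_add]; rfl
  map_smul' k a := by rw [map_smul]; rfl

variable {θ : (N ≃ₐ[K] N) →* MulAut Γ}

theorem invAlgCoeff_apply (a : InvAlg θ) (x : Γ) :
    invAlgCoeff θ a x = (invAlgVal θ a).coeff x := rfl

theorem invAlgCoeff_injective : Function.Injective (invAlgCoeff θ) := fun _ _ h =>
  Subtype.ext (MonoidAlgebra.ext (DFunLike.coe_injective h))

theorem invAlg_ext {a b : InvAlg θ} (h : ∀ x, invAlgCoeff θ a x = invAlgCoeff θ b x) : a = b :=
  invAlgCoeff_injective (funext h)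

theorem invAlgCoeff_act (a : InvAlg θ) (g : N ≃ₐ[K] N) (x : Γ) :
    invAlgCoeff θ a (θ g x) = g (invAlgCoeff θ a x) := a.2 g x

theorem invAlgCoeff_mem (a : InvAlg θ) :
    invAlgCoeff θ a ∈ equivariantFun ((MulAut.toPerm Γ).comp θ) := invAlgCoeff_act a

theorem invAlgCoeff_mul [Fintype Γ] (a b : InvAlg θ) (z : Γ) :
    invAlgCoeff θ (a * b) z = ∑ x, invAlgCoeff θ a x * invAlgCoeff θ b (x⁻¹ * z) := by
  simp only [invAlgCoeff_apply, map_mul, coeff_mul_eq_sum]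

theorem invAlgCoeff_algebraMap [DecidableEq Γ] (k : K) (z : Γ) :
    invAlgCoeff θ (algebraMap K _ k) z = if z = 1 then algebraMap K N k else 0 := by
  rw [invAlgCoeff_apply, AlgHom.commutes, coeff_algebraMap]

/-- An element of `N[Γ]^G` with given equivariant coefficients. -/
def invAlgMk (f : Γ → N) (hf : ∀ g x, f (θ g x) = g (f x)) : InvAlg θ :=
  ⟨.ofCoeff (Finsupp.equivFunOnFinite.symm f), hf⟩

variable [FiniteDimensional K N] [IsGalois K N]

theorem finrank_invAlg : Module.finrank K (InvAlg θ) = Nat.card Γ := by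
  rw [← finrank_equivariantFun (θ := (MulAut.toPerm Γ).comp θ)]
  refine LinearEquiv.finrank_eq (.ofBijective
    ((invAlgCoeff θ).codRestrict _ invAlgCoeff_mem) ⟨?_, fun f => ⟨invAlgMk f.1 f.2, rfl⟩⟩)
  exact fun a b h => invAlgCoeff_injective (congrArg Subtype.val h)

instance invAlg_finiteDimensional : FiniteDimensional K (InvAlg θ) :=
  .of_finrank_pos (by rw [finrank_invAlg]; exact Nat.card_pos)

variable (θ) in
/-- The diagonal action on `Γ × Γ`. -/
def diagAct : (N ≃ₐ[K] N) →* MulAut (Γ × Γ) where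
  toFun g := MulEquiv.prodCongr (θ g) (θ g)
  map_one' := by rw [map_one]; rfl
  map_mul' g h := by rw [map_mul]; rfl

variable (θ) in
/-- The natural map `N[Γ]^G ⊗ N[Γ]^G → N[Γ × Γ]`. -/
def invAlgTensor : InvAlg θ ⊗[K] InvAlg θ →ₐ[K] MonoidAlgebra N (Γ × Γ) :=
  Algebra.TensorProduct.lift
    ((MonoidAlgebra.mapDomainAlgHom K N (MonoidHom.inl Γ Γ)).comp (invAlgVal θ))
    ((MonoidAlgebra.mapDomainAlgHom K N (MonoidHom.inr Γ Γ)).comp (invAlgVal θ))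
    fun _ _ => Commute.all _ _

theorem coeff_invAlgTensor_tmul (a b : InvAlg θ) (x y : Γ) :
    (invAlgTensor θ (a ⊗ₜ b)).coeff (x, y) = invAlgCoeff θ a x * invAlgCoeff θ b y := by
  rw [invAlgTensor, Algebra.TensorProduct.lift_tmul]
  exact coeff_mapDomain_inl_mul_mapDomain_inr (invAlgVal θ a) (invAlgVal θ b) x y

/-- The coefficients of the image of an element of `N[Γ]^G ⊗ N[Γ]^G` in `N[Γ × Γ]`. -/
def tensorCoeff (θ : (N ≃ₐ[K] N) →* MulAut Γ) : InvAlg θ ⊗[K] InvAlg θ →ₗ[K] Γ × Γ → N where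
  toFun t z := (invAlgTensor θ t).coeff z
  map_add' s t := by ext; simp
  map_smul' k t := by ext; simp

@[simp]
theorem tensorCoeff_tmul (a b : InvAlg θ) (x y : Γ) :
    tensorCoeff θ (a ⊗ₜ b) (x, y) = invAlgCoeff θ a x * invAlgCoeff θ b y :=
  coeff_invAlgTensor_tmul a b x y

/-- Lets identities in N[Γ]^G ⊗ N[Γ]^G be checked on coefficient functions Γ × Γ → N. -/
theorem tensorCoeff_injective : Function.Injective (tensorCoeff θ) :=
  injective_of_tmul_eq_mul (invAlgCoeff θ) invAlgCoeff_injective invAlgCoeff_mem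
    (invAlgCoeff θ) invAlgCoeff_injective _ tensorCoeff_tmul

theorem invAlgTensor_injective : Function.Injective (invAlgTensor θ) := fun s t h =>
  tensorCoeff_injective (by ext z; exact congrArg (fun a => a.coeff z) h)

theorem invAlgTensor_mem (t : InvAlg θ ⊗[K] InvAlg θ) : invAlgTensor θ t ∈ invAlg (diagAct θ) := by
  induction t with
  | zero => simp
  | add s t hs ht => rw [map_add]; exact add_mem hs ht
  | tmul a b =>
    rintro g ⟨x, y⟩
    change (invAlgTensor θ (a ⊗ₜ b)).coeff (θ g x, θ g y) = _
    rw [coeff_invAlgTensor_tmul, coeff_invAlgTensor_tmul, map_mul, invAlgCoeff_act, invAlgCoeff_act]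

variable (θ) in
/-- The natural map `N[Γ]^G ⊗ N[Γ]^G → N[Γ × Γ]^G`. -/
def invAlgTensorRestrict : InvAlg θ ⊗[K] InvAlg θ →ₐ[K] InvAlg (diagAct θ) :=
  (invAlgTensor θ).codRestrict (invAlg (diagAct θ)) invAlgTensor_mem

/-- Both sides have K-dimension |Γ|². Surjectivity is what allows the diagonal map of N[Γ] to
restrict to a comultiplication on the invariants. -/
theorem invAlgTensorRestrict_bijective : Function.Bijective (invAlgTensorRestrict θ) := by
  have hinj : Function.Injective (invAlgTensorRestrict θ) := fun s t h =>
    invAlgTensor_injective (congrArg Subtype.val h)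
  have hf : Module.finrank K (InvAlg θ ⊗[K] InvAlg θ) = Module.finrank K (InvAlg (diagAct θ)) := by
    rw [Module.finrank_tensorProduct, finrank_invAlg, finrank_invAlg, Nat.card_prod]
  exact ⟨hinj, (LinearMap.injective_iff_surjective_of_finrank_eq_finrank
    (f := (invAlgTensorRestrict θ).toLinearMap) hf).1 hinj⟩

variable (θ) in
/-- The natural isomorphism `N[Γ]^G ⊗ N[Γ]^G ≃ N[Γ × Γ]^G`. -/
def invAlgTensorEquiv : InvAlg θ ⊗[K] InvAlg θ ≃ₐ[K] InvAlg (diagAct θ) :=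
  .ofBijective (invAlgTensorRestrict θ) invAlgTensorRestrict_bijective

theorem mapDomain_diag_mem (a : InvAlg θ) :
    (invAlgVal θ a).mapDomain ((MonoidHom.id Γ).prod (MonoidHom.id Γ)) ∈ invAlg (diagAct θ) := by
  classical
  rintro g ⟨x, y⟩
  refine (coeff_mapDomain_diag (invAlgVal θ a) (θ g x) (θ g y)).trans ?_
  rw [coeff_mapDomain_diag, (θ g).injective.eq_iff, ← invAlgCoeff_apply, invAlgCoeff_act]
  split_ifs
  · rfl
  · simp

variable (θ) in
/-- The diagonal map `N[Γ]^G → N[Γ × Γ]^G`. -/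
def invAlgDiag : InvAlg θ →ₐ[K] InvAlg (diagAct θ) :=
  ((MonoidAlgebra.mapDomainAlgHom K N ((MonoidHom.id Γ).prod (MonoidHom.id Γ))).comp
    (invAlgVal θ)).codRestrict (invAlg (diagAct θ)) mapDomain_diag_mem

variable (θ) in
/-- The comultiplication of `N[Γ]^G`. -/
def invAlgComul : InvAlg θ →ₐ[K] InvAlg θ ⊗[K] InvAlg θ :=
  (invAlgTensorEquiv θ).symm.toAlgHom.comp (invAlgDiag θ)

/-- Elements of Γ are group-like, so the comultiplication is supported on the diagonal. The
coalgebra and antipode axioms are all verified through this formula. -/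
theorem tensorCoeff_comul [DecidableEq Γ] (a : InvAlg θ) (x y : Γ) :
    tensorCoeff θ (invAlgComul θ a) (x, y) = if x = y then invAlgCoeff θ a x else 0 := by
  rw [invAlgCoeff_apply, ← coeff_mapDomain_diag]
  have h : invAlgTensorEquiv θ (invAlgComul θ a) = invAlgDiag θ a :=
    (invAlgTensorEquiv θ).apply_symm_apply _
  exact congrArg (fun b => invAlgCoeff (diagAct θ) b (x, y)) h

variable (θ) in
/-- The augmentation `N[Γ]^G → N`. -/
def invAlgAug : InvAlg θ →ₐ[K] N :=
  ((MonoidAlgebra.lift N N Γ 1).restrictScalars K).comp (invAlgVal θ)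

theorem invAlgAug_apply [Fintype Γ] (a : InvAlg θ) : invAlgAug θ a = ∑ x, invAlgCoeff θ a x := by
  refine (MonoidAlgebra.lift_apply _ _).trans ?_
  rw [Finsupp.sum_fintype _ _ (by simp)]
  simp
  rfl

theorem invAlgAug_mem_bot (a : InvAlg θ) : invAlgAug θ a ∈ (⊥ : Subalgebra K N) := by
  have := Fintype.ofFinite Γ
  change _ ∈ (⊥ : IntermediateField K N)
  rw [IsGalois.mem_bot_iff_fixed]
  intro g
  rw [invAlgAug_apply, map_sum]
  exact Fintype.sum_equiv (θ g).toEquiv _ _ fun x => (invAlgCoeff_act a g x).symm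

variable (θ) in
/-- The counit of `N[Γ]^G`. -/
def invAlgCounit : InvAlg θ →ₐ[K] K :=
  (Algebra.botEquiv K N).toAlgHom.comp ((invAlgAug θ).codRestrict ⊥ invAlgAug_mem_bot)

theorem algebraMap_counit [Fintype Γ] (a : InvAlg θ) :
    algebraMap K N (invAlgCounit θ a) = ∑ x, invAlgCoeff θ a x := by
  rw [← invAlgAug_apply]
  have h := (Algebra.botEquiv K N).symm_apply_apply
    ((invAlgAug θ).codRestrict ⊥ (invAlgAug_mem_bot (θ := θ)) a)
  exact congrArg Subtype.val h

variable (θ) in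
/-- The antipode of `N[Γ]^G`. -/
def invAlgAntipode : InvAlg θ →ₗ[K] InvAlg θ where
  toFun a := invAlgMk (fun x => invAlgCoeff θ a x⁻¹) fun g x => by rw [← map_inv, invAlgCoeff_act]
  map_add' _ _ := invAlg_ext fun _ => rfl
  map_smul' _ _ := invAlg_ext fun _ => rfl

variable (θ) in
/-- The coefficients of an element of `N[Γ]^G ⊗ (N[Γ]^G ⊗ N[Γ]^G)`. -/
def tripleCoeff : InvAlg θ ⊗[K] (InvAlg θ ⊗[K] InvAlg θ) →ₗ[K] Γ × Γ × Γ → N :=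
  TensorProduct.lift
    { toFun a :=
        { toFun t z := invAlgCoeff θ a z.1 * tensorCoeff θ t z.2
          map_add' s t := by ext; simp [mul_add]
          map_smul' k t := by ext; simp }
      map_add' a b := by ext; simp [add_mul]
      map_smul' k a := by ext; simp }

@[simp]
theorem tripleCoeff_tmul (a : InvAlg θ) (t : InvAlg θ ⊗[K] InvAlg θ) (x : Γ) (z : Γ × Γ) :
    tripleCoeff θ (a ⊗ₜ t) (x, z) = invAlgCoeff θ a x * tensorCoeff θ t z := rfl

theorem tripleCoeff_injective : Function.Injective (tripleCoeff θ) :=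
  injective_of_tmul_eq_mul (invAlgCoeff θ) invAlgCoeff_injective invAlgCoeff_mem
    (tensorCoeff θ) tensorCoeff_injective _ tripleCoeff_tmul

theorem tripleCoeff_assoc_tmul (s : InvAlg θ ⊗[K] InvAlg θ) (c : InvAlg θ) (x y z : Γ) :
    tripleCoeff θ (TensorProduct.assoc K _ _ _ (s ⊗ₜ[K] c)) (x, y, z) =
      tensorCoeff θ s (x, y) * invAlgCoeff θ c z := by
  induction s with
  | zero => simp
  | add s t hs ht => simp [TensorProduct.add_tmul, hs, ht, add_mul]
  | tmul a b => simp [mul_assoc]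

theorem tripleCoeff_assoc_map_comul [DecidableEq Γ] (t : InvAlg θ ⊗[K] InvAlg θ) (x y z : Γ) :
    tripleCoeff θ (TensorProduct.assoc K _ _ _
      (Algebra.TensorProduct.map (invAlgComul θ) (AlgHom.id K _) t)) (x, y, z) =
      if x = y then tensorCoeff θ t (x, z) else 0 := by
  induction t with
  | zero => simp
  | add s t hs ht => rw [map_add, map_add, map_add, Pi.add_apply, hs, ht]; split_ifs <;> simp
  | tmul a b =>
    rw [Algebra.TensorProduct.map_tmul, tripleCoeff_assoc_tmul, tensorCoeff_comul]
    split_ifs <;> simp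

theorem tripleCoeff_map_comul [DecidableEq Γ] (t : InvAlg θ ⊗[K] InvAlg θ) (x y z : Γ) :
    tripleCoeff θ (Algebra.TensorProduct.map (AlgHom.id K _) (invAlgComul θ) t) (x, y, z) =
      if y = z then tensorCoeff θ t (x, y) else 0 := by
  induction t with
  | zero => simp
  | add s t hs ht => rw [map_add, map_add, Pi.add_apply, hs, ht]; split_ifs <;> simp
  | tmul a b =>
    rw [Algebra.TensorProduct.map_tmul, tripleCoeff_tmul, tensorCoeff_comul]
    split_ifs <;> simp

theorem coeff_lid_map_counit [Fintype Γ] (t : InvAlg θ ⊗[K] InvAlg θ) (y : Γ) :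
    invAlgCoeff θ (Algebra.TensorProduct.lid K (InvAlg θ)
      (Algebra.TensorProduct.map (invAlgCounit θ) (AlgHom.id K _) t)) y =
      ∑ x, tensorCoeff θ t (x, y) := by
  induction t with
  | zero => simp
  | add s t hs ht => simp [hs, ht, Finset.sum_add_distrib]
  | tmul a b =>
    simp only [Algebra.TensorProduct.map_tmul, Algebra.TensorProduct.lid_tmul, tensorCoeff_tmul,
      ← Finset.sum_mul, ← algebraMap_counit]
    rw [map_smul, Pi.smul_apply, Algebra.smul_def, AlgHom.id_apply]

theorem coeff_rid_map_counit [Fintype Γ] (t : InvAlg θ ⊗[K] InvAlg θ) (x : Γ) :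
    invAlgCoeff θ (Algebra.TensorProduct.rid K K (InvAlg θ)
      (Algebra.TensorProduct.map (AlgHom.id K _) (invAlgCounit θ) t)) x =
      ∑ y, tensorCoeff θ t (x, y) := by
  induction t with
  | zero => simp
  | add s t hs ht => simp [hs, ht, Finset.sum_add_distrib]
  | tmul a b =>
    simp only [Algebra.TensorProduct.map_tmul, Algebra.TensorProduct.rid_tmul, tensorCoeff_tmul,
      ← Finset.mul_sum, ← algebraMap_counit]
    rw [map_smul, Pi.smul_apply, Algebra.smul_def, AlgHom.id_apply, mul_comm]

instance invAlg_bialgebra : Bialgebra K (InvAlg θ) :=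
  Bialgebra.ofAlgHom (invAlgComul θ) (invAlgCounit θ)
    (by
      classical
      refine AlgHom.ext fun a => tripleCoeff_injective (funext fun ⟨x, y, z⟩ => ?_)
      refine (tripleCoeff_assoc_map_comul _ x y z).trans
        (Eq.trans ?_ (tripleCoeff_map_comul _ x y z).symm)
      have h := tensorCoeff_comul a
      simp only [RingHom.coe_coe] at h ⊢
      rw [h, h]
      split_ifs <;> simp_all)
    (by
      classical
      have := Fintype.ofFinite Γ
      refine AlgHom.ext fun a => (Algebra.TensorProduct.lid K (InvAlg θ)).injective
        (invAlg_ext fun y => ?_)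
      refine (coeff_lid_map_counit _ y).trans ?_
      simp [tensorCoeff_comul])
    (by
      classical
      have := Fintype.ofFinite Γ
      refine AlgHom.ext fun a => (Algebra.TensorProduct.rid K K (InvAlg θ)).injective
        (invAlg_ext fun y => ?_)
      refine (coeff_rid_map_counit _ y).trans ?_
      simp [tensorCoeff_comul])

theorem invAlg_comul (a : InvAlg θ) : Coalgebra.comul (R := K) a = invAlgComul θ a := rfl

theorem invAlg_counit (a : InvAlg θ) : Coalgebra.counit (R := K) a = invAlgCounit θ a := rfl

theorem coeff_mul'_rTensor_antipode [Fintype Γ] (t : InvAlg θ ⊗[K] InvAlg θ) (z : Γ) :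
    invAlgCoeff θ (LinearMap.mul' K (InvAlg θ) ((invAlgAntipode θ).rTensor _ t)) z =
      ∑ x, tensorCoeff θ t (x, x * z) := by
  induction t with
  | zero => simp
  | add s t hs ht => simp [hs, ht, Finset.sum_add_distrib]
  | tmul a b =>
    rw [LinearMap.rTensor_tmul, LinearMap.mul'_apply, invAlgCoeff_mul]
    refine Fintype.sum_equiv (Equiv.inv Γ) _ _ fun x => ?_
    rw [tensorCoeff_tmul]
    rfl

theorem coeff_mul'_lTensor_antipode [Fintype Γ] (t : InvAlg θ ⊗[K] InvAlg θ) (z : Γ) :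
    invAlgCoeff θ (LinearMap.mul' K (InvAlg θ) ((invAlgAntipode θ).lTensor _ t)) z =
      ∑ x, tensorCoeff θ t (x, x * z⁻¹) := by
  induction t with
  | zero => simp
  | add s t hs ht => simp [hs, ht, Finset.sum_add_distrib]
  | tmul a b =>
    rw [LinearMap.lTensor_tmul, LinearMap.mul'_apply, invAlgCoeff_mul]
    refine Finset.sum_congr rfl fun x _ => ?_
    rw [tensorCoeff_tmul]
    congr 1
    change invAlgCoeff θ b (x⁻¹ * z)⁻¹ = _
    rw [mul_inv_rev, inv_inv, mul_comm]

instance invAlg_hopfAlgebra : HopfAlgebra K (InvAlg θ) where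
  antipode := invAlgAntipode θ
  mul_antipode_rTensor_comul := by
    classical
    have := Fintype.ofFinite Γ
    refine LinearMap.ext fun a => invAlg_ext fun z => ?_
    refine (coeff_mul'_rTensor_antipode _ z).trans (Eq.trans ?_ (invAlgCoeff_algebraMap _ z).symm)
    rw [invAlg_counit, algebraMap_counit, invAlg_comul]
    simp [tensorCoeff_comul, Finset.sum_ite_irrel]
  mul_antipode_lTensor_comul := by
    classical
    have := Fintype.ofFinite Γ
    refine LinearMap.ext fun a => invAlg_ext fun z => ?_
    refine (coeff_mul'_lTensor_antipode _ z).trans (Eq.trans ?_ (invAlgCoeff_algebraMap _ z).symm)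
    rw [invAlg_counit, algebraMap_counit, invAlg_comul]
    simp [tensorCoeff_comul, Finset.sum_ite_irrel]

theorem tensorCoeff_comm (t : InvAlg θ ⊗[K] InvAlg θ) (x y : Γ) :
    tensorCoeff θ (TensorProduct.comm K _ _ t) (x, y) = tensorCoeff θ t (y, x) := by
  induction t with
  | zero => simp
  | add s t hs ht => simp [hs, ht]
  | tmul a b => simp [mul_comm]

instance invAlg_isCocomm : Coalgebra.IsCocomm K (InvAlg θ) where
  comm_comp_comul := by
    classical
    refine LinearMap.ext fun a => tensorCoeff_injective (funext fun ⟨x, y⟩ => ?_)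
    refine (tensorCoeff_comm _ x y).trans ?_
    rw [invAlg_comul, tensorCoeff_comul, tensorCoeff_comul]
    split_ifs <;> simp_all

end InvariantAlgebra

/-! ### The action of the invariant group algebra -/

section InvariantAction

variable {K N : Type*} [Field K] [Field N] [Algebra K N] [FiniteDimensional K N] [IsGalois K N]
  (L : IntermediateField K N) {Γ : Type*} [CommGroup Γ] [Finite Γ]

/-- The restrictions to `L` of the automorphisms of `N` in the image of `ι`. -/
def restrictHom (ι : Γ →* (N ≃ₐ[K] N)) (x : Γ) : L →ₐ[K] N := (ι x).toAlgHom.comp L.val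

@[simp]
theorem restrictHom_apply (ι : Γ →* (N ≃ₐ[K] N)) (x : Γ) (l : L) :
    restrictHom L ι x l = ι x l := rfl

variable {ι : Γ →* (N ≃ₐ[K] N)} {θ : (N ≃ₐ[K] N) →* MulAut Γ}
  (hθ : ∀ g x, ι (θ g x) = g * ι x * g⁻¹)

theorem linearIndependent_restrictHom (hinj : Function.Injective (restrictHom L ι)) :
    LinearIndependent N fun x => (restrictHom L ι x).toLinearMap :=
  (linearIndependent_toLinearMap K L N).comp _ hinj

include hθ in
theorem apply_eq_of_conj_eq {g : N ≃ₐ[K] N} {l : N} (hg : g l = l) (x : Γ) :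
    g (ι x l) = ι (θ g x) l := by
  have h : g⁻¹ l = l := by
    rw [← hg, ← AlgEquiv.mul_apply, inv_mul_cancel, AlgEquiv.one_apply, hg]
  rw [hθ, AlgEquiv.mul_apply, AlgEquiv.mul_apply, h]

include hθ in
-- An element of Gal(N/L) permutes the terms of the sum, so the sum is fixed by it.
theorem sum_coeff_mul_mem [Fintype Γ] (a : InvAlg θ) (l : L) :
    ∑ x, invAlgCoeff θ a x * restrictHom L ι x l ∈ L := by
  suffices h : ∑ x, invAlgCoeff θ a x * restrictHom L ι x l ∈
      IntermediateField.fixedField L.fixingSubgroup by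
    rwa [IsGalois.fixedField_fixingSubgroup] at h
  rw [IntermediateField.mem_fixedField_iff]
  intro g hg
  rw [map_sum]
  refine Fintype.sum_equiv (θ g).toEquiv _ _ fun x => ?_
  rw [map_mul, restrictHom_apply, apply_eq_of_conj_eq hθ
    ((IntermediateField.mem_fixingSubgroup_iff _ _).1 hg _ l.2)]
  exact congrArg (· * _) (invAlgCoeff_act a g x).symm

include hθ in
-- Γ is commutative, so conjugation by ι(y) is trivial on it. Hence the ι(y) pass through
-- coefficients, which makes the action on L multiplicative.
theorem coeff_fixed (a : InvAlg θ) (hι : Function.Injective ι) (x y : Γ) :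
    ι y (invAlgCoeff θ a x) = invAlgCoeff θ a x := by
  rw [← invAlgCoeff_act]
  refine congrArg _ (hι ?_)
  rw [hθ, ← map_mul, ← map_inv, ← map_mul, mul_comm y, mul_inv_cancel_right]

/-- The action of `N[Γ]^G` on `L`: the element `∑ aₓ x` sends `l` to `∑ aₓ ι(x)(l)`. -/
def invAlgAction (hι : Function.Injective ι) : InvAlg θ →ₐ[K] Module.End K L :=
  letI := Fintype.ofFinite Γ
  AlgHom.ofLinearMap
    { toFun a :=
        { toFun l := ⟨∑ x, invAlgCoeff θ a x * restrictHom L ι x l, sum_coeff_mul_mem L hθ a l⟩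
          map_add' l m := Subtype.ext (by simp [mul_add, Finset.sum_add_distrib])
          map_smul' k l := Subtype.ext (by simp [Algebra.smul_def, Finset.mul_sum, mul_left_comm]) }
      map_add' a b := by ext l; simp [add_mul, Finset.sum_add_distrib]
      map_smul' k a := by ext l; simp [Finset.smul_sum] }
    (by
      classical
      ext l
      have h (x : Γ) : invAlgCoeff θ 1 x = if x = 1 then 1 else 0 := by
        have := invAlgCoeff_algebraMap (θ := θ) 1 x
        rwa [map_one (algebraMap K (InvAlg θ)), map_one (algebraMap K N)] at this
      simp [h])
    (fun a b => by
      ext l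
      simp only [LinearMap.coe_mk, AddHom.coe_mk, Module.End.mul_apply, restrictHom_apply, map_sum,
        map_mul, coeff_fixed hθ _ hι, Finset.mul_sum, invAlgCoeff_mul, Finset.sum_mul]
      rw [Finset.sum_comm]
      refine Finset.sum_congr rfl fun x _ => ?_
      refine Fintype.sum_equiv (Equiv.mulLeft x⁻¹) _ _ fun y => ?_
      rw [← AlgEquiv.mul_apply, ← map_mul, Equiv.coe_mulLeft, mul_inv_cancel_left, mul_assoc])

theorem invAlgAction_apply [inst : Fintype Γ] (hι : Function.Injective ι) (a : InvAlg θ) (l : L) :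
    (invAlgAction L hθ hι a l : N) = ∑ x, invAlgCoeff θ a x * restrictHom L ι x l := by
  obtain rfl := Subsingleton.elim inst (Fintype.ofFinite Γ)
  rfl

theorem coe_mul'_map_invAlgAction [Fintype Γ] (hι : Function.Injective ι)
    (t : InvAlg θ ⊗[K] InvAlg θ) (l m : L) :
    (LinearMap.mul' K L (TensorProduct.map ((invAlgAction L hθ hι).toLinearMap.flip l)
      ((invAlgAction L hθ hι).toLinearMap.flip m) t) : N) =
      ∑ x, ∑ y, tensorCoeff θ t (x, y) * (restrictHom L ι x l * restrictHom L ι y m) := by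
  induction t with
  | zero => simp
  | add s t hs ht => simp only [map_add, Pi.add_apply, add_mul, Finset.sum_add_distrib, ← hs, ← ht,
      IntermediateField.coe_add]
  | tmul a b =>
    simp only [TensorProduct.map_tmul, LinearMap.mul'_apply, LinearMap.flip_apply,
      AlgHom.toLinearMap_apply, IntermediateField.coe_mul, invAlgAction_apply, tensorCoeff_tmul,
      Finset.sum_mul_sum]
    exact Finset.sum_congr rfl fun x _ => Finset.sum_congr rfl fun y _ => mul_mul_mul_comm _ _ _ _

/-- The coefficients of an element of `L ⊗ N[Γ]^G`. -/
def lTensorCoeff (θ : (N ≃ₐ[K] N) →* MulAut Γ) : InvAlg θ ⊗[K] L →ₗ[K] Γ × Unit → N :=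
  TensorProduct.lift
    { toFun a :=
        { toFun l z := invAlgCoeff θ a z.1 * l
          map_add' s t := by ext; simp [mul_add]
          map_smul' k t := by ext; simp [Algebra.smul_def, mul_left_comm] }
      map_add' a b := by ext; simp [add_mul]
      map_smul' k a := by ext; simp }

theorem lTensorCoeff_tmul (a : InvAlg θ) (l : L) (x : Γ) (u : Unit) :
    lTensorCoeff L θ (a ⊗ₜ l) (x, u) = invAlgCoeff θ a x * l := rfl

theorem lTensorCoeff_injective : Function.Injective (lTensorCoeff L θ) :=
  injective_of_tmul_eq_mul (invAlgCoeff θ) invAlgCoeff_injective invAlgCoeff_mem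
    (LinearMap.pi fun _ => L.val.toLinearMap) (fun _ _ h => Subtype.ext (congrFun h ()))
    (lTensorCoeff L θ) (lTensorCoeff_tmul L)

theorem jMap_invAlgAction [Fintype Γ] (hι : Function.Injective ι) (t : InvAlg θ ⊗[K] L) (m : L) :
    (jMap (invAlgAction L hθ hι) (TensorProduct.comm K _ _ t) m : N) =
      ∑ x, lTensorCoeff L θ t (x, ()) * restrictHom L ι x m := by
  induction t with
  | zero => simp
  | add s t hs ht => simp only [map_add, Pi.add_apply, add_mul, Finset.sum_add_distrib, ← hs, ← ht,
      LinearMap.add_apply, IntermediateField.coe_add]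
  | tmul a l =>
    rw [TensorProduct.comm_tmul]
    change ((l * invAlgAction L hθ hι a m : L) : N) = _
    rw [IntermediateField.coe_mul, invAlgAction_apply, Finset.mul_sum]
    refine Finset.sum_congr rfl fun x _ => ?_
    rw [lTensorCoeff_tmul, mul_comm (invAlgCoeff θ a x) (l : N), mul_assoc]

/-- For `bijective`: after applying j, the coefficients of an element of L ⊗ N[Γ]^G multiply the
distinct embeddings ι(x)|_L, which are N-independent by Dedekind. So j is injective, and both sides
have dimension [L : K]². -/
theorem isHopfGalois_invAlgAction (hι : Function.Injective ι)
    (hinj : Function.Injective (restrictHom L ι)) (hcard : Module.finrank K L = Nat.card Γ) :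
    IsHopfGalois (invAlgAction L hθ hι) where
  finite := inferInstance
  cocomm := inferInstance
  map_one a := by
    have := Fintype.ofFinite Γ
    refine Subtype.ext ?_
    rw [invAlgAction_apply, invAlg_counit]
    refine Eq.trans ?_ (algebraMap_counit a).symm
    simp
  map_mul a l m := by
    classical
    have := Fintype.ofFinite Γ
    refine Subtype.ext ?_
    rw [invAlgAction_apply, coe_mul'_map_invAlgAction, invAlg_comul]
    simp [tensorCoeff_comul]
  bijective := by
    have := Fintype.ofFinite Γ
    have hjinj : Function.Injective (jMap (invAlgAction L hθ hι)) := by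
      rw [injective_iff_map_eq_zero]
      intro s hs
      obtain ⟨t, rfl⟩ := (TensorProduct.comm K (InvAlg θ) L).surjective s
      have h1 : lTensorCoeff L θ t = 0 := by
        have h2 := Fintype.linearIndependent_iff.1 (linearIndependent_restrictHom L hinj)
          (fun x => lTensorCoeff L θ t (x, ())) (by
            ext m
            have h3 := jMap_invAlgAction L hθ hι t m
            rw [hs] at h3
            simpa using h3.symm)
        ext ⟨x, ⟨⟩⟩
        exact h2 x
      rw [(map_eq_zero_iff _ (lTensorCoeff_injective L)).1 h1, map_zero]
    refine ⟨hjinj, (LinearMap.injective_iff_surjective_of_finrank_eq_finrank ?_).1 hjinj⟩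
    rw [Module.finrank_tensorProduct, Module.finrank_linearMap, finrank_invAlg, hcard]

end InvariantAction

/-! ### Hopf-Galois structures are determined by their image -/

section Range

variable {K L H : Type*} [Field K] [Field L] [Algebra K L] [Ring H] [HopfAlgebra K H]

theorem jMap_tmul (ρ : HopfAction K L H) (x : L) (h : H) (y : L) :
    jMap ρ (x ⊗ₜ h) y = x * ρ h y := rfl

theorem IsHopfGalois.injective {ρ : HopfAction K L H} (hρ : IsHopfGalois ρ) :
    Function.Injective ρ := by
  intro a b hab
  refine Algebra.TensorProduct.includeRight_injective (A := L) (B := H)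
    (algebraMap K L).injective (hρ.bijective.1 ?_)
  ext y
  change 1 * ρ a y = 1 * ρ b y
  rw [hab]

theorem IsHopfGalois.finrank_eq [FiniteDimensional K L] {ρ : HopfAction K L H}
    (hρ : IsHopfGalois ρ) : Module.finrank K H = Module.finrank K L := by
  have := hρ.finite
  have h := (LinearEquiv.ofBijective _ hρ.bijective).finrank_eq
  rw [Module.finrank_tensorProduct, Module.finrank_linearMap] at h
  exact Nat.eq_of_mul_eq_mul_left Module.finrank_pos h

/-- Write t = ∑ bᵢ ⊗ cᵢ with (bᵢ) a basis. For fixed y the element ∑ (cᵢ·y) ⊗ bᵢ of L ⊗ H is killed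
by j, so each cᵢ·y is 0; as y varies, each cᵢ is 0. -/
theorem IsHopfGalois.eq_zero_of_mul'_map_eq_zero {ρ : HopfAction K L H} (hρ : IsHopfGalois ρ)
    (t : H ⊗[K] H) (ht : ∀ x y : L, LinearMap.mul' K L
      (TensorProduct.map (ρ.toLinearMap.flip x) (ρ.toLinearMap.flip y) t) = 0) : t = 0 := by
  classical
  let b := Module.Basis.ofVectorSpace K H
  obtain ⟨c, rfl⟩ := TensorProduct.eq_repr_basis_left b t
  have h1 : ∀ i, c i = 0 := by
    intro i
    refine hρ.injective (LinearMap.ext fun y => ?_)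
    rw [map_zero, LinearMap.zero_apply]
    have h2 : (c.sum fun i m => ρ m y ⊗ₜ[K] b i) = 0 := by
      refine hρ.bijective.1 (LinearMap.ext fun x => ?_)
      have h3 := ht x y
      simp only [Finsupp.sum, map_sum, LinearMap.sum_apply, TensorProduct.map_tmul,
        LinearMap.mul'_apply, LinearMap.flip_apply, AlgHom.toLinearMap_apply, jMap_tmul, map_zero,
        LinearMap.zero_apply] at h3 ⊢
      rw [← h3]
      exact Finset.sum_congr rfl fun i _ => mul_comm _ _
    have h4 := DFunLike.congr_fun (congrArg (TensorProduct.equivFinsuppOfBasisRight b) h2) i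
    have h5 : TensorProduct.equivFinsuppOfBasisRight b (c.sum fun i m => ρ m y ⊗ₜ[K] b i) i =
        c.sum fun j m => if j = i then ρ m y else 0 := by
      simp [Finsupp.sum, Finsupp.single_apply]
    rw [h5] at h4
    by_cases hc : c i = 0
    · simp [hc]
    · simpa [Finsupp.sum, hc] using h4
  simp [Finsupp.sum, h1]

variable {H' : Type*} [Ring H'] [HopfAlgebra K H']

theorem mul'_map_map {ρ : HopfAction K L H} {ρ' : HopfAction K L H'} (φ : H →ₗ[K] H')
    (hφ : ∀ h, ρ' (φ h) = ρ h) (t : H ⊗[K] H) (x y : L) :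
    LinearMap.mul' K L (TensorProduct.map (ρ'.toLinearMap.flip x) (ρ'.toLinearMap.flip y)
      (TensorProduct.map φ φ t)) =
    LinearMap.mul' K L (TensorProduct.map (ρ.toLinearMap.flip x) (ρ.toLinearMap.flip y) t) := by
  rw [TensorProduct.map_map]
  congr 3 <;> ext h <;> simp [hφ]

/-- A faithful action recovers the algebra from its image; the counit is read off from h·1, and the
comultiplication from h·(xy) by `eq_zero_of_mul'_map_eq_zero`. -/
theorem exists_bialgEquiv_of_range_eq {ρ : HopfAction K L H} {ρ' : HopfAction K L H'}
    (hρ : IsHopfGalois ρ) (hρ' : IsHopfGalois ρ') (h : ρ.range = ρ'.range) :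
    ∃ φ : H ≃ₐc[K] H', ∀ a, ρ' (φ a) = ρ a := by
  let φ : H ≃ₐ[K] H' := (AlgEquiv.ofInjective ρ hρ.injective).trans
    ((Subalgebra.equivOfEq _ _ h).trans (AlgEquiv.ofInjective ρ' hρ'.injective).symm)
  have hφ : ∀ a, ρ' (φ a) = ρ a := fun a =>
    congrArg Subtype.val ((AlgEquiv.ofInjective ρ' hρ'.injective).apply_symm_apply
      ((Subalgebra.equivOfEq _ _ h) (AlgEquiv.ofInjective ρ hρ.injective a)))
  refine ⟨BialgEquiv.ofAlgEquiv φ ?_ ?_, hφ⟩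
  · refine AlgHom.ext fun a => (algebraMap K L).injective ?_
    change algebraMap K L (Coalgebra.counit (φ a)) = algebraMap K L (Coalgebra.counit a)
    rw [← hρ.map_one, ← hρ'.map_one, hφ]
  · refine AlgHom.ext fun a => ?_
    change TensorProduct.map φ.toLinearMap φ.toLinearMap (Coalgebra.comul a) =
      Coalgebra.comul (φ a)
    rw [← sub_eq_zero]
    refine hρ'.eq_zero_of_mul'_map_eq_zero _ fun x y => ?_
    rw [map_sub, map_sub, mul'_map_map φ.toLinearMap hφ, ← hρ.map_mul, ← hρ'.map_mul, hφ, sub_self]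

end Range

/-! ### Uniqueness of the Hopf-Galois structure in prime degree -/

section Uniqueness

variable {K N : Type*} [Field K] [Field N] [Algebra K N] [FiniteDimensional K N] [IsGalois K N]
  {L : IntermediateField K N} {Γ : Type*} [CommGroup Γ] [Finite Γ]
  {ι : Γ →* (N ≃ₐ[K] N)} {θ : (N ≃ₐ[K] N) →* MulAut Γ}
  (hinj : Function.Injective (restrictHom L ι)) (hcard : Module.finrank K L = Nat.card Γ)
  {H : Type*} [Ring H] [HopfAlgebra K H] {ρ : HopfAction K L H}

/-- The basis of `Hom_K(L, N)` given by the restrictions to `L` of automorphisms of `N`. -/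
def restrictHomBasis : Module.Basis Γ N (L →ₗ[K] N) :=
  letI := Fintype.ofFinite Γ
  basisOfLinearIndependentOfCardEqFinrank (linearIndependent_restrictHom L hinj)
    (by rw [Module.finrank_linearMap_self, hcard, Nat.card_eq_fintype_card])

theorem restrictHomBasis_apply (x : Γ) :
    restrictHomBasis hinj hcard x = (restrictHom L ι x).toLinearMap := by
  simp [restrictHomBasis]

/-- The coordinates of the action of `H` on `L`: the action of `h` is `∑ eₓ(h) ι(x)`. -/
def actionCoord (ρ : HopfAction K L H) (x : Γ) : H →ₗ[K] N :=
  ((restrictHomBasis hinj hcard).coord x).restrictScalars K ∘ₗ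
    LinearMap.compRight K L.val.toLinearMap ∘ₗ ρ.toLinearMap

theorem sum_actionCoord [Fintype Γ] (h : H) (l : L) :
    ∑ x, actionCoord hinj hcard ρ x h * ι x l = (ρ h l : N) := by
  have h1 := (restrictHomBasis hinj hcard).sum_repr (L.val.toLinearMap ∘ₗ ρ h)
  have h2 := DFunLike.congr_fun h1 l
  simp only [restrictHomBasis_apply, LinearMap.sum_apply, LinearMap.smul_apply,
    AlgHom.toLinearMap_apply, restrictHom_apply, smul_eq_mul] at h2
  exact h2

include hinj in
theorem eq_of_forall_sum_eq [Fintype Γ] {c d : Γ → N}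
    (h : ∀ l : L, ∑ x, c x * ι x l = ∑ x, d x * ι x l) (x : Γ) : c x = d x := by
  have h1 := Fintype.linearIndependent_iff.1 (linearIndependent_restrictHom L hinj)
    (fun x => c x - d x) (by
      ext l
      simpa [sub_mul, sub_eq_zero, LinearMap.sum_apply] using h l) x
  exact sub_eq_zero.1 h1

theorem actionCoord_eq_of_forall [Fintype Γ] {h : H} {c : Γ → N}
    (hc : ∀ l : L, ∑ x, c x * ι x l = (ρ h l : N)) (x : Γ) :
    actionCoord hinj hcard ρ x h = c x :=
  eq_of_forall_sum_eq hinj (fun l => (sum_actionCoord hinj hcard h l).trans (hc l).symm) x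

theorem actionCoord_one [DecidableEq Γ] (x : Γ) :
    actionCoord hinj hcard ρ x 1 = if x = 1 then 1 else 0 := by
  have := Fintype.ofFinite Γ
  exact actionCoord_eq_of_forall (c := fun x => if x = 1 then 1 else 0) hinj hcard (by simp) x

theorem sum_actionCoord_eq_counit [Fintype Γ] (hρ : IsHopfGalois ρ) (h : H) :
    ∑ x, actionCoord hinj hcard ρ x h = algebraMap K N (Coalgebra.counit (R := K) h) := by
  have h1 := sum_actionCoord hinj hcard (ρ := ρ) h 1
  rw [hρ.map_one] at h1
  simpa using h1

theorem sum_sum_mul'_map_actionCoord [Fintype Γ] (t : H ⊗[K] H) (l m : L) :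
    ∑ x, ∑ y, LinearMap.mul' K N (TensorProduct.map (actionCoord hinj hcard ρ x)
      (actionCoord hinj hcard ρ y) t) * ι y m * ι x l =
    (LinearMap.mul' K L (TensorProduct.map (ρ.toLinearMap.flip l) (ρ.toLinearMap.flip m) t) : N) := by
  induction t with
  | zero => simp
  | add s t hs ht => simp only [map_add, add_mul, Finset.sum_add_distrib, hs, ht,
      IntermediateField.coe_add]
  | tmul a b =>
    simp only [TensorProduct.map_tmul, LinearMap.mul'_apply, LinearMap.flip_apply,
      AlgHom.toLinearMap_apply, IntermediateField.coe_mul, ← sum_actionCoord hinj hcard,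
      Finset.sum_mul_sum]
    exact Finset.sum_congr rfl fun x _ => Finset.sum_congr rfl fun y _ => by ring

/-- Expand h·(lm) in two ways and compare coefficients, first of ι(x)l and then of ι(y)m. The
coordinates are thus orthogonal idempotents for the convolution product on Hom_K(H, N). -/
theorem mul'_map_actionCoord_comul [DecidableEq Γ] (hρ : IsHopfGalois ρ) (h : H) (x y : Γ) :
    LinearMap.mul' K N (TensorProduct.map (actionCoord hinj hcard ρ x)
      (actionCoord hinj hcard ρ y) (Coalgebra.comul (R := K) h)) =
    if x = y then actionCoord hinj hcard ρ x h else 0 := by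
  have := Fintype.ofFinite Γ
  refine eq_of_forall_sum_eq (c := fun y => LinearMap.mul' K N (TensorProduct.map
    (actionCoord hinj hcard ρ x) (actionCoord hinj hcard ρ y) (Coalgebra.comul (R := K) h)))
    (d := fun y => if x = y then actionCoord hinj hcard ρ x h else 0) hinj (fun m => ?_) y
  refine eq_of_forall_sum_eq (c := fun x => ∑ y, LinearMap.mul' K N (TensorProduct.map
    (actionCoord hinj hcard ρ x) (actionCoord hinj hcard ρ y) (Coalgebra.comul (R := K) h)) * ι y m)
    (d := fun x => ∑ y, (if x = y then actionCoord hinj hcard ρ x h else 0) * ι y m)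
    hinj (fun l => ?_) x
  simp only [Finset.sum_mul, sum_sum_mul'_map_actionCoord]
  rw [← hρ.map_mul, ← sum_actionCoord hinj hcard]
  refine Finset.sum_congr rfl fun x _ => ?_
  simp [mul_right_comm, mul_assoc]

/-- Surjectivity of j says that the image of H spans End_K(L) over L, hence spans Hom_K(L, N) over
N. A functional vanishing on that image is therefore zero. -/
theorem eq_of_forall_sum_mul_actionCoord_eq [Fintype Γ] (hρ : IsHopfGalois ρ) {c d : Γ → N}
    (h : ∀ a : H, ∑ x, c x * actionCoord hinj hcard ρ x a =
      ∑ x, d x * actionCoord hinj hcard ρ x a) : c = d := by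
  classical
  -- the functional `∑ (c x - d x) eₓ*` on `Hom_K(L, N)` vanishes
  let B := restrictHomBasis hinj hcard
  let f : (L →ₗ[K] N) →ₗ[N] N := ∑ x, (c x - d x) • B.coord x
  have h1 : ∀ a : H, f (L.val.toLinearMap ∘ₗ ρ a) = 0 := by
    intro a
    have h2 := h a
    rw [← sub_eq_zero, ← Finset.sum_sub_distrib] at h2
    rw [← h2]
    simp only [f, LinearMap.sum_apply, LinearMap.smul_apply, smul_eq_mul, sub_mul]
    rfl
  have h2 : ∀ s : Module.End K L, f (L.val.toLinearMap ∘ₗ s) = 0 := by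
    intro s
    obtain ⟨t, rfl⟩ := hρ.bijective.2 s
    induction t with
    | zero => simp
    | add s t hs ht => rw [map_add, LinearMap.comp_add, map_add, hs, ht, add_zero]
    | tmul l a =>
      have h3 : L.val.toLinearMap ∘ₗ jMap ρ (l ⊗ₜ a) = (l : N) • (L.val.toLinearMap ∘ₗ ρ a) := by
        ext m
        rfl
      rw [h3, map_smul, h1, smul_zero]
  have h3 : ∀ s : L →ₗ[K] N, f s = 0 := by
    intro s
    let b := Module.finBasis K L
    have h4 : s = ∑ i, s (b i) • (L.val.toLinearMap ∘ₗ (b.coord i).smulRight 1) := by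
      refine b.ext fun j => ?_
      rw [LinearMap.sum_apply, Finset.sum_eq_single j]
      · simp
      · intro i _ hij
        simp [Finsupp.single_eq_of_ne hij]
      · simp
    rw [h4, map_sum]
    exact Finset.sum_eq_zero fun i _ => by rw [map_smul, h2, smul_zero]
  funext x
  have h4 := h3 (B x)
  simpa [f, LinearMap.sum_apply, Finsupp.single_apply, sub_eq_zero] using h4

theorem exists_eq_sum_mul_actionCoord [Fintype Γ] (hρ : IsHopfGalois ρ) (f : H →ₗ[K] N) :
    ∃ c : Γ → N, ∀ a, f a = ∑ x, c x * actionCoord hinj hcard ρ x a := by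
  have := hρ.finite
  have hli : LinearIndependent N (actionCoord hinj hcard ρ) := by
    refine Fintype.linearIndependent_iff.2 fun c hc x => ?_
    refine congrFun (eq_of_forall_sum_mul_actionCoord_eq (d := 0) hinj hcard hρ fun a => ?_) x
    have h := DFunLike.congr_fun hc a
    simpa [LinearMap.sum_apply] using h
  let B := basisOfLinearIndependentOfCardEqFinrank hli
    (by rw [Module.finrank_linearMap_self, hρ.finrank_eq, hcard, Nat.card_eq_fintype_card])
  refine ⟨B.repr f, fun a => ?_⟩
  have h := DFunLike.congr_fun (B.sum_repr f) a
  simpa [B, LinearMap.sum_apply] using h.symm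

theorem mul'_map_sum [Fintype Γ] {e : Γ → H →ₗ[K] N} {f f' : H →ₗ[K] N} {c c' : Γ → N}
    (hf : ∀ a, f a = ∑ x, c x * e x a) (hf' : ∀ a, f' a = ∑ x, c' x * e x a) (t : H ⊗[K] H) :
    LinearMap.mul' K N (TensorProduct.map f f' t) =
      ∑ x, ∑ y, c x * c' y * LinearMap.mul' K N (TensorProduct.map (e x) (e y) t) := by
  induction t with
  | zero => simp
  | add s t hs ht => simp only [map_add, mul_add, Finset.sum_add_distrib, hs, ht]
  | tmul a b =>
    simp only [TensorProduct.map_tmul, LinearMap.mul'_apply, hf, hf', Finset.sum_mul_sum]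
    exact Finset.sum_congr rfl fun x _ => Finset.sum_congr rfl fun y _ => by ring

/-- Automorphisms of `N` permute the coordinates of a Hopf-Galois structure. -/
theorem exists_perm_actionCoord (hρ : IsHopfGalois ρ) (g : N ≃ₐ[K] N) :
    ∃ q : Equiv.Perm Γ, ∀ x a,
      g (actionCoord hinj hcard ρ (q x) a) = actionCoord hinj hcard ρ x a := by
  classical
  have := Fintype.ofFinite Γ
  let e := actionCoord hinj hcard ρ
  -- The functionals g ∘ eₓ are again orthogonal convolution idempotents with sum the counit. So for
  -- each y the scalars c x y are orthogonal idempotents of N with sum 1: exactly one equals 1 and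
  -- the others vanish.
  choose c hc using fun x => exists_eq_sum_mul_actionCoord hinj hcard hρ (g.toLinearMap ∘ₗ e x)
  have hmul : ∀ x x' y, c x y * c x' y = if x = x' then c x y else 0 := by
    intro x x'
    refine congrFun (eq_of_forall_sum_mul_actionCoord_eq
      (c := fun y => c x y * c x' y) (d := fun y => if x = x' then c x y else 0)
      hinj hcard hρ fun a => ?_)
    have h1 := mul'_map_sum (hc x) (hc x') (Coalgebra.comul (R := K) a)
    simp only [mul'_map_actionCoord_comul hinj hcard hρ, mul_ite, mul_zero, Finset.sum_ite_eq,
      Finset.mem_univ, if_true] at h1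
    have h2 : LinearMap.mul' K N (TensorProduct.map (g.toLinearMap ∘ₗ e x) (g.toLinearMap ∘ₗ e x')
        (Coalgebra.comul (R := K) a)) = g (if x = x' then e x a else 0) := by
      rw [← mul'_map_actionCoord_comul hinj hcard hρ, TensorProduct.map_comp, LinearMap.comp_apply]
      generalize TensorProduct.map (e x) (e x') (Coalgebra.comul (R := K) a) = t
      induction t with
      | zero => simp
      | add s t hs ht => simp only [map_add, hs, ht]
      | tmul a b => simp
    rw [← h1, h2]
    split_ifs
    · exact hc x a
    · simp
  have hsum : ∀ y, ∑ x, c x y = 1 := by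
    refine congrFun (eq_of_forall_sum_mul_actionCoord_eq (c := fun y => ∑ x, c x y)
      (d := fun _ => 1) hinj hcard hρ fun a => ?_)
    simp only [one_mul, sum_actionCoord_eq_counit hinj hcard hρ]
    rw [← g.commutes, ← sum_actionCoord_eq_counit hinj hcard hρ, map_sum]
    simp only [Finset.sum_mul]
    rw [Finset.sum_comm]
    exact Finset.sum_congr rfl fun x _ => (hc x a).symm
  have hex : ∀ y, ∃ x, c x y ≠ 0 := by
    intro y
    obtain ⟨x, -, hx⟩ := Finset.exists_ne_zero_of_sum_ne_zero ((hsum y).trans_ne one_ne_zero)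
    exact ⟨x, hx⟩
  choose q hq using hex
  have hcq : ∀ x y, c x y = if x = q y then 1 else 0 := by
    intro x y
    split_ifs with h
    · subst h
      have h1 := hmul (q y) (q y) y
      rw [if_pos rfl] at h1
      exact mul_right_cancel₀ (hq y) (h1.trans (one_mul _).symm)
    · have h1 := hmul x (q y) y
      rw [if_neg h] at h1
      exact (mul_eq_zero.1 h1).resolve_right (hq y)
  -- If x were not a value of q, then g ∘ eₓ, hence eₓ, would be zero, against independence of the
  -- coordinates.
  have hqs : Function.Surjective q := by
    intro x
    by_contra! hx
    have h1 : ∀ a, e x a = 0 := by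
      intro a
      refine (map_eq_zero_iff g g.injective).1 ((hc x a).trans ?_)
      exact Finset.sum_eq_zero fun y _ => by rw [hcq, if_neg (hx y).symm, zero_mul]
    have h2 := congrFun (eq_of_forall_sum_mul_actionCoord_eq (c := Pi.single x 1) (d := 0)
      hinj hcard hρ fun a => by simpa [Pi.single_apply] using h1 a) x
    simp at h2
  have hqb : Function.Bijective q := ⟨Finite.injective_iff_surjective.2 hqs, hqs⟩
  refine ⟨Equiv.ofBijective q hqb, fun x a => ?_⟩
  refine (hc (q x) a).trans ?_
  simp only [hcq, hqb.1.eq_iff]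
  simp

/-- The permutation of coordinates induced by ι(z) has order dividing the prime |Γ|, so its number
of fixed points is divisible by |Γ|. It fixes the coordinate at 1, the only one not vanishing on 1 ∈
H, so it fixes all of them. -/
theorem actionCoord_fixed [Fact (Nat.card Γ).Prime] (hρ : IsHopfGalois ρ) (z x : Γ) (a : H) :
    ι z (actionCoord hinj hcard ρ x a) = actionCoord hinj hcard ρ x a := by
  classical
  have := Fintype.ofFinite Γ
  obtain ⟨q, hq⟩ := exists_perm_actionCoord hinj hcard hρ (ι z)
  have h1 : q 1 = 1 := by
    have h := hq 1 1
    rw [actionCoord_one, actionCoord_one, if_pos rfl] at h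
    by_contra hne
    rw [if_neg hne, map_zero] at h
    exact zero_ne_one h
  have hinj' : ∀ x y, (∀ a, actionCoord hinj hcard ρ x a = actionCoord hinj hcard ρ y a) →
      x = y := by
    intro x y h
    have h2 := congrFun (eq_of_forall_sum_mul_actionCoord_eq (c := Pi.single x 1)
      (d := Pi.single y 1) hinj hcard hρ fun a => by simpa [Pi.single_apply] using h a) x
    by_contra hne
    simp [hne] at h2
  have hpow : ∀ (n : ℕ) x a, (ι z ^ n) (actionCoord hinj hcard ρ ((q ^ n) x) a) =
      actionCoord hinj hcard ρ x a := by
    intro n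
    induction n with
    | zero => simp
    | succ n ih =>
      intro x a
      rw [pow_succ, pow_succ', AlgEquiv.mul_apply, Equiv.Perm.mul_apply, hq, ih]
  have hq1 : q ^ Nat.card Γ = 1 := by
    ext x
    refine hinj' _ _ fun a => ?_
    have h := hpow (Nat.card Γ) x a
    rwa [← map_pow, pow_card_eq_one', map_one] at h
  have h2 : Fintype.card Γ ≡ Fintype.card (Function.fixedPoints q) [MOD Nat.card Γ] :=
    Equiv.Perm.card_fixedPoints_modEq (n := 1) (by
      rw [pow_one]
      have h := map_pow (MulAction.toEndHom (M := Equiv.Perm Γ) (α := Γ)) q (Nat.card Γ)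
      rw [hq1, map_one] at h
      exact h.symm)
  have h3 : Nat.card Γ ∣ Fintype.card (Function.fixedPoints q) := by
    rw [← Nat.modEq_zero_iff_dvd]
    refine h2.symm.trans ?_
    rw [← Nat.card_eq_fintype_card, Nat.modEq_zero_iff_dvd]
  have : Nonempty (Function.fixedPoints q) := ⟨⟨1, h1⟩⟩
  have h4 := Nat.le_of_dvd Fintype.card_pos h3
  rw [Nat.card_eq_fintype_card] at h4
  have h5 : Function.fixedPoints q = Set.univ :=
    (set_fintype_card_eq_univ_iff _).1 (le_antisymm (Fintype.card_le_of_injective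
      Subtype.val Subtype.val_injective) h4)
  have h6 : q x = x := h5.symm.le (Set.mem_univ x)
  have h7 := hq x a
  rwa [h6] at h7

variable (hθ : ∀ g x, ι (θ g x) = g * ι x * g⁻¹) (hι : Function.Injective ι)
  (hG : ∀ g : N ≃ₐ[K] N, ∃ x, ∃ k ∈ L.fixingSubgroup, g = ι x * k)

include hθ in
-- Apply k to the expansion of a·l: both l and a·l lie in L and are fixed, and coordinates are
-- unique.
theorem actionCoord_act_of_mem_fixingSubgroup {k : N ≃ₐ[K] N} (hk : k ∈ L.fixingSubgroup)
    (x : Γ) (a : H) :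
    actionCoord hinj hcard ρ (θ k x) a = k (actionCoord hinj hcard ρ x a) := by
  have := Fintype.ofFinite Γ
  rw [IntermediateField.mem_fixingSubgroup_iff] at hk
  have h := actionCoord_eq_of_forall (h := a) (ρ := ρ)
    (c := fun x => k (actionCoord hinj hcard ρ ((θ k)⁻¹ x) a)) hinj hcard (fun l => by
      rw [← hk _ (ρ a l).2, ← sum_actionCoord hinj hcard, map_sum]
      refine (Fintype.sum_equiv (θ k).toEquiv _ _ fun x => ?_).symm
      rw [map_mul, apply_eq_of_conj_eq hθ (hk _ l.2)]
      change _ = k (actionCoord hinj hcard ρ (((θ k)⁻¹ * θ k) x) a) * ι (θ k x) l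
      rw [inv_mul_cancel]
      rfl) (θ k x)
  refine h.trans ?_
  change k (actionCoord hinj hcard ρ (((θ k)⁻¹ * θ k) x) a) = _
  rw [inv_mul_cancel]
  rfl

include hinj hcard hG in
-- Writing g = ι(z)k, equivariance of the coordinates holds for k and is trivial for ι(z), which
-- fixes the coordinates and centralizes Γ. So they are the coefficients of an element of N[Γ]^G
-- with the same action; equality follows since both images have dimension [L : K].
theorem range_eq_range_invAlgAction [Fact (Nat.card Γ).Prime] (hρ : IsHopfGalois ρ) :
    ρ.range = (invAlgAction L hθ hι).range := by
  have := Fintype.ofFinite Γ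
  have hρ₀ := isHopfGalois_invAlgAction L hθ hι hinj hcard
  have hle : ρ.range ≤ (invAlgAction L hθ hι).range := by
    rintro _ ⟨a, rfl⟩
    refine ⟨invAlgMk (fun x => actionCoord hinj hcard ρ x a) fun g x => ?_, ?_⟩
    · obtain ⟨z, k, hk, rfl⟩ := hG g
      rw [AlgEquiv.mul_apply, ← actionCoord_act_of_mem_fixingSubgroup hinj hcard hθ hk,
        actionCoord_fixed hinj hcard hρ]
      refine congrArg (fun y => actionCoord hinj hcard ρ y a) (hι ?_)
      rw [map_mul, MulAut.mul_apply, hθ, ← map_mul, ← map_inv, ← map_mul, mul_comm z,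
        mul_inv_cancel_right]
    · ext l
      refine (invAlgAction_apply L hθ hι _ l).trans ?_
      exact sum_actionCoord hinj hcard a l
  refine Subalgebra.toSubmodule_injective (Submodule.eq_of_le_of_finrank_eq hle ?_)
  have h1 := LinearMap.finrank_range_of_inj (f := ρ.toLinearMap) hρ.injective
  have h2 := LinearMap.finrank_range_of_inj (f := (invAlgAction L hθ hι).toLinearMap) hρ₀.injective
  rw [hρ.finrank_eq] at h1
  rw [hρ₀.finrank_eq] at h2
  exact h1.trans h2.symm

end Uniqueness

/-! ### Normal complements of prime order -/

section NormalComplement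

variable {K : Type u} {N : Type v} [Field K] [Field N] [Algebra K N] [FiniteDimensional K N]
  [IsGalois K N] {L : IntermediateField K N} {J : Subgroup (N ≃ₐ[K] N)} [J.Normal]
  (hJ : Subgroup.IsComplement' J L.fixingSubgroup)

include hJ in
theorem finrank_eq_card_of_isComplement' : Module.finrank K L = Nat.card J := by
  have h := hJ.card_mul_card
  rw [card_gal_eq_mul_card_fixingSubgroup L] at h
  exact (Nat.eq_of_mul_eq_mul_right Nat.card_pos h).symm

include hJ in
theorem eq_of_forall_apply_eq {x y : J} (h : ∀ l : L, x.1 l = y.1 l) : x = y := by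
  have h1 : x.1⁻¹ * y.1 ∈ L.fixingSubgroup := by
    rw [IntermediateField.mem_fixingSubgroup_iff]
    intro l hl
    rw [AlgEquiv.mul_apply, ← h ⟨l, hl⟩, ← AlgEquiv.mul_apply, inv_mul_cancel, AlgEquiv.one_apply]
  have h2 := Subgroup.disjoint_def.1 hJ.disjoint (J.mul_mem (J.inv_mem x.2) y.2) h1
  exact Subtype.ext (inv_mul_eq_one.1 h2)

/-- A commutative group structure on a subgroup of prime order. -/
abbrev commGroupOfPrimeCard {G : Type*} [Group G] (J : Subgroup G) [h : Fact (Nat.card J).Prime] :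
    CommGroup J :=
  haveI := isCyclic_of_prime_card (α := J) rfl
  IsCyclic.commGroup

variable [Fact (Nat.card J).Prime]

include hJ in
theorem isHopfGaloisExtension_of_isComplement' : IsHopfGaloisExtension K L := by
  let _ := commGroupOfPrimeCard J
  exact ⟨InvAlg (Γ := J) MulAut.conjNormal, inferInstance, inferInstance, _,
    isHopfGalois_invAlgAction L (ι := J.subtype) (θ := MulAut.conjNormal)
      (fun g x => MulAut.conjNormal_apply g x) Subtype.val_injective
      (fun x y h => eq_of_forall_apply_eq hJ fun l => DFunLike.congr_fun h l)
      (finrank_eq_card_of_isComplement' hJ)⟩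

variable {H : Type*} [Ring H] [HopfAlgebra K H] {ρ : HopfAction K L H}

variable (L J) in
/-- The image in `End_K(L)` of the Hopf-Galois structure attached to a normal complement. -/
def complementRange : Subalgebra K (Module.End K L) :=
  letI := commGroupOfPrimeCard J
  (invAlgAction L (ι := J.subtype) (θ := MulAut.conjNormal)
    (fun g x => MulAut.conjNormal_apply g x) Subtype.val_injective).range

theorem mul_comm_of_mem_complementRange {a b : Module.End K L} (ha : a ∈ complementRange L J)
    (hb : b ∈ complementRange L J) : a * b = b * a := by
  let _ := commGroupOfPrimeCard J
  obtain ⟨a, rfl⟩ := ha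
  obtain ⟨b, rfl⟩ := hb
  exact (Commute.all a b).map _

include hJ in
theorem IsHopfGalois.range_eq_complementRange (hρ : IsHopfGalois ρ) :
    ρ.range = complementRange L J := by
  let _ := commGroupOfPrimeCard J
  refine range_eq_range_invAlgAction (ι := J.subtype)
    (fun x y h => eq_of_forall_apply_eq hJ fun l => DFunLike.congr_fun h l)
    (finrank_eq_card_of_isComplement' hJ) _ _ (fun g => ?_) hρ
  obtain ⟨⟨x, k⟩, rfl⟩ := hJ.2 g
  exact ⟨x, k, k.2, rfl⟩

include hJ in
-- Inherited from N[J]^G with J abelian; it makes the associated orders commutative, as the descent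
-- of freeness requires.
theorem IsHopfGalois.mul_comm (hρ : IsHopfGalois ρ) (a b : H) : a * b = b * a := by
  refine hρ.injective ?_
  rw [_root_.map_mul, _root_.map_mul]
  exact mul_comm_of_mem_complementRange (hρ.range_eq_complementRange hJ ▸ ρ.mem_range_self a)
    (hρ.range_eq_complementRange hJ ▸ ρ.mem_range_self b)

include hJ in
theorem IsHopfGalois.isUniqueHopfGalois (hρ : IsHopfGalois ρ) : IsUniqueHopfGalois.{z} ρ :=
  ⟨hρ, fun _ _ _ _ hρ₁ => exists_bialgEquiv_of_range_eq hρ₁ hρ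
    ((hρ₁.range_eq_complementRange hJ).trans (hρ.range_eq_complementRange hJ).symm)⟩

end NormalComplement

/-! ### Base change of Hopf-Galois structures -/

section BaseChange

variable {K K' L L' : Type*} [Field K] [Field K'] [Field L] [Field L'] [Algebra K K'] [Algebra K L]
  [Algebra K L'] [Algebra K' L'] [IsScalarTower K K' L'] {i : L →ₐ[K] L'}
  (hi : IsBaseChange K' i.toLinearMap) {H : Type*} [Ring H] [HopfAlgebra K H]

/-- The base change to `K'` of an action of `H` on `L`. -/
def baseChangeAction (ρ : HopfAction K L H) : HopfAction K' L' (K' ⊗[K] H) :=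
  (hi.equiv.conjAlgEquiv K').toAlgHom.comp
    (Algebra.TensorProduct.lift (Algebra.ofId K' (Module.End K' (K' ⊗[K] L)))
      ((Module.End.baseChangeHom K K' L).comp ρ) fun a _ => Algebra.commute_algebraMap_left a _)

@[simp]
theorem baseChangeAction_tmul (ρ : HopfAction K L H) (a b : K') (h : H) (x : L) :
    baseChangeAction hi ρ (a ⊗ₜ h) (b • i x) = (a * b) • i (ρ h x) := by
  have h1 : hi.equiv.symm (b • i x) = b ⊗ₜ x := by
    rw [LinearEquiv.symm_apply_eq, IsBaseChange.equiv_tmul]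
    rfl
  simp only [baseChangeAction, AlgHom.comp_apply]
  change hi.equiv (a • ((ρ h).baseChange K' (hi.equiv.symm (b • i x)))) = _
  rw [h1, LinearMap.baseChange_tmul]
  rw [map_smul, IsBaseChange.equiv_tmul, smul_smul]
  rfl

theorem baseChangeAction_tmul_apply (ρ : HopfAction K L H) (a : K') (h : H) (x : L) :
    baseChangeAction hi ρ (a ⊗ₜ h) (i x) = a • i (ρ h x) := by
  have := baseChangeAction_tmul hi ρ a 1 h x
  rwa [one_smul, mul_one] at this

include hi in
@[elab_as_elim]
theorem baseChange_induction {P : L' → Prop} (zero : P 0) (hadd : ∀ x y, P x → P y → P (x + y))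
    (hsmul : ∀ (a : K') (x : L), P (a • i x)) (y : L') : P y := by
  obtain ⟨t, rfl⟩ := hi.equiv.surjective y
  induction t with
  | zero => rwa [map_zero]
  | add s t hs ht => rw [map_add]; exact hadd _ _ hs ht
  | tmul a x => rw [IsBaseChange.equiv_tmul]; exact hsmul a x

theorem eq_baseChangeAction {ρ : HopfAction K L H} {σ : HopfAction K' L' (K' ⊗[K] H)}
    (h : ∀ (a : K') (h : H) (x : L), σ (a ⊗ₜ h) (i x) = a • i (ρ h x)) :
    σ = baseChangeAction hi ρ := by
  refine AlgHom.ext fun t => LinearMap.ext fun y => ?_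
  induction t with
  | zero => simp
  | add s t hs ht => simp only [map_add, LinearMap.add_apply, hs, ht]
  | tmul a b =>
    refine baseChange_induction hi ?_ ?_ ?_ y
    · simp
    · intro x y hx hy
      rw [map_add, map_add, hx, hy]
    · intro c x
      rw [map_smul, map_smul, h, baseChangeAction_tmul_apply]

theorem mul'_map_baseChangeAction (ρ : HopfAction K L H) (a b c : K') (t : H ⊗[K] H) (x y : L) :
    LinearMap.mul' K' L' (TensorProduct.map ((baseChangeAction hi ρ).toLinearMap.flip (b • i x))
      ((baseChangeAction hi ρ).toLinearMap.flip (c • i y))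
      (TensorProduct.AlgebraTensorModule.tensorTensorTensorComm K K' K K' K' K' H H
        ((1 ⊗ₜ a) ⊗ₜ t))) =
    (a * b * c) • i (LinearMap.mul' K L
      (TensorProduct.map (ρ.toLinearMap.flip x) (ρ.toLinearMap.flip y) t)) := by
  induction t with
  | zero => simp
  | add s t hs ht => simp only [TensorProduct.tmul_add, map_add, hs, ht, smul_add]
  | tmul h k =>
    simp only [TensorProduct.AlgebraTensorModule.tensorTensorTensorComm_tmul,
      TensorProduct.map_tmul, LinearMap.mul'_apply, LinearMap.flip_apply,
      AlgHom.toLinearMap_apply, baseChangeAction_tmul, map_mul, one_mul, smul_mul_smul_comm, mul_assoc,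
      mul_left_comm b a c]

theorem isHopfGalois_baseChangeAction [FiniteDimensional K L] {ρ : HopfAction K L H}
    (hρ : IsHopfGalois ρ) : IsHopfGalois (baseChangeAction hi ρ) where
  finite := by
    have := hρ.finite
    infer_instance
  cocomm := by
    have := hρ.cocomm
    infer_instance
  map_one t := by
    induction t with
    | zero => simp
    | add s t hs ht => simp only [map_add, LinearMap.add_apply, hs, ht]
    | tmul a h =>
      have h1 := baseChangeAction_tmul_apply hi ρ a h 1
      rw [map_one, hρ.map_one, AlgHom.commutes] at h1
      rw [h1, TensorProduct.counit_tmul, CommSemiring.counit_apply, Algebra.smul_def,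
        Algebra.smul_def, map_mul, ← IsScalarTower.algebraMap_apply, mul_comm]
  map_mul t x y := by
    induction t with
    | zero => simp
    | add s t hs ht => simp only [map_add, LinearMap.add_apply, hs, ht]
    | tmul a h =>
      rw [TensorProduct.comul_tmul, CommSemiring.comul_apply]
      refine baseChange_induction hi ?_ ?_ ?_ x
      · simp
      · intro x x' hx hx'
        simp only [add_mul, map_add, TensorProduct.map_add_left, LinearMap.add_apply, hx, hx']
      intro b x
      refine baseChange_induction hi ?_ ?_ ?_ y
      · simp
      · intro y y' hy hy'
        simp only [mul_add, map_add, TensorProduct.map_add_right, LinearMap.add_apply, hy, hy']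
      intro c y
      rw [mul'_map_baseChangeAction, ← hρ.map_mul, smul_mul_smul_comm, ← map_mul,
        baseChangeAction_tmul, mul_assoc]
  bijective := by
    have := hρ.finite
    have : FiniteDimensional K' L' := Module.Finite.equiv hi.equiv
    have hL : Module.finrank K' L' = Module.finrank K L := by
      rw [← hi.equiv.finrank_eq, Module.finrank_baseChange]
    -- Surjectivity of j over K': its image is closed under left multiplication by L' and contains
    -- an extension of every K-endomorphism of L.
    have hmul : ∀ (l : L') (f : Module.End K' L'),
        f ∈ LinearMap.range (jMap (baseChangeAction hi ρ)) →
        Algebra.lmul K' L' l * f ∈ LinearMap.range (jMap (baseChangeAction hi ρ)) := by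
      rintro l _ ⟨t, rfl⟩
      induction t with
      | zero => simp
      | add s t hs ht => rw [map_add, mul_add]; exact add_mem hs ht
      | tmul m h =>
        refine ⟨(l * m) ⊗ₜ h, LinearMap.ext fun x => ?_⟩
        rw [jMap_tmul, mul_assoc]
        rfl
    have hbc : ∀ f : Module.End K L, ∃ g ∈ LinearMap.range (jMap (baseChangeAction hi ρ)),
        ∀ x, g (i x) = i (f x) := by
      intro f
      obtain ⟨t, rfl⟩ := hρ.bijective.2 f
      induction t with
      | zero => exact ⟨0, zero_mem _, by simp⟩
      | add s t hs ht =>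
        obtain ⟨g, hg, hg'⟩ := hs
        obtain ⟨k, hk, hk'⟩ := ht
        exact ⟨g + k, add_mem hg hk, by simp [hg', hk']⟩
      | tmul l h =>
        refine ⟨_, ⟨i l ⊗ₜ (1 ⊗ₜ h), rfl⟩, fun x => ?_⟩
        rw [jMap_tmul, jMap_tmul, baseChangeAction_tmul_apply, one_smul, map_mul]
    have hs : Function.Surjective (jMap (baseChangeAction hi ρ)) := by
      intro f
      let b := Module.finBasis K L
      choose g hg hg' using fun j => hbc ((b.coord j).smulRight 1)
      -- Here g j extends the j-th coordinate function of L, viewed with values in K ⊆ L; both sides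
      -- agree on i(L), which spans L' over K'.
      have hf : f = ∑ j, Algebra.lmul K' L' (f (i (b j))) * g j := by
        refine LinearMap.ext fun y => ?_
        refine baseChange_induction hi ?_ ?_ ?_ y
        · simp
        · intro x y hx hy
          rw [map_add, map_add, hx, hy]
        · intro a x
          rw [map_smul, map_smul]
          congr 1
          have hx := congrArg (fun z => f (i z)) (b.sum_repr x)
          simp only [map_sum, map_smul] at hx
          rw [← hx, LinearMap.sum_apply]
          refine Finset.sum_congr rfl fun j _ => ?_
          change _ = f (i (b j)) * g j (i x)
          rw [hg', LinearMap.map_smul_of_tower]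
          simp [Algebra.smul_def, mul_comm]
      rw [hf]
      exact sum_mem fun j _ => hmul _ _ (hg j)
    refine ⟨(LinearMap.injective_iff_surjective_of_finrank_eq_finrank ?_).2 hs, hs⟩
    rw [Module.finrank_tensorProduct, Module.finrank_linearMap, Module.finrank_baseChange,
      hρ.finrank_eq, hL]

end BaseChange

/-! ### Descent of freeness over semilocal rings -/

section Free

theorem finite_maximalSpectrum_of_finite (A S : Type*) [CommRing A] [IsLocalRing A] [CommRing S]
    [Algebra A S] [Module.Finite A S] : Finite (MaximalSpectrum S) := by
  have := (Algebra.QuasiFinite.finite_primesOver (S := S) (IsLocalRing.maximalIdeal A)).to_subtype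
  refine Finite.of_injective (β := (IsLocalRing.maximalIdeal A).primesOver S)
    (fun P => ⟨P.1, P.2.isPrime, ⟨?_⟩⟩) fun P Q h => MaximalSpectrum.ext (congrArg Subtype.val h)
  have := P.2
  exact (IsLocalRing.eq_maximalIdeal
    (Ideal.isMaximal_comap_of_isIntegral_of_isMaximal (R := A) P.1)).symm

/-- M is a summand of a free module, hence projective, and its rank at every maximal ideal is the
rank of the power divided by |κ|. Over a semilocal ring, constant rank implies free. -/
theorem free_of_free_pi {R M : Type*} [CommRing R] [Finite (MaximalSpectrum R)] [AddCommGroup M]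
    [Module R M] [Module.Finite R M] {κ : Type*} [Finite κ] [Nonempty κ]
    (h : Module.Free R (κ → M)) : Module.Free R M := by
  classical
  have := Fintype.ofFinite κ
  obtain ⟨k⟩ := ‹Nonempty κ›
  have : Module.Projective R M := Module.Projective.of_split (LinearMap.single R (fun _ => M) k)
    (LinearMap.proj k) (by ext; simp)
  refine Module.free_of_flat_of_finrank_eq R M
    (Module.finrank R (κ → M) / Fintype.card κ) fun P => ?_
  have hP := P.2
  let _ := Ideal.Quotient.field P.1
  have h1 : Module.finrank (R ⧸ P.1) ((R ⧸ P.1) ⊗[R] (κ → M)) =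
      Fintype.card κ * Module.finrank (R ⧸ P.1) ((R ⧸ P.1) ⊗[R] M) := by
    rw [(TensorProduct.piRight R (R ⧸ P.1) (R ⧸ P.1) fun _ : κ => M).finrank_eq,
      Module.finrank_pi_fintype, Finset.sum_const, smul_eq_mul, Finset.card_univ]
  have : Nontrivial R := (Ideal.Quotient.mk P.1).domain_nontrivial
  rw [Module.finrank_baseChange] at h1
  rw [h1, Nat.mul_div_cancel_left _ (Fintype.card_pos_iff.2 ⟨k⟩)]

variable {R R' M M' : Type*} [CommRing R] [CommRing R'] [AddCommGroup M] [Module R M]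
  [AddCommGroup M'] [Module R' M'] {κ : Type*} [Fintype κ] {φ : R →+* R'} {ψ : M →+ M'}
  (hψ : ∀ a m, ψ (a • m) = φ a • ψ m) {W : κ → R'}
  (hR : Function.Bijective fun a : κ → R => ∑ i, W i * φ (a i))
  (hM : Function.Bijective fun m : κ → M => ∑ i, W i • ψ (m i))

include hψ hR hM in
theorem free_of_free_of_decomposition (h : Module.Free R M) : Module.Free R' M' := by
  let b := Module.Free.chooseBasis R M
  refine Module.Free.of_basis (Module.Basis.mk (v := fun j => ψ (b j)) ?_ ?_)
  · rw [linearIndependent_iff']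
    intro s c hc
    choose a ha using fun j => hR.2 (c j)
    have h1 : (fun i => ∑ j ∈ s, a j i • b j) = 0 := by
      refine hM.1 ?_
      simp only [map_sum, hψ, Pi.zero_apply, map_zero, smul_zero, Finset.sum_const_zero,
        Finset.smul_sum]
      rw [Finset.sum_comm, ← hc]
      refine Finset.sum_congr rfl fun j _ => ?_
      rw [← ha, Finset.sum_smul]
      simp only [mul_smul]
    intro j hj
    rw [← ha]
    refine Finset.sum_eq_zero fun i _ => ?_
    rw [linearIndependent_iff'.1 b.linearIndependent s (fun j => a j i) (congrFun h1 i) j hj,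
      map_zero, mul_zero]
  · rintro y -
    obtain ⟨m, rfl⟩ := hM.2 y
    refine sum_mem fun i _ => Submodule.smul_mem _ _ ?_
    rw [← b.linearCombination_repr (m i), Finsupp.linearCombination_apply, Finsupp.sum, map_sum]
    refine sum_mem fun j _ => ?_
    rw [hψ]
    exact Submodule.smul_mem _ _ (Submodule.subset_span ⟨j, rfl⟩)

include hψ hR hM in
-- For descent: R' is free over R, so M' free over R' is free over R, and M' is a finite power of M
-- as an R-module.
theorem free_iff_free_of_decomposition [Nonempty κ] [Finite (MaximalSpectrum R)]
    [Module.Finite R M] : Module.Free R' M' ↔ Module.Free R M := by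
  refine ⟨fun h => ?_, free_of_free_of_decomposition hψ hR hM⟩
  let _ := φ.toAlgebra
  let _ : Module R M' := Module.compHom M' φ
  have : IsScalarTower R R' M' := ⟨fun a b m => by
    rw [Algebra.smul_def, mul_smul]
    rfl⟩
  let eR : (κ → R) ≃ₗ[R] R' := LinearEquiv.ofBijective
    { toFun := fun a => ∑ i, W i * φ (a i)
      map_add' := fun a b => by simp [mul_add, Finset.sum_add_distrib]
      map_smul' := fun c a => by
        simp only [Pi.smul_apply, smul_eq_mul, map_mul, RingHom.id_apply, Algebra.smul_def,
          RingHom.algebraMap_toAlgebra, Finset.mul_sum]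
        exact Finset.sum_congr rfl fun i _ => mul_left_comm _ _ _ } hR
  let eM : (κ → M) ≃ₗ[R] M' := LinearEquiv.ofBijective
    { toFun := fun m => ∑ i, W i • ψ (m i)
      map_add' := fun a b => by simp [Finset.sum_add_distrib]
      map_smul' := fun c a => by
        simp only [Pi.smul_apply, hψ, RingHom.id_apply]
        rw [Finset.smul_sum]
        exact Finset.sum_congr rfl fun i _ => smul_comm _ _ _ } hM
  have : Module.Free R R' := Module.Free.of_equiv eR
  have : Module.Free R M' := Module.Free.trans (S := R')
  exact free_of_free_pi (Module.Free.of_equiv eM.symm)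

end Free

/-! ### Base change of associated orders -/

section Orders

variable {p : ℕ} [Fact p.Prime] {K K' L L' : Type*} [Field K] [Field K'] [Field L] [Field L']
  [Algebra K K'] [Algebra K L] [Algebra K L'] [Algebra K' L'] [IsScalarTower K K' L']
  [Algebra ℤ_[p] K] [Algebra ℤ_[p] K'] [Algebra ℤ_[p] L] [Algebra ℤ_[p] L']
  [IsScalarTower ℤ_[p] K K'] [IsScalarTower ℤ_[p] K L] [IsScalarTower ℤ_[p] K L']
  [IsScalarTower ℤ_[p] K' L'] {i : L →ₐ[K] L'}
  (hi : IsBaseChange K' i.toLinearMap) {H : Type*} [Ring H] [HopfAlgebra K H]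

theorem map_mem_intRing (i : L →ₐ[K] L') {x : L} (hx : x ∈ intRing p L) : i x ∈ intRing p L' :=
  IsIntegral.map (i.restrictScalars ℤ_[p]) hx

theorem smul_mem_intRing {a : K'} (ha : a ∈ intRing p K') {y : L'} (hy : y ∈ intRing p L') :
    a • y ∈ intRing p L' := by
  rw [Algebra.smul_def]
  exact mul_mem (IsIntegral.map (IsScalarTower.toAlgHom ℤ_[p] K' L') ha) hy

variable {κ : Type*} [Fintype κ] (W : Module.Basis κ K K')

theorem bijective_sum_tmul {A A' : Type*} [CommRing A] [CommRing A'] [Algebra A A']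
    (b : Module.Basis κ A A') (V : Type*) [AddCommGroup V] [Module A V] :
    Function.Bijective fun v : κ → V => ∑ k, b k ⊗ₜ[A] v k := by
  classical
  have h : (fun v : κ → V => ∑ k, b k ⊗ₜ[A] v k) =
      (TensorProduct.equivFinsuppOfBasisLeft b).symm ∘ Finsupp.equivFunOnFinite.symm := by
    ext v
    simp [Finsupp.sum_fintype]
  rw [h]
  exact (LinearEquiv.bijective _).comp (Equiv.bijective _)

include hi in
theorem bijective_sum_smul : Function.Bijective fun x : κ → L => ∑ k, W k • i (x k) := by
  have h : (fun x : κ → L => ∑ k, W k • i (x k)) =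
      hi.equiv ∘ fun v : κ → L => ∑ k, W k ⊗ₜ[K] v k := by
    ext v
    simp [IsBaseChange.equiv_tmul]
  rw [h]
  exact hi.equiv.bijective.comp (bijective_sum_tmul W L)

theorem baseChangeAction_sum_tmul (ρ : HopfAction K L H) (h : κ → H) (x : L) :
    baseChangeAction hi ρ (∑ k, W k ⊗ₜ h k) (i x) = ∑ k, W k • i (ρ (h k) x) := by
  simp only [map_sum, LinearMap.sum_apply, baseChangeAction_tmul_apply]

variable (hW : ∀ k, W k ∈ intRing p K')
  (hO : ∀ y ∈ intRing p L', ∃ x : κ → L, (∀ k, x k ∈ intRing p L) ∧ ∑ k, W k • i (x k) = y)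

include hW hO in
-- Evaluated on i(x) with x ∈ 𝒪_L, the element has coordinates hₖ·x along the basis, and an element
-- of 𝒪_{L'} has integral coordinates by `hO`.
theorem sum_tmul_mem_associatedOrder_iff (ρ : HopfAction K L H) (h : κ → H) :
    ∑ k, W k ⊗ₜ[K] h k ∈ associatedOrder p (baseChangeAction hi ρ) ↔
      ∀ k, h k ∈ associatedOrder p ρ := by
  constructor
  · intro hh k x hx
    obtain ⟨z, hz, hz'⟩ := hO _ (hh (i x) (map_mem_intRing i hx))
    rw [baseChangeAction_sum_tmul] at hz'
    have h1 := (bijective_sum_smul hi W).1 hz'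
    have h2 := congrFun h1 k
    exact h2 ▸ hz k
  · intro hh y hy
    obtain ⟨x, hx, rfl⟩ := hO y hy
    rw [map_sum]
    refine sum_mem fun k _ => ?_
    rw [map_smul, baseChangeAction_sum_tmul]
    exact smul_mem_intRing (hW k) (sum_mem fun j _ =>
      smul_mem_intRing (hW j) (map_mem_intRing i (hh j _ (hx k))))

instance intRing_isScalarTower_tensorProduct :
    IsScalarTower (intRing p K) (intRing p K') (K' ⊗[K] H) :=
  .of_algebraMap_eq fun _ => rfl

variable (p) in
/-- The natural map `𝒪_{K'} ⊗ 𝔄_H → K' ⊗ H`. -/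
def orderBaseChangeMap (ρ : HopfAction K L H) :
    (intRing p K' ⊗[intRing p K] associatedOrder p ρ) →ₐ[intRing p K'] K' ⊗[K] H :=
  Algebra.TensorProduct.lift (Algebra.ofId (intRing p K') (K' ⊗[K] H))
    (((Algebra.TensorProduct.includeRight : H →ₐ[K] K' ⊗[K] H).restrictScalars (intRing p K)).comp
      (associatedOrder p ρ).val) fun a _ => by
        rw [Algebra.ofId_apply]
        exact Algebra.commute_algebraMap_left a _

theorem orderBaseChangeMap_tmul (ρ : HopfAction K L H) (a : intRing p K')
    (h : associatedOrder p ρ) :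
    orderBaseChangeMap p ρ (a ⊗ₜ h) = (a : K') ⊗ₜ[K] (h : H) := by
  rw [orderBaseChangeMap, Algebra.TensorProduct.lift_tmul]
  change ((a : K') ⊗ₜ[K] (1 : H)) * (1 ⊗ₜ (h : H)) = _
  rw [Algebra.TensorProduct.tmul_mul_tmul, mul_one, one_mul]

variable {W} {b : Module.Basis κ (intRing p K) (intRing p K')} (hb : ∀ k, W k = b k)

include hb in
theorem orderBaseChangeMap_sum (ρ : HopfAction K L H) (a : κ → associatedOrder p ρ) :
    orderBaseChangeMap p ρ (∑ k, b k ⊗ₜ a k) = ∑ k, W k ⊗ₜ[K] (a k : H) := by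
  simp only [map_sum, orderBaseChangeMap_tmul, hb]

include hO hb in
theorem exists_orderBaseChangeEquiv (ρ : HopfAction K L H) :
    ∃ Φ : (intRing p K' ⊗[intRing p K] associatedOrder p ρ) ≃ₐ[intRing p K']
        associatedOrder p (baseChangeAction hi ρ),
      ∀ (a : intRing p K') (h : associatedOrder p ρ),
        (Φ (a ⊗ₜ[intRing p K] h) : K' ⊗[K] H) = (a : K') ⊗ₜ[K] (h : H) := by
  have hW : ∀ k, W k ∈ intRing p K' := fun k => hb k ▸ (b k).2
  have hmem : ∀ t, orderBaseChangeMap p ρ t ∈ associatedOrder p (baseChangeAction hi ρ) := by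
    intro t
    obtain ⟨a, rfl⟩ := (bijective_sum_tmul b _).2 t
    dsimp only
    rw [orderBaseChangeMap_sum hb, sum_tmul_mem_associatedOrder_iff hi W hW hO]
    exact fun k => (a k).2
  refine ⟨AlgEquiv.ofBijective ((orderBaseChangeMap p ρ).codRestrict _ hmem) ⟨?_, ?_⟩,
    orderBaseChangeMap_tmul ρ⟩
  · intro s t hst
    obtain ⟨a, rfl⟩ := (bijective_sum_tmul b _).2 s
    obtain ⟨c, rfl⟩ := (bijective_sum_tmul b _).2 t
    have h := congrArg Subtype.val hst
    change orderBaseChangeMap p ρ _ = orderBaseChangeMap p ρ _ at h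
    dsimp only at h
    rw [orderBaseChangeMap_sum hb, orderBaseChangeMap_sum hb] at h
    have h1 : (fun k => (a k : H)) = fun k => (c k : H) := (bijective_sum_tmul W H).1 h
    have h2 : a = c := funext fun k => Subtype.ext (congrFun h1 k)
    rw [h2]
  · rintro ⟨t, ht⟩
    obtain ⟨h, rfl⟩ := (bijective_sum_tmul W H).2 t
    have h1 := (sum_tmul_mem_associatedOrder_iff hi W hW hO ρ h).1 ht
    refine ⟨∑ k, b k ⊗ₜ ⟨h k, h1 k⟩, Subtype.ext ?_⟩
    exact orderBaseChangeMap_sum hb ρ fun k => ⟨h k, h1 k⟩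

variable (p) in
/-- The map `𝔄_H → 𝔄_{H'}`, `h ↦ 1 ⊗ h`. -/
def orderInclusion (ρ : HopfAction K L H)
    (h : ∀ a ∈ associatedOrder p ρ, (1 : K') ⊗ₜ[K] a ∈ associatedOrder p (baseChangeAction hi ρ)) :
    associatedOrder p ρ →+* associatedOrder p (baseChangeAction hi ρ) :=
  ((Algebra.TensorProduct.includeRight : H →ₐ[K] K' ⊗[K] H).toRingHom.comp
    (associatedOrder p ρ).val.toRingHom).codRestrict _ fun a => h a a.2

variable (p) in
/-- The inclusion of `𝒪_L` in `𝒪_{L'}`. -/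
def intRingInclusion (i : L →ₐ[K] L') : intRing p L →+ intRing p L' :=
  (i.toAddMonoidHom.comp (intRing p L).val.toAddMonoidHom).codRestrict
    (intRing p L').toSubmodule.toAddSubmonoid fun x => map_mem_intRing i x.2

include hO hb in
-- The elements Wₖ ⊗ 1 decompose both 𝔄_{H'} over 𝔄_H and 𝒪_{L'} over 𝒪_L. The order 𝔄_H is
-- semilocal because it is commutative and finite over the local ring 𝒪_K.
theorem isFreeOverAssociatedOrder_baseChangeAction_iff [Nonempty κ] {ρ : HopfAction K L H}
    (hH : ∀ a b : H, a * b = b * a) [IsLocalRing (intRing p K)]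
    [Module.Finite (intRing p K) (associatedOrder p ρ)]
    [Module.Finite (intRing p K) (intRing p L)] :
    IsFreeOverAssociatedOrder p (baseChangeAction hi ρ) ↔ IsFreeOverAssociatedOrder p ρ := by
  classical
  have hW : ∀ k, W k ∈ intRing p K' := fun k => hb k ▸ (b k).2
  have hH' : ∀ s t : K' ⊗[K] H, s * t = t * s := by
    let _ : CommRing H := { (inferInstance : Ring H) with mul_comm := hH }
    exact fun s t => mul_comm s t
  let _ : CommRing (associatedOrder p ρ) :=
    { (inferInstance : Ring (associatedOrder p ρ)) with mul_comm a b := Subtype.ext (hH a b) }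
  let _ : CommRing (associatedOrder p (baseChangeAction hi ρ)) :=
    { (inferInstance : Ring (associatedOrder p (baseChangeAction hi ρ))) with
      mul_comm a b := Subtype.ext (hH' a b) }
  let _ := associatedOrderModule p ρ
  let _ := associatedOrderModule p (baseChangeAction hi ρ)
  have : IsScalarTower (intRing p K) (associatedOrder p ρ) (intRing p L) := ⟨fun r a x =>
    Subtype.ext (by
      change ρ ((r : K) • (a : H)) x = algebraMap K L r * ρ a x
      rw [map_smul, LinearMap.smul_apply, Algebra.smul_def])⟩
  have : Module.Finite (associatedOrder p ρ) (intRing p L) :=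
    Module.Finite.of_restrictScalars_finite (intRing p K) _ _
  have : Finite (MaximalSpectrum (associatedOrder p ρ)) :=
    finite_maximalSpectrum_of_finite (intRing p K) _
  have h1 : ∀ a ∈ associatedOrder p ρ,
      (1 : K') ⊗ₜ[K] a ∈ associatedOrder p (baseChangeAction hi ρ) := by
    intro a ha y hy
    obtain ⟨x, hx, rfl⟩ := hO y hy
    rw [map_sum]
    refine sum_mem fun k _ => ?_
    rw [map_smul, baseChangeAction_tmul_apply, one_smul]
    exact smul_mem_intRing (hW k) (map_mem_intRing i (ha _ (hx k)))
  have h2 : ∀ k, W k ⊗ₜ[K] (1 : H) ∈ associatedOrder p (baseChangeAction hi ρ) := fun k =>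
    (associatedOrder p (baseChangeAction hi ρ)).algebraMap_mem ⟨W k, hW k⟩
  have hR : ∀ a : κ → associatedOrder p ρ, ((∑ k, ⟨W k ⊗ₜ 1, h2 k⟩ * orderInclusion p hi ρ h1 (a k) :
      associatedOrder p (baseChangeAction hi ρ)) : K' ⊗[K] H) = ∑ k, W k ⊗ₜ[K] (a k : H) := by
    intro a
    rw [AddSubmonoidClass.coe_finsetSum]
    refine Finset.sum_congr rfl fun k _ => ?_
    change (W k ⊗ₜ[K] (1 : H)) * (1 ⊗ₜ (a k : H)) = _
    rw [Algebra.TensorProduct.tmul_mul_tmul, mul_one, one_mul]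
  have hM : ∀ m : κ → intRing p L, ((∑ k, (⟨W k ⊗ₜ 1, h2 k⟩ :
      associatedOrder p (baseChangeAction hi ρ)) • intRingInclusion p i (m k) : intRing p L') : L') =
      ∑ k, W k • i (m k) := by
    intro m
    rw [AddSubmonoidClass.coe_finsetSum]
    refine Finset.sum_congr rfl fun k _ => ?_
    change baseChangeAction hi ρ (W k ⊗ₜ 1) (i (m k)) = _
    rw [baseChangeAction_tmul_apply, map_one, Module.End.one_apply]
  refine free_iff_free_of_decomposition (φ := orderInclusion p hi ρ h1)
    (ψ := intRingInclusion p i) (W := fun k => ⟨W k ⊗ₜ 1, h2 k⟩) ?_ ⟨?_, ?_⟩ ⟨?_, ?_⟩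
  · intro a m
    refine Subtype.ext ?_
    change i (ρ a m) = baseChangeAction hi ρ (1 ⊗ₜ (a : H)) (i m)
    rw [baseChangeAction_tmul_apply, one_smul]
  · intro a c hac
    have h := congrArg Subtype.val hac
    dsimp only at h
    rw [hR, hR] at h
    exact funext fun k => Subtype.ext (congrFun ((bijective_sum_tmul W H).1 h) k)
  · rintro ⟨t, ht⟩
    obtain ⟨h, rfl⟩ := (bijective_sum_tmul W H).2 t
    exact ⟨fun k => ⟨h k, (sum_tmul_mem_associatedOrder_iff hi W hW hO ρ h).1 ht k⟩,
      Subtype.ext (hR _)⟩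
  · intro m n hmn
    have h := congrArg Subtype.val hmn
    dsimp only at h
    rw [hM, hM] at h
    exact funext fun k => Subtype.ext (congrFun ((bijective_sum_smul hi W).1 h) k)
  · rintro ⟨y, hy⟩
    obtain ⟨x, hx, rfl⟩ := hO y hy
    exact ⟨fun k => ⟨x k, hx k⟩, Subtype.ext (hM _)⟩

end Orders

/-! ### Integral bases -/

section IntegralBasis

variable (p : ℕ) [Fact p.Prime] (F E : Type*) [Field F] [Field E] [Algebra ℤ_[p] F]
  [Algebra ℤ_[p] E] [Algebra F E] [IsScalarTower ℤ_[p] F E]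
  [Algebra ℚ_[p] F] [FiniteDimensional ℚ_[p] F] [IsScalarTower ℤ_[p] ℚ_[p] F]
  [Algebra ℚ_[p] E] [FiniteDimensional ℚ_[p] E] [IsScalarTower ℤ_[p] ℚ_[p] E]

theorem exists_basis_eq_intRing_basis {κ : Type*} [Fintype κ]
    (b : Module.Basis κ (intRing p F) (intRing p E)) :
    ∃ W : Module.Basis κ F E, ∀ k, W k = b k := by
  have h1 : LinearIndependent F fun k => (b k : E) := by
    rw [← LinearIndependent.iff_fractionRing (intRing p F) F]
    exact b.linearIndependent.map' (IsScalarTower.toAlgHom (intRing p F) (intRing p E) E).toLinearMap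
      (LinearMap.ker_eq_bot.2 Subtype.val_injective)
  have h2 : Fintype.card κ = Module.finrank F E := by
    rw [← finrank_intRing p F E, Module.finrank_eq_card_basis b]
  have : Nonempty κ := b.index_nonempty
  exact ⟨basisOfLinearIndependentOfCardEqFinrank h1 h2, fun k => by simp⟩

variable {F E} {H : Type*} [Ring H] [HopfAlgebra F H]

/-- An integral basis of 𝒪_E is a basis of E, so 𝔄_H embeds in End(𝒪_E), a finite module over the
noetherian ring 𝒪_F. -/
theorem associatedOrder_finite {ρ : HopfAction F E H} (hρ : IsHopfGalois ρ) :
    Module.Finite (intRing p F) (associatedOrder p ρ) := by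
  let b := Module.Free.chooseBasis (intRing p F) (intRing p E)
  obtain ⟨W, hW⟩ := exists_basis_eq_intRing_basis p F E b
  let f : associatedOrder p ρ →ₗ[intRing p F] intRing p E →ₗ[intRing p F] intRing p E :=
    { toFun := fun a =>
        { toFun := fun x => ⟨ρ a x, a.2 x x.2⟩
          map_add' := fun x y => Subtype.ext (map_add _ _ _)
          map_smul' := fun r x => Subtype.ext (by
            change ρ a (algebraMap F E r * x) = algebraMap F E r * ρ a x
            rw [← Algebra.smul_def, ← Algebra.smul_def, map_smul]) }
      map_add' := fun a c => by
        ext x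
        exact congrArg (fun s : Module.End F E => s x) (map_add ρ a.1 c.1)
      map_smul' := fun r a => by
        ext x
        change ρ ((r : F) • a.1) x = algebraMap F E r * ρ a.1 x
        rw [map_smul, LinearMap.smul_apply, Algebra.smul_def] }
  have hf : Function.Injective f := by
    intro a c hac
    refine Subtype.ext (hρ.injective (W.ext fun k => ?_))
    rw [hW]
    exact congrArg Subtype.val (DFunLike.congr_fun hac (b k))
  exact Module.Finite.of_injective f hf

end IntegralBasis

theorem isBaseChange_of_linearIndependent {K K' L L' : Type*} [Field K] [Field K'] [Field L]
    [Field L'] [Algebra K K'] [Algebra K L] [Algebra K L'] [Algebra K' L'] [IsScalarTower K K' L']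
    {ι : Type*} [Fintype ι] [Nonempty ι] {i : L →ₐ[K] L'}
    (c : Module.Basis ι K L) (hc : LinearIndependent K' fun j => i (c j))
    (hcard : Fintype.card ι = Module.finrank K' L') : IsBaseChange K' i.toLinearMap := by
  refine IsBaseChange.of_equiv
    ((c.baseChange K').equiv (basisOfLinearIndependentOfCardEqFinrank hc hcard) (Equiv.refl ι))
    fun x => ?_
  rw [← c.sum_repr x]
  simp only [TensorProduct.tmul_sum, map_sum]
  refine Finset.sum_congr rfl fun j _ => ?_
  rw [TensorProduct.tmul_smul, LinearMap.map_smul, ← algebraMap_smul K' (c.repr x j) (_ ⊗ₜ _),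
    LinearEquiv.map_smul, algebraMap_smul, ← Module.Basis.baseChange_apply, Module.Basis.equiv_apply]
  simp

/-! ### Coordinates of integers along a basis of 𝒪_{K'} over 𝒪_K. -/

section Generation

variable {p : ℕ} [Fact p.Prime] {K K' L L' : Type*} [Field K] [Field K'] [Field L] [Field L']
  [Algebra K K'] [Algebra K L] [Algebra K L'] [Algebra K' L'] [IsScalarTower K K' L']
  [Algebra ℤ_[p] K] [Algebra ℤ_[p] K'] [Algebra ℤ_[p] L] [Algebra ℤ_[p] L']
  [IsScalarTower ℤ_[p] K K'] [IsScalarTower ℤ_[p] K L] [IsScalarTower ℤ_[p] K' L']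
  [Algebra L L'] [IsScalarTower ℤ_[p] L L'] [IsScalarTower K L L']

theorem exists_sum_smul_eq_of_span_eq_top {κ : Type*} [Fintype κ]
    (b : Module.Basis κ (intRing p K) (intRing p K'))
    (h : Submodule.span (intRing p L) (Set.range (algebraMap (intRing p K') (intRing p L'))) = ⊤)
    (y : intRing p L') :
    ∃ x : κ → intRing p L, ∑ k, (b k : K') • algebraMap L L' (x k) = (y : L') := by
  have hy : y ∈ Submodule.span (intRing p L)
      (Set.range (algebraMap (intRing p K') (intRing p L'))) := h ▸ Submodule.mem_top
  induction hy using Submodule.span_induction with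
  | mem y hy =>
    obtain ⟨a, rfl⟩ := hy
    refine ⟨fun k => algebraMap (intRing p K) (intRing p L) (b.repr a k), ?_⟩
    have h1 := congrArg (fun c : intRing p K' => algebraMap K' L' c) (b.sum_repr a)
    simp only [AddSubmonoidClass.coe_finsetSum, map_sum] at h1
    refine Eq.trans (Finset.sum_congr rfl fun k _ => ?_) h1
    change _ = algebraMap K' L' (algebraMap K K' (b.repr a k) * b k)
    rw [coe_algebraMap_intRing, ← IsScalarTower.algebraMap_apply, map_mul,
      ← IsScalarTower.algebraMap_apply, Algebra.smul_def, mul_comm]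
  | zero => exact ⟨0, by simp⟩
  | add y z _ _ hy hz =>
    obtain ⟨x, hx⟩ := hy
    obtain ⟨x', hx'⟩ := hz
    exact ⟨x + x', by simp [smul_add, Finset.sum_add_distrib, hx, hx']⟩
  | smul r y _ hy =>
    obtain ⟨x, hx⟩ := hy
    refine ⟨r • x, ?_⟩
    change _ = algebraMap L L' r * y
    rw [← hx, Finset.mul_sum]
    refine Finset.sum_congr rfl fun k _ => ?_
    change (b k : K') • algebraMap L L' (r * x k) = _
    rw [map_mul, mul_smul_comm]

end Generation

/-! ### The inertia fields of a totally ramified extension of degree `p` -/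

section Disjoint

variable {K N : Type*} [Field K] [Field N] [Algebra K N] [FiniteDimensional K N] [IsGalois K N]
  {L K' L' : IntermediateField K N} {J : Subgroup (N ≃ₐ[K] N)} [J.Normal]
  (hJ : Subgroup.IsComplement' J L.fixingSubgroup) [Fact (Nat.card J).Prime]
  (hJK : J ≤ K'.fixingSubgroup) (hle : K' ≤ L') (hLL : L ≤ L')

/-- The inclusion of `L` in `L'`, where `L'` is viewed as an extension of `K'`. -/
def inclusionExtendScalars : L →ₐ[K] IntermediateField.extendScalars hle where
  toFun x := ⟨x, hLL x.2⟩
  map_one' := rfl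
  map_mul' _ _ := rfl
  map_zero' := rfl
  map_add' _ _ := rfl
  commutes' _ := rfl

include hJ hJK in
-- J fixes K', so a relation ∑ aⱼcⱼ = 0 over K' yields ∑ aⱼτ(cⱼ) = 0 for all τ ∈ J. The functional s
-- ↦ ∑ aⱼs(cⱼ) thus vanishes on the N-basis {τ|_L} of Hom_K(L, N), and testing it on coordinate
-- functions gives aⱼ = 0.
theorem linearIndependent_of_isComplement' {ι : Type*} [Fintype ι] (c : Module.Basis ι K L) :
    LinearIndependent K' fun j => inclusionExtendScalars hle hLL (c j) := by
  let _ := commGroupOfPrimeCard J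
  rw [Fintype.linearIndependent_iff]
  intro a ha j
  have hinj : Function.Injective (restrictHom L J.subtype) :=
    fun x y h => eq_of_forall_apply_eq hJ fun l => DFunLike.congr_fun h l
  let f : (L →ₗ[K] N) →ₗ[N] N := ∑ j, (a j : N) • LinearMap.applyₗ' N (c j)
  have hf : f = 0 := by
    refine (restrictHomBasis hinj (finrank_eq_card_of_isComplement' hJ)).ext fun τ => ?_
    have h1 := congrArg (fun y : IntermediateField.extendScalars hle => τ.1 y) ha
    rw [restrictHomBasis_apply]
    simp only [f, LinearMap.sum_apply, LinearMap.smul_apply, LinearMap.zero_apply]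
    refine Eq.trans ?_ (h1.trans (map_zero _))
    rw [AddSubmonoidClass.coe_finsetSum, map_sum]
    refine Finset.sum_congr rfl fun j _ => ?_
    change (a j : N) * τ.1 (c j) = τ.1 ((a j : N) * c j)
    rw [map_mul, (IntermediateField.mem_fixingSubgroup_iff _ _).1 (hJK τ.2) _ (a j).2]
  have h2 := DFunLike.congr_fun hf (L.val.toLinearMap ∘ₗ (c.coord j).smulRight 1)
  simp only [f, LinearMap.sum_apply, LinearMap.smul_apply, LinearMap.zero_apply] at h2
  rw [Finset.sum_eq_single j] at h2
  · refine Subtype.ext ?_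
    simpa using h2
  · intro k _ hkj
    simp [Finsupp.single_eq_of_ne' hkj]
  · simp

include hJ hJK in
theorem isBaseChange_inclusionExtendScalars
    (h : Module.finrank K' (IntermediateField.extendScalars hle) = Module.finrank K L) :
    IsBaseChange K' (inclusionExtendScalars hle hLL).toLinearMap := by
  let c := Module.finBasis K L
  have : Nonempty (Fin (Module.finrank K L)) := ⟨⟨0, Module.finrank_pos⟩⟩
  exact isBaseChange_of_linearIndependent c
    (linearIndependent_of_isComplement' hJ hJK hle hLL c) (by rw [Fintype.card_fin, h])

end Disjoint

/-! ### Unramifiedness of L'/L and generation of 𝒪_{L'}. -/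

section Main

variable {p : ℕ} [Fact p.Prime] {K N : Type*} [Field K] [Algebra ℚ_[p] K]
  [Algebra ℤ_[p] K] [IsScalarTower ℤ_[p] ℚ_[p] K]
  [Field N] [Algebra K N] [Algebra ℚ_[p] N] [IsScalarTower ℚ_[p] K N]
  [Algebra ℤ_[p] N] [IsScalarTower ℤ_[p] K N] [FiniteDimensional ℚ_[p] K]
  [FiniteDimensional K N] [IsGalois K N] [FiniteDimensional ℚ_[p] N] [IsScalarTower ℤ_[p] ℚ_[p] N]
  {L K' L' : IntermediateField K N} (hK' : K'.fixingSubgroup = inertiaGroup p K N)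
  (hL' : L'.fixingSubgroup = inertiaGroup p K N ⊓ L.fixingSubgroup) (hle : K' ≤ L') (hLL : L ≤ L')

include hK' hL' in
theorem exists_sum_smul_eq_of_mem_intRing {κ : Type*} [Fintype κ]
    (b : Module.Basis κ (intRing p K) (intRing p K'))
    (y : IntermediateField.extendScalars hle)
    (hy : y ∈ intRing p (IntermediateField.extendScalars hle)) :
    ∃ x : κ → L, (∀ k, x k ∈ intRing p L) ∧
      ∑ k, (b k : K') • inclusionExtendScalars hle hLL (x k) = y := by
  let E := IntermediateField.extendScalars hle
  let _ : Algebra L E := (inclusionExtendScalars hle hLL).toRingHom.toAlgebra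
  have : IsScalarTower K L E := .of_algebraMap_eq fun _ => rfl
  have : IsScalarTower L E N := .of_algebraMap_eq fun _ => rfl
  have : IsScalarTower ℤ_[p] L E := .of_algebraMap_eq fun _ => rfl
  have : IsScalarTower ℚ_[p] K' N := .of_algebraMap_eq fun _ => rfl
  have h1 : inertiaGroup p K' N = ⊤ := inertiaGroup_fixedField_eq_top p hK'.le
  have h2 : inertiaGroup p E N = ⊤ := inertiaGroup_eq_top_of_tower p K' E N h1
  -- e(N/L) = |I ∩ Gal(N/L)| = [N : L'] = e(N/L'), the last because N/L' is totally ramified;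
  -- multiplicativity leaves e(L'/L) = 1.
  have h3 := ramificationIdx_tower p L E N
  rw [← card_inertiaGroup p L N, ← card_inertiaGroup p E N, h2, Subgroup.card_top,
    card_inertiaGroup_intermediateField, ← hL', IsGalois.card_aut_eq_finrank,
    IsGalois.card_fixingSubgroup_eq_finrank] at h3
  have h4 : Module.finrank E N = Module.finrank L' N := rfl
  rw [h4] at h3
  have h5 : (maxIdeal p E).ramificationIdx (intRing p L) = 1 :=
    Nat.eq_of_mul_eq_mul_right (Module.finrank_pos (R := L') (M := N))
      (by rw [one_mul]; exact h3.symm)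
  obtain ⟨x, hx⟩ := exists_sum_smul_eq_of_span_eq_top b (span_range_algebraMap_eq_top p K' E N L
    (isTotallyRamified_inertiaField hK') h5) ⟨y, hy⟩
  exact ⟨fun k => x k, fun k => (x k).2, hx⟩

end Main

end HopfGaloisDegP

end

/-! ### The main theorem. -/

theorem mainTheorem2 (p : ℕ) [Fact p.Prime] (hp : p ≠ 2)
    -- `K` is a `p`-adic field and `N/K` is an extension
    (K : Type u) [Field K] [Algebra ℚ_[p] K] [FiniteDimensional ℚ_[p] K]
    [Algebra ℤ_[p] K] [IsScalarTower ℤ_[p] ℚ_[p] K]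
    (N : Type v) [Field N] [Algebra K N] [Algebra ℚ_[p] N] [IsScalarTower ℚ_[p] K N]
    [Algebra ℤ_[p] N] [IsScalarTower ℤ_[p] K N]
    -- `L/K` is totally ramified of degree `p` and `N` is its normal closure
    (L : IntermediateField K N) (hdeg : Module.finrank K L = p)
    (hram : IsTotallyRamified p K L) (hN : IsNormalClosure K L N)
    -- `K'` and `L'` are the inertia fields of `N/K` and `N/L`, as subfields of `N`
    (K' : IntermediateField K N) (hK' : K' = inertiaField p K N)
    (L' : IntermediateField K N) (hL' : L' = (inertiaField p L N).restrictScalars K) :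
    ∃ hle : K' ≤ L',
      -- `L'/K'` is a degree `p` extension of `p`-adic fields with normal closure `N`,
      -- and it is Hopf-Galois
      (FiniteDimensional ℚ_[p] K' ∧ FiniteDimensional ℚ_[p] L' ∧
        Module.finrank K' (IntermediateField.extendScalars hle) = p ∧
        IsNormalClosure K' (IntermediateField.extendScalars hle) N ∧
        IsHopfGaloisExtension K' (IntermediateField.extendScalars hle)) ∧
      -- `N/K'` is totally ramified
      IsTotallyRamified p K' N ∧
      -- `L/K` has a Galois complement, and `L'/K'` is almost classically Galois with the
      -- same complement
      ((∃ M : IntermediateField K N, IsAlmostClassicallyGaloisWith L M) ∧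
        ∀ M : IntermediateField K N, IsAlmostClassicallyGaloisWith L M →
          ∃ hM : K' ≤ M, IsAlmostClassicallyGaloisWith
            (IntermediateField.extendScalars hle) (IntermediateField.extendScalars hM)) ∧
      -- `L/K` admits a Hopf-Galois structure, and for every such structure `H`:
      IsHopfGaloisExtension K L ∧
      ∀ (H : Type w) [Ring H] [HopfAlgebra K H] (ρ : HopfAction K L H),
        IsHopfGalois ρ →
        -- the action of `H` on `L` extends to exactly one `K'`-linear action of the `K'`-Hopf
        -- algebra `K' ⊗ H` on `L'`,
        ∃ ρ' : HopfAction K' (IntermediateField.extendScalars hle) (K' ⊗[K] H),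
          (∀ σ : HopfAction K' (IntermediateField.extendScalars hle) (K' ⊗[K] H),
            (∀ (a : K') (h : H) (x : L) (y : IntermediateField.extendScalars hle),
              (y : N) = x → (σ (a ⊗ₜ[K] h) y : N) = a * (ρ h x : N)) ↔ σ = ρ') ∧
          -- which is the unique Hopf-Galois structure on `L'/K'`;
          IsUniqueHopfGalois.{z} ρ' ∧
          -- the associated order of `K' ⊗ H` is `𝒪_{K'} ⊗ 𝔄_H`, via `a ⊗ h ↦ a ⊗ h`;
          (∃ Φ : (intRing p K' ⊗[intRing p K] associatedOrder p ρ)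
              ≃ₐ[intRing p K'] associatedOrder p ρ',
            ∀ (a : intRing p K') (h : associatedOrder p ρ),
              (Φ (a ⊗ₜ[intRing p K] h) : K' ⊗[K] H) = (a : K') ⊗ₜ[K] (h : H)) ∧
          -- and freeness over the associated orders is equivalent
          (IsFreeOverAssociatedOrder p ρ' ↔ IsFreeOverAssociatedOrder p ρ) := by
  have hp' : p.Prime := Fact.out
  have hpos : 0 < Module.finrank K L := hdeg ▸ hp'.pos
  have : FiniteDimensional K L := .of_finrank_pos hpos
  have : FiniteDimensional K N := finiteDimensional_of_isNormalClosure hN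
  have : CharZero K := charZero_of_injective_algebraMap (algebraMap ℚ_[p] K).injective
  have : Normal K N := hN.normal
  have : IsGalois K N := ⟨⟩
  have : FiniteDimensional ℚ_[p] N := .trans ℚ_[p] K N
  have : IsScalarTower ℤ_[p] ℚ_[p] N := isScalarTower_padic_of_tower p K N
  -- From here on K' and L' enter only through their Galois groups I and I ∩ Gal(N/L).
  replace hK' : K'.fixingSubgroup = inertiaGroup p K N := by
    rw [hK', inertiaField, IntermediateField.fixingSubgroup_fixedField]
  replace hL' : L'.fixingSubgroup = inertiaGroup p K N ⊓ L.fixingSubgroup := by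
    rw [hL', fixingSubgroup_restrictScalars_inertiaField]
  have hle : K' ≤ L' := le_of_fixingSubgroup_le (hL'.le.trans (inf_le_left.trans hK'.ge))
  have hLL : L ≤ L' := le_of_fixingSubgroup_le (hL'.le.trans inf_le_right)
  have hdeg' := finrank_extendScalars_inertiaField hdeg hram hK' hL' hle
  have hW := isComplement'_wildInertiaGroup hdeg hram hN
  -- This complement over K' gives both existence and uniqueness of the Hopf–Galois structure on
  -- L'/K', by the same prime-degree argument as over K.
  have hW' := isComplement'_comap_wildInertiaGroup hdeg hram hN hK' hL' hle
  have : Fact (Nat.card (wildInertiaGroup p K N)).Prime :=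
    ⟨by rw [← finrank_eq_card_of_isComplement' hW, hdeg]; exact hp'⟩
  have : ((wildInertiaGroup p K N).comap (galRestrictScalars K')).Normal :=
    Subgroup.Normal.comap inferInstance _
  have : Fact (Nat.card ((wildInertiaGroup p K N).comap (galRestrictScalars K'))).Prime :=
    ⟨by rw [← finrank_eq_card_of_isComplement' hW', hdeg']; exact hp'⟩
  have hi := isBaseChange_inclusionExtendScalars hW
    (hK' ▸ wildInertiaGroup_le_inertiaGroup) hle hLL (hdeg'.trans hdeg.symm)
  refine ⟨hle, ⟨inferInstance, inferInstance, hdeg',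
    isNormalClosure_extendScalars_inertiaField hdeg hram hN hK' hL' hle,
    isHopfGaloisExtension_of_isComplement' hW'⟩, isTotallyRamified_inertiaField hK',
    ⟨⟨_, exists_isAlmostClassicallyGaloisWith hdeg hram hN⟩, fun M hM =>
      isAlmostClassicallyGaloisWith_extendScalars hdeg hram hN hK' hL' hle hM⟩,
    isHopfGaloisExtension_of_isComplement' hW, fun H _ _ ρ hρ => ?_⟩
  have hρ' := isHopfGalois_baseChangeAction hi hρ
  let b := Module.Free.chooseBasis (intRing p K) (intRing p K')
  obtain ⟨W, hWb⟩ := exists_basis_eq_intRing_basis p K K' b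
  have hO := exists_sum_smul_eq_of_mem_intRing hK' hL' hle hLL b
  simp only [← hWb] at hO
  have := associatedOrder_finite p hρ
  have : IsScalarTower ℤ_[p] K (IntermediateField.extendScalars hle) :=
    .of_algebraMap_eq fun x => Subtype.ext (IsScalarTower.algebraMap_apply ℤ_[p] K N x)
  have : Nonempty (Module.Free.ChooseBasisIndex (intRing p K) (intRing p K')) := b.index_nonempty
  refine ⟨baseChangeAction hi ρ, fun σ => ⟨fun h => ?_, ?_⟩, hρ'.isUniqueHopfGalois hW',
    exists_orderBaseChangeEquiv hi hO hWb ρ,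
    isFreeOverAssociatedOrder_baseChangeAction_iff hi hO hWb (hρ.mul_comm hW)⟩
  · exact eq_baseChangeAction hi fun a h' x => Subtype.ext (h a h' x _ rfl)
  · rintro rfl a h x y hy
    obtain rfl : y = inclusionExtendScalars hle hLL x := Subtype.ext hy
    rw [baseChangeAction_tmul_apply]
    rfl
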